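/- Let $0<T\le\infty$ and fix $\Theta\in C_c^\infty(\mathbb R^3)$ with $\Theta=1$ on $B_2(0)$ and $\operatorname{supp}\Theta\subset B_4(0)$; put $\theta_R(x)=\Theta(x/R)$. Let $K_{ij}(y)=\partial_i\partial_j\frac1{4\pi|y|}=\frac{-\delta_{ij}|y|^2+3y_iy_j}{4\pi|y|^5}$ and $R_iR_jf(x)=-\frac13\delta_{ij}f(x)+\mathrm{p.v.}\!\int K_{ij}(x-y)f(y)\,dy$. Repeated indices $i,j$ are summed. Write $L^2_{\mathrm{uloc}}(0,T)$ for the measurable $u:\mathbb R^3\times(0,T)\to\mathbb R^3$ with $\operatorname{ess\,sup}_{0<t<T}\sup_{x_0\in\mathbb R^3}\|u(t)\|_{L^2(B_1(x_0))}<\infty$. **Weak solutions.** Let $u_0\in L^1_{\mathrm{loc}}(\mathbb R^3)^3$ be divergence-free (in the sense of distributions). A pair $(u,p)$ with $u\in L^2_{\mathrm{uloc}}(0,T)$ and $p\in\mathcal D'(\mathbb R^3\times(0,T))$ is a weak solution for $u_0$ if $\partial_tu-\Delta u+u\cdot\nabla u+\nabla p=0$ and $\nabla\cdot u=0$ in $\mathcal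 D'(\mathbb R^3\times(0,T))$ (with $u\cdot\nabla u=\nabla\cdot(u\otimes u)$), and if for all $k\in\{1,2,3\}$ and $\psi\in C_0^\infty(\mathbb R^3\times[0,T))$ the limit $\int_{0+}^T\langle p,\partial_k\psi\rangle\,dt=\lim_{\epsilon\to0^+}\int_\epsilon^T\langle p,\partial_k\psi\rangle\,dt$ exists and $$\int_0^T\!\!\int u_k\big(\partial_t\psi+\Delta\psi+u_j\partial_j\psi\big)\,dx\,dt+\int_{0+}^T\langle p,\partial_k\psi\rangle\,dt=-\int u_{0k}\,\psi(\cdot,0)\,dx.$$ Here $\epsilon\mapsto\int_\epsilon^T\langle p,\partial_k\psi\rangle\,dt$ denotes the locally integrable function on $(0,T)$ (required to exist) that vanishes near $T$ and has distributional derivative $-\langle p,\partial_k\psi\rangle\in\mathcal D'(0,T)$, and the limit is taken outside a null set of $\epsilon$. **Local pressure expansion.** For $x_0\in\mathbb R^3$, $R>0$ and a scalar $g\in\mathcal D(B_R(x_0)\times(0,T))$ set $$N_{x_0,R}(g)=\int_0^T\!\!\int u_iu_j\,\theta_R(x_0-x)\,R_iR_jg\,dx\,dt,$$ $$F_{x_0,R}(g)=\int_0^T\!\!\int\!\!\int\big(K_{ij}(x-y)-K_{ij}(x_0-y)\big)\big(1-\theta_R(x_0-y)\big)(u_iu_j)(y,t)\,dy\;g(x,t)\,dx\,dt.$$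 A distribution $p$ satisfies the distributional local pressure expansion for $u$ if for all $x_0\in\mathbb R^3$, $R>0$ there is $c_{x_0,R}\in L^1(0,T)$ such that, for every vector field $\psi\in\mathcal D(B_R(x_0)\times(0,T))^3$ and $g=\nabla\cdot\psi$, the integrals in $N_{x_0,R}(g)$, $F_{x_0,R}(g)$ converge absolutely and $$\langle p-c_{x_0,R}(t),g\rangle=N_{x_0,R}(g)+F_{x_0,R}(g).\tag{1}$$ Further, $\bar p\in\mathcal D'(\mathbb R^3\times(0,T))$ is called an expansion pressure of $u$ if for all $x_0$, $R$ there is $c_{x_0,R}\in L^1(0,T)$ such that this holds with $\bar p$ in place of $p$ for every scalar $g\in\mathcal D(B_R(x_0)\times(0,T))$; this determines $\bar p$ up to a function of $t$ in $L^1(0,T)$. **Theorem 1.2.** Let $u_0\in L^1_{\mathrm{loc}}(\mathbb R^3)^3$ be divergence-free and let $(u,p)$ be a weak solution for $u_0$. Suppose $$\lim_{R\to\infty}\frac1{R^3}\int_{B_R(0)}|u_0|\,dx=0,\qquad \lim_{R\to\infty}\frac1{R^3}\int_0^T\!\!\int_{B_R(0)}|u|^2\,dx\,dt=0.$$ Then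 $p$ satisfies the distributional local pressure expansion for $u$. Moreover, $u$ has an expansion pressure $\bar p$, and $\nabla p=\nabla\bar p$ in $\mathcal D'(\mathbb R^3\times(0,T))$. -/

import Mathlib

open MeasureTheory Filter Topology Set
open scoped Distributions LineDeriv ContDiff

namespace NSPressure

noncomputable section

/-- Euclidean three-space. -/
abbrev E3 : Type := EuclideanSpace ℝ (Fin 3)

/-- Space-time; a point is a pair `(x, t)`. -/
abbrev ST : Type := E3 × ℝ

/-- The open time interval `(a, b)`, with possibly infinite end points. -/
def timeInterval (a b : EReal) : TopologicalSpace.Opens ℝ :=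
  ⟨{t : ℝ | a < (t : EReal) ∧ (t : EReal) < b},
    (isOpen_lt continuous_const continuous_coe_real_ereal).inter
      (isOpen_lt continuous_coe_real_ereal continuous_const)⟩

/-- The open space-time slab `ℝ³ × (a, b)`. -/
def slab (a b : EReal) : TopologicalSpace.Opens ST :=
  ⟨{z : ST | z.2 ∈ timeInterval a b}, (timeInterval a b).isOpen.preimage continuous_snd⟩

/-- The vector `(e_k, 0)` of space-time. -/
def spaceDir (k : Fin 3) : ST := (EuclideanSpace.single k 1, 0)

/-- The vector `(0, 1)` of space-time. -/
def timeDir : ST := (0, 1)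

/-- Spatial Laplacian of a space-time test function. -/
def spaceLaplacian {Ω : TopologicalSpace.Opens ST} (ψ : 𝓓(Ω, ℝ)) : 𝓓(Ω, ℝ) :=
  ∑ k : Fin 3, ∂_{spaceDir k} (∂_{spaceDir k} ψ)

/-- Spatial divergence of a vector-valued space-time test function, given by its components. -/
def spaceDiv {Ω : TopologicalSpace.Opens ST} (ψ : Fin 3 → 𝓓(Ω, ℝ)) : 𝓓(Ω, ℝ) :=
  ∑ k : Fin 3, ∂_{spaceDir k} (ψ k)

/-- The product `(x, t) ↦ lam(t) ψ(x, t)` of a test function in time on `(0, T)` and a test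
function on `ℝ³ × (-∞, T)`; it is a test function on `ℝ³ × (0, T)`. -/
def timeMul {T : EReal} (lam : 𝓓(timeInterval 0 T, ℝ)) (ψ : 𝓓(slab ⊥ T, ℝ)) :
    𝓓(slab 0 T, ℝ) where
  toFun z := lam z.2 * ψ z
  contDiff' := (lam.contDiff.comp contDiff_snd).mul ψ.contDiff
  hasCompactSupport' := ψ.hasCompactSupport.mul_left
  tsupport_subset' := by
    intro z hz
    have h1 : z ∈ tsupport (fun z : ST => lam z.2) :=
      tsupport_mul_subset_left (f := fun z : ST => lam z.2) (g := ψ) hz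
    exact lam.tsupport_subset (tsupport_comp_subset_preimage lam continuous_snd h1)

/-! ### Function classes and the notion of weak solution -/

/-- The norm of `L²_uloc(ℝ³)`: supremum of the `L²` norms over unit balls. -/
def ulocNorm (f : E3 → E3) : ENNReal :=
  ⨆ x₀ : E3, eLpNorm f 2 (volume.restrict (Metric.ball x₀ 1))

/-- The class `L²_uloc(0, T)`: measurable `u : ℝ³ × (0, T) → ℝ³` with
`ess sup_{0 < t < T} ‖u(t)‖_{L²_uloc} < ∞`. -/
def MemL2uloc (T : EReal) (u : ST → E3) : Prop :=
  AEStronglyMeasurable u (volume.restrict (slab 0 T)) ∧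
    essSup (fun t : ℝ => ulocNorm fun x => u (x, t)) (volume.restrict (timeInterval 0 T)) < ⊤

/-- A vector field on `ℝ³` is divergence-free in the sense of distributions. -/
def DivFree (v : E3 → E3) : Prop :=
  ∀ φ : 𝓓((⊤ : TopologicalSpace.Opens E3), ℝ),
    ∫ x, ∑ j : Fin 3, v x j * (∂_{(EuclideanSpace.single j 1 : E3)} φ) x = 0

/-- `∫₀ᵀ ∫ u_k (∂_t ψ + Δ ψ + u_j ∂_j ψ) dx dt`. -/
def velocityTerm (T : EReal) (u : ST → E3) (k : Fin 3) {Ω : TopologicalSpace.Opens ST}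
    (ψ : 𝓓(Ω, ℝ)) : ℝ :=
  ∫ z in slab 0 T, u z k *
    ((∂_{timeDir} ψ) z + spaceLaplacian ψ z + ∑ j : Fin 3, u z j * (∂_{spaceDir j} ψ) z)

/-- `(u, p)` solves the Navier-Stokes equations in `𝓓'(ℝ³ × (0, T))`. -/
structure SolvesNSE (T : EReal) (u : ST → E3) (p : 𝓓'(slab 0 T, ℝ)) : Prop where
  momentum : ∀ (k : Fin 3) (ψ : 𝓓(slab 0 T, ℝ)),
    velocityTerm T u k ψ + p (∂_{spaceDir k} ψ) = 0
  divergence : ∀ ψ : 𝓓(slab 0 T, ℝ),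
    ∫ z in slab 0 T, ∑ j : Fin 3, u z j * (∂_{spaceDir j} ψ) z = 0

/-- `G(ε) = ∫_ε^T ⟨p, χ⟩ dt` for almost every `ε ∈ (0, T)`, where `χ` is smooth with compact
support in `ℝ³ × (-∞, T)`. The distribution `⟨p, χ⟩ ∈ 𝓓'(0, T)` is `lam ↦ p (lam χ)`, and it
vanishes near `T`; its integral from `ε` to `T` is the function `G` with distributional derivative
`-⟨p, χ⟩` which vanishes near `T`. When `⟨p, χ⟩` is a locally integrable function of time this is
the Lebesgue integral. -/
def IsTailIntegral {T : EReal} (p : 𝓓'(slab 0 T, ℝ)) (χ : 𝓓(slab ⊥ T, ℝ)) (G : ℝ → ℝ) : Prop :=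
  LocallyIntegrableOn G (timeInterval 0 T) ∧
  (∃ T' : ℝ, (T' : EReal) < T ∧ ∀ᵐ t ∂volume.restrict (timeInterval 0 T), T' < t → G t = 0) ∧
  ∀ lam : 𝓓(timeInterval 0 T, ℝ),
    ∫ t in timeInterval 0 T, G t * (∂_{(1 : ℝ)} lam) t = p (timeMul lam χ)

/-- The limit `∫_{0+}^T ⟨p, χ⟩ dt = lim_{ε → 0+} ∫_ε^T ⟨p, χ⟩ dt` exists and equals `L`.
Since the integral is determined for almost every `ε` only, exceptional null sets of `ε` are
disregarded in the limit. -/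
def HasImproperIntegral {T : EReal} (p : 𝓓'(slab 0 T, ℝ)) (χ : 𝓓(slab ⊥ T, ℝ)) (L : ℝ) : Prop :=
  ∃ G : ℝ → ℝ, IsTailIntegral p χ G ∧ Tendsto G (𝓝[>] (0 : ℝ) ⊓ ae volume) (𝓝 L)

/-- `(u, p)` is a weak solution of the Navier-Stokes equations on `ℝ³ × (0, T)` with data `u₀`.
Elements of `C_0^∞(ℝ³ × [0, T))` are the restrictions to `t ≥ 0` of test functions on
`ℝ³ × (-∞, T)`. -/
structure IsWeakSolution (T : EReal) (u₀ : E3 → E3) (u : ST → E3) (p : 𝓓'(slab 0 T, ℝ)) :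
    Prop where
  uloc : MemL2uloc T u
  nse : SolvesNSE T u p
  pressure_limit : ∀ (k : Fin 3) (ψ : 𝓓(slab ⊥ T, ℝ)),
    ∃ L : ℝ, HasImproperIntegral p (∂_{spaceDir k} ψ) L
  initial : ∀ (k : Fin 3) (ψ : 𝓓(slab ⊥ T, ℝ)) (L : ℝ),
    HasImproperIntegral p (∂_{spaceDir k} ψ) L →
      velocityTerm T u k ψ + L = - ∫ x, u₀ x k * ψ (x, 0)

/-! ### The local pressure expansion -/

/-- `K_ij(y) = ∂_i ∂_j (1 / (4π|y|)) = (-δ_ij |y|² + 3 y_i y_j) / (4π |y|⁵)`. -/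
def kernelK (i j : Fin 3) (y : E3) : ℝ :=
  (-(if i = j then 1 else 0) * ‖y‖ ^ 2 + 3 * y i * y j) / (4 * Real.pi * ‖y‖ ^ 5)

/-- `R_i R_j f (x) = -(1/3) δ_ij f(x) + p.v. ∫ K_ij(x - y) f(y) dy`. -/
def rieszRR (i j : Fin 3) (f : E3 → ℝ) (x : E3) : ℝ :=
  -(1 / 3) * (if i = j then 1 else 0) * f x +
    limUnder (𝓝[>] (0 : ℝ)) fun ε : ℝ =>
      ∫ y in {y : E3 | ε < ‖x - y‖}, kernelK i j (x - y) * f y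

/-- The fixed cut-off: `Θ ∈ C_c^∞(ℝ³)`, `Θ = 1` on `B_2(0)`, `supp Θ ⊆ B_4(0)`. -/
structure IsCutoff (Θ : E3 → ℝ) : Prop where
  smooth : ContDiff ℝ ∞ Θ
  eq_one : ∀ x ∈ Metric.ball (0 : E3) 2, Θ x = 1
  supp : tsupport Θ ⊆ Metric.ball (0 : E3) 4

/-- `θ_R(x) = Θ(x / R)`. -/
def cutoff (Θ : E3 → ℝ) (R : ℝ) (x : E3) : ℝ := Θ (R⁻¹ • x)

/-- `u_i u_j θ_R(x₀ - x) (R_i R_j g)(x, t)` at `z = (x, t)`, with `R_i R_j` acting in `x`. -/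
def nearIntegrand (Θ : E3 → ℝ) (u : ST → E3) (x₀ : E3) (R : ℝ) (g : ST → ℝ) (i j : Fin 3)
    (z : ST) : ℝ :=
  u z i * u z j * cutoff Θ R (x₀ - z.1) * rieszRR i j (fun x => g (x, z.2)) z.1

/-- `(K_ij(x - y) - K_ij(x₀ - y)) (1 - θ_R(x₀ - y)) u_i(y, t) u_j(y, t)` at `z = (x, t)` and `y`. -/
def farKernel (Θ : E3 → ℝ) (u : ST → E3) (x₀ : E3) (R : ℝ) (i j : Fin 3) (z : ST) (y : E3) : ℝ :=
  (kernelK i j (z.1 - y) - kernelK i j (x₀ - y)) * (1 - cutoff Θ R (x₀ - y)) *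
    (u (y, z.2) i * u (y, z.2) j)

/-- `∫₀ᵀ ⟨p_near, g⟩ dt`. -/
def nearTerm (Θ : E3 → ℝ) (T : EReal) (u : ST → E3) (x₀ : E3) (R : ℝ) (g : ST → ℝ) : ℝ :=
  ∑ i : Fin 3, ∑ j : Fin 3, ∫ z in slab 0 T, nearIntegrand Θ u x₀ R g i j z

/-- `∫₀ᵀ ⟨p_far, g⟩ dt`. -/
def farTerm (Θ : E3 → ℝ) (T : EReal) (u : ST → E3) (x₀ : E3) (R : ℝ) (g : ST → ℝ) : ℝ :=
  ∑ i : Fin 3, ∑ j : Fin 3, ∫ z in slab 0 T, (∫ y, farKernel Θ u x₀ R i j z y) * g z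

/-- `⟨p - c(t), g⟩ = ⟨p_near, g⟩ + ⟨p_far, g⟩`, all integrals on the right being absolutely
convergent. -/
def ExpansionHolds (Θ : E3 → ℝ) (T : EReal) (u : ST → E3) (p : 𝓓'(slab 0 T, ℝ))
    (x₀ : E3) (R : ℝ) (c : ℝ → ℝ) (g : 𝓓(slab 0 T, ℝ)) : Prop :=
  (∀ i j, Integrable (nearIntegrand Θ u x₀ R g i j) (volume.restrict (slab 0 T))) ∧
  (∀ i j, Integrable (fun w : ST × E3 => farKernel Θ u x₀ R i j w.1 w.2 * g w.1)
    ((volume.restrict (slab 0 T)).prod volume)) ∧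
  p g - ∫ z in slab 0 T, c z.2 * g z = nearTerm Θ T u x₀ R g + farTerm Θ T u x₀ R g

/-- `p` satisfies the distributional local pressure expansion for `u`: on every ball `B_R(x₀)` the
expansion holds, up to a function `c ∈ L¹(0, T)` of time, against the divergence of every
vector field `ψ ∈ 𝓓(B_R(x₀) × (0, T))³`. -/
def SatisfiesLocalPressureExpansion (Θ : E3 → ℝ) (T : EReal) (u : ST → E3)
    (p : 𝓓'(slab 0 T, ℝ)) : Prop :=
  ∀ (x₀ : E3) (R : ℝ), 0 < R → ∃ c : ℝ → ℝ, IntegrableOn c (timeInterval 0 T) ∧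
    ∀ ψ : Fin 3 → 𝓓(slab 0 T, ℝ),
      (∀ k, tsupport (ψ k) ⊆ Metric.ball x₀ R ×ˢ (univ : Set ℝ)) →
        ExpansionHolds Θ T u p x₀ R c (spaceDiv ψ)

/-- `q` is a pressure `p̄` given by the local pressure expansion for `u`: on every ball `B_R(x₀)`
the expansion holds, up to a function `c ∈ L¹(0, T)` of time, against every scalar
`g ∈ 𝓓(B_R(x₀) × (0, T))`. This determines `q` up to a function of time in `L¹(0, T)`. -/
def IsExpansionPressure (Θ : E3 → ℝ) (T : EReal) (u : ST → E3) (q : 𝓓'(slab 0 T, ℝ)) : Prop :=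
  ∀ (x₀ : E3) (R : ℝ), 0 < R → ∃ c : ℝ → ℝ, IntegrableOn c (timeInterval 0 T) ∧
    ∀ g : 𝓓(slab 0 T, ℝ), tsupport g ⊆ Metric.ball x₀ R ×ˢ (univ : Set ℝ) →
      ExpansionHolds Θ T u q x₀ R c g

end

end NSPressure

open NSPressure

/-! Let E(z) = 1/(4π|z|), so that -ΔE = δ and R_iR_j g = E * ∂_i∂_j g (`integral_newton_mul_pd_pd`).
The divergence of the momentum equation reads -Δp = ∂_i∂_j(u_i u_j), which formally gives p(g) = ∫
u_i u_j R_iR_j g. The difficulty lies at infinity: R_iR_j g behaves like K_ij(y) ∫ g, of order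
|y|^{-3}, while the growth o(R³) of ∫∫_{B_R} |u|² only makes |u|² integrable against (1 + |y|)^{-4}
(`velocityDecay_of_tendsto`).

Construction of an expansion pressure. Subtracting `anchor` times ∫ g removes the leading term of
R_iR_j g and leaves O(|y|^{-4}) (`rieszRR_sub_anchor_bound`). The resulting integral defines a
distribution for any base ball. Fubini splits it into the near and far terms (`near_add_far_eq`),
and changing the base ball costs only an L¹ function of time (`expansionFunctional_sub`), because
two anchors differ by O(|y|^{-4}).

Identification of the gradient. On g = ∂_kψ the anchor disappears, since ∫ g = 0. Let η_R be a
cut-off at scale R and test the pressure equation with χ = (η_R E) * ∂_kψ. Then Δχ = -∂_kψ - τ_R *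
∂_kψ, where τ_R = Δ((1 - η_R)E) is smooth, of size R^{-3} and supported in |z| ≤ 2R. The term
p(∂_k(τ_R * ψ)) is rewritten by the momentum equation itself as an integral in u alone. This gives
an exact identity (`SolvesNSE.pressure_sub_expansionFunctional`): p(∂_kψ) minus the expansion is the
velocity term of τ_R * ψ minus Σ ∫ u_i u_j (∂_i∂_j((1 - η_R)E) * ∂_kψ). The first tends to zero
because R^{-3} ∫ (|u| + |u|²) over B_{3R} and a bounded time interval does; the second by dominated
convergence, its kernel being O(min((1 + |x|)^{-4}, R^{-4})). No harmonic or time-dependent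
ambiguity survives, so ∇p is the gradient of the expansion pressure. -/

namespace NSPressure

noncomputable section

/-! ### Partial derivatives, test functions, and the Newton potential with its kernels -/

section

/-- The `j`-th standard basis vector of `ℝ³`. -/
abbrev basisVec (j : Fin 3) : E3 := EuclideanSpace.single j 1

/-- The `j`-th partial derivative. -/
def pd (j : Fin 3) (f : E3 → ℝ) (z : E3) : ℝ := fderiv ℝ f z (basisVec j)

/-- Smooth functions of compact support on `ℝ³`. -/
structure IsTest (g : E3 → ℝ) : Prop where
  smooth : ContDiff ℝ ∞ g
  supp : HasCompactSupport g

theorem contDiff_pd {f : E3 → ℝ} (hf : ContDiff ℝ ∞ f) (j : Fin 3) : ContDiff ℝ ∞ (pd j f) :=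
  (hf.fderiv_right (m := ∞) (by simp)).clm_apply contDiff_const

theorem tsupport_pd_subset (f : E3 → ℝ) (j : Fin 3) : tsupport (pd j f) ⊆ tsupport f := by
  refine closure_minimal ?_ (isClosed_tsupport f)
  intro x hx
  by_contra h
  apply hx
  have : fderiv ℝ f x = 0 := by
    have := (tsupport_fderiv_subset ℝ (f := f))
    exact image_eq_zero_of_notMem_tsupport fun h' => h (this h')
  simp [pd, this]

theorem IsTest.pd {g : E3 → ℝ} (hg : IsTest g) (j : Fin 3) : IsTest (pd j g) :=
  ⟨contDiff_pd hg.smooth j, hg.supp.mono' ((subset_tsupport _).trans (tsupport_pd_subset g j))⟩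

theorem IsTest.integrable {g : E3 → ℝ} (hg : IsTest g) : Integrable g :=
  hg.smooth.continuous.integrable_of_hasCompactSupport hg.supp

theorem pd_comm {f : E3 → ℝ} (hf : ContDiff ℝ ∞ f) (i j : Fin 3) :
    pd i (pd j f) = pd j (pd i f) := by
  funext x
  have h : ∀ a b : E3, fderiv ℝ (fun y => fderiv ℝ f y a) x b = fderiv ℝ (fderiv ℝ f) x b a := by
    intro a b
    rw [fderiv_clm_apply]
    · simp
    · exact ((hf.fderiv_right (m := ∞) (by simp)).differentiable (by simp)).differentiableAt
    · exact differentiableAt_const _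
  change fderiv ℝ (fun y => fderiv ℝ f y (basisVec j)) x (basisVec i) =
    fderiv ℝ (fun y => fderiv ℝ f y (basisVec i)) x (basisVec j)
  rw [h, h]
  exact (hf.contDiffAt.isSymmSndFDerivAt (by simpa using ENat.LEInfty.out)) _ _

theorem IsTest.comp_sub {g : E3 → ℝ} (hg : IsTest g) (x : E3) : IsTest fun z => g (x - z) := by
  refine ⟨hg.smooth.comp (contDiff_const.sub contDiff_id), ?_⟩
  have := hg.supp.comp_homeomorph (Homeomorph.subLeft x)
  exact this

theorem pd_comp_sub {g : E3 → ℝ} (hg : Differentiable ℝ g) (x z : E3) (i : Fin 3) :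
    pd i (fun z => g (x - z)) z = - pd i g (x - z) := by
  have h := (hg (x - z)).hasFDerivAt.comp z ((hasFDerivAt_id z).const_sub x)
  unfold pd
  change fderiv ℝ (g ∘ fun z => x - z) z _ = _
  rw [h.fderiv]
  simp

/-- Integration by parts in a convolution integral. -/
theorem integral_mul_pd_comp_sub {f g : E3 → ℝ} (hf : ContDiff ℝ ∞ f) (hg : IsTest g) (x : E3)
    (i : Fin 3) : ∫ z, f z * pd i g (x - z) = ∫ z, pd i f z * g (x - z) := by
  have hgx := hg.comp_sub x
  have hd : Differentiable ℝ g := hg.smooth.differentiable (by simp)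
  have e : ∀ z, pd i g (x - z) = - fderiv ℝ (fun z => g (x - z)) z (basisVec i) := by
    intro z
    have := pd_comp_sub hd x z i
    unfold pd at *
    rw [this, neg_neg]
  have key := integral_mul_fderiv_eq_neg_fderiv_mul_of_integrable (μ := (volume : Measure E3))
    (f := f) (g := fun z => g (x - z)) (v := basisVec i)
    (((contDiff_pd hf i).continuous.mul hgx.smooth.continuous).integrable_of_hasCompactSupport
      hgx.supp.mul_left)
    ((hf.continuous.mul (hgx.pd i).smooth.continuous).integrable_of_hasCompactSupport
      (hgx.pd i).supp.mul_left)
    ((hf.continuous.mul hgx.smooth.continuous).integrable_of_hasCompactSupport hgx.supp.mul_left)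
    (fun z _ => (hf.differentiable (by simp)).differentiableAt)
    (fun z _ => (hgx.smooth.differentiable (by simp)).differentiableAt)
  simp_rw [e, mul_neg, integral_neg, key, neg_neg]
  rfl

theorem integral_mul_pd_pd_comp_sub {f g : E3 → ℝ} (hf : ContDiff ℝ ∞ f) (hg : IsTest g) (x : E3)
    (i j : Fin 3) : ∫ z, f z * pd i (pd j g) (x - z) = ∫ z, pd i (pd j f) z * g (x - z) := by
  rw [integral_mul_pd_comp_sub hf (hg.pd j), integral_mul_pd_comp_sub (contDiff_pd hf i) hg,
    pd_comm hf]

/-! ### The regularized Newton potential -/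

/-- `(|z|² + a)^p`. -/
def japanese (a p : ℝ) (z : E3) : ℝ := (‖z‖ ^ 2 + a) ^ p

theorem contDiffAt_japanese {a : ℝ} (p : ℝ) {z : E3} (h : 0 < ‖z‖ ^ 2 + a) :
    ContDiffAt ℝ ∞ (japanese a p) z :=
  (((contDiff_norm_sq ℝ).contDiffAt.add contDiffAt_const)).rpow_const_of_ne h.ne'

theorem pd_japanese {a : ℝ} (p : ℝ) {z : E3} (h : 0 < ‖z‖ ^ 2 + a) (i : Fin 3) :
    pd i (japanese a p) z = 2 * p * z i * japanese a (p - 1) z := by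
  have h1 : HasFDerivAt (fun z : E3 => ‖z‖ ^ 2 + a) (2 • innerSL ℝ z) z :=
    ((hasStrictFDerivAt_norm_sq z).hasFDerivAt).add_const a
  have h2 := h1.rpow_const (p := p) (Or.inl h.ne')
  unfold pd
  change fderiv ℝ (fun z : E3 => (‖z‖ ^ 2 + a) ^ p) z _ = _
  rw [h2.fderiv]
  simp [japanese, EuclideanSpace.inner_single_right]
  ring

theorem pd_coord_mul {f : E3 → ℝ} {z : E3} (hf : DifferentiableAt ℝ f z) (i j : Fin 3) :
    pd i (fun z => z j * f z) z = (if i = j then 1 else 0) * f z + z j * pd i f z := by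
  have h1 : HasFDerivAt (fun z : E3 => z j) (EuclideanSpace.proj j : E3 →L[ℝ] ℝ) z :=
    (EuclideanSpace.proj j : E3 →L[ℝ] ℝ).hasFDerivAt
  unfold pd
  change fderiv ℝ ((fun z : E3 => z j) * f) z _ = _
  rw [(h1.mul hf.hasFDerivAt).fderiv]
  simp [eq_comm]
  ring

theorem pd_congr {f g : E3 → ℝ} {z : E3} (h : f =ᶠ[𝓝 z] g) (i : Fin 3) : pd i f z = pd i g z := by
  unfold pd; rw [h.fderiv_eq]

theorem pd_eventuallyEq {f g : E3 → ℝ} {z : E3} (h : f =ᶠ[𝓝 z] g) (i : Fin 3) :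
    pd i f =ᶠ[𝓝 z] pd i g :=
  h.eventuallyEq_nhds.mono fun _ hy => pd_congr hy i

theorem pd_const_mul {f : E3 → ℝ} (c : ℝ) (z : E3) (i : Fin 3) :
    pd i (fun z => c * f z) z = c * pd i f z := by
  unfold pd
  have : fderiv ℝ (fun z => c * f z) z = c • fderiv ℝ f z :=
    congrFun (fderiv_const_smul_field (f := f) c) z
  rw [this]; simp

/-- The regularized Newton potential `1 / (4π √(|z|² + a))`. -/
def regNewton (a : ℝ) (z : E3) : ℝ := (4 * Real.pi)⁻¹ * japanese a (-(1 / 2)) z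

/-- The trace-free part of the second derivatives of the regularized Newton potential. -/
def regKernel (a : ℝ) (i j : Fin 3) (z : E3) : ℝ :=
  (4 * Real.pi)⁻¹ * ((-(if i = j then 1 else 0) * ‖z‖ ^ 2 + 3 * z i * z j) * japanese a (-(5 / 2)) z)

/-- Writing (|z|² + a)^{-3/2} = (|z|² + a)(|z|² + a)^{-5/2} separates a trace-free kernel, which
converges to K_ij as a → 0, from a diagonal remainder. The remainder is one third of an approximate
identity and is the origin of the term -(1/3) δ_ij f in R_iR_j f. -/
theorem pd_pd_regNewton {a : ℝ} {z : E3} (h : 0 < ‖z‖ ^ 2 + a) (i j : Fin 3) :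
    pd i (pd j (regNewton a)) z = regKernel a i j z -
      (if i = j then 1 else 0) * ((4 * Real.pi)⁻¹ * (a * japanese a (-(5 / 2)) z)) := by
  have hopen : ∀ᶠ y in 𝓝 z, 0 < ‖y‖ ^ 2 + a :=
    (isOpen_lt continuous_const (by fun_prop : Continuous fun y : E3 => ‖y‖ ^ 2 + a)).mem_nhds h
  have h1 : pd j (regNewton a) =ᶠ[𝓝 z]
      fun y => -(4 * Real.pi)⁻¹ * (y j * japanese a (-(3 / 2)) y) := by
    filter_upwards [hopen] with y hy
    have : pd j (regNewton a) y = _ := pd_const_mul (f := japanese a (-(1 / 2))) _ y j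
    rw [this, pd_japanese _ hy]
    norm_num
  rw [pd_congr h1, pd_const_mul, pd_coord_mul, pd_japanese _ h]
  · have h2 : japanese a (-(3 / 2)) z = (‖z‖ ^ 2 + a) * japanese a (-(5 / 2)) z := by
      unfold japanese
      rw [← Real.rpow_one_add' h.le (by norm_num)]
      norm_num
    rw [h2, regKernel, show (-(3 / 2) - 1 : ℝ) = -(5 / 2) by norm_num]
    split_ifs <;> ring
  · exact (contDiffAt_japanese _ h).differentiableAt (by simp)

theorem japanese_zero (p : ℝ) (z : E3) : japanese 0 p z = ‖z‖ ^ (2 * p) := by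
  unfold japanese
  rw [add_zero, ← Real.rpow_natCast, ← Real.rpow_mul (norm_nonneg _)]
  simp

theorem regKernel_zero (i j : Fin 3) (z : E3) : regKernel 0 i j z = kernelK i j z := by
  rw [regKernel, kernelK, japanese_zero, show (2 * -(5 / 2) : ℝ) = -(5 : ℕ) by norm_num,
    Real.rpow_neg (norm_nonneg _), Real.rpow_natCast]
  rw [div_eq_mul_inv, mul_inv (4 * Real.pi)]
  ring

theorem pd_pd_newton {z : E3} (h : z ≠ 0) (i j : Fin 3) :
    pd i (pd j (regNewton 0)) z = kernelK i j z := by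
  rw [pd_pd_regNewton (by positivity), regKernel_zero]
  simp

theorem contDiffAt_regNewton {a : ℝ} {z : E3} (h : 0 < ‖z‖ ^ 2 + a) :
    ContDiffAt ℝ ∞ (regNewton a) z :=
  contDiffAt_const.mul (contDiffAt_japanese _ h)

theorem contDiff_regNewton {a : ℝ} (ha : 0 < a) : ContDiff ℝ ∞ (regNewton a) :=
  contDiff_iff_contDiffAt.2 fun _ => contDiffAt_regNewton (by positivity)

theorem regNewton_zero (z : E3) : regNewton 0 z = (4 * Real.pi)⁻¹ * ‖z‖⁻¹ := by
  rw [regNewton, japanese_zero, show (2 * -(1 / 2) : ℝ) = -1 by norm_num, Real.rpow_neg_one]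

theorem japanese_le {a p : ℝ} (ha : 0 ≤ a) (hp : p ≤ 0) {z : E3} (hz : z ≠ 0) :
    japanese a p z ≤ japanese 0 p z := by
  unfold japanese
  have : 0 < ‖z‖ := norm_pos_iff.2 hz
  exact Real.rpow_le_rpow_of_nonpos (by positivity) (by simpa using ha) hp

theorem japanese_nonneg {a : ℝ} (ha : 0 ≤ a) (p : ℝ) (z : E3) : 0 ≤ japanese a p z := by
  unfold japanese; positivity

theorem abs_coord_le (z : E3) (i : Fin 3) : |z i| ≤ ‖z‖ := by
  simpa using PiLp.norm_apply_le z i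

theorem abs_numerator_le (i j : Fin 3) (z : E3) :
    |(-(if i = j then 1 else 0) * ‖z‖ ^ 2 + 3 * z i * z j : ℝ)| ≤ 4 * ‖z‖ ^ 2 := by
  have h1 : |z i * z j| ≤ ‖z‖ ^ 2 := by
    rw [abs_mul, sq]
    exact mul_le_mul (abs_coord_le z i) (abs_coord_le z j) (abs_nonneg _) (norm_nonneg _)
  rw [abs_le] at *
  split_ifs <;> constructor <;> nlinarith [sq_nonneg ‖z‖]

/-- The bound is uniform in a, so that it can serve as the majorant when a → 0. -/
theorem abs_regKernel_le {a : ℝ} (ha : 0 ≤ a) (i j : Fin 3) {z : E3} (hz : z ≠ 0) :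
    |regKernel a i j z| ≤ ‖z‖ ^ (-3 : ℝ) := by
  have hn : 0 < ‖z‖ := norm_pos_iff.2 hz
  have h1 : |regKernel a i j z| ≤ (4 * Real.pi)⁻¹ * (4 * ‖z‖ ^ 2 * ‖z‖ ^ (-5 : ℝ)) := by
    rw [regKernel, abs_mul, abs_mul, abs_of_nonneg (by positivity : 0 ≤ (4 * Real.pi)⁻¹),
      abs_of_nonneg (japanese_nonneg ha _ z)]
    have := japanese_le (p := -(5 / 2)) ha (by norm_num) hz
    rw [japanese_zero, show (2 * -(5 / 2) : ℝ) = -5 by norm_num] at this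
    gcongr
    · exact japanese_nonneg ha _ z
    · exact abs_numerator_le i j z
  refine h1.trans ?_
  have h2 : ‖z‖ ^ 2 * ‖z‖ ^ (-5 : ℝ) = ‖z‖ ^ (-3 : ℝ) := by
    rw [← Real.rpow_natCast, ← Real.rpow_add hn]; norm_num
  rw [mul_assoc 4, h2, ← mul_assoc]
  have h3 : (4 * Real.pi)⁻¹ * 4 ≤ 1 := by
    rw [mul_inv, mul_comm, ← mul_assoc, mul_inv_cancel₀ (by norm_num), one_mul]
    exact inv_le_one_of_one_le₀ (by linarith [Real.pi_gt_three])
  calc _ ≤ 1 * ‖z‖ ^ (-3 : ℝ) := by gcongr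
    _ = _ := one_mul _

theorem abs_kernelK_le (i j : Fin 3) (z : E3) : |kernelK i j z| ≤ ‖z‖ ^ (-3 : ℝ) := by
  rcases eq_or_ne z 0 with rfl | hz
  · simp [kernelK]
  · rw [← regKernel_zero]
    exact abs_regKernel_le le_rfl i j hz

theorem kernelK_neg (i j : Fin 3) (z : E3) : kernelK i j (-z) = kernelK i j z := by
  simp [kernelK]

theorem kernelK_smul (i j : Fin 3) {s : ℝ} (hs : 0 < s) (z : E3) :
    kernelK i j (s • z) = (s ^ 3)⁻¹ * kernelK i j z := by
  simp only [kernelK, norm_smul, Real.norm_eq_abs, abs_of_pos hs, PiLp.smul_apply, smul_eq_mul]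
  rcases eq_or_ne z 0 with rfl | hz
  · simp
  have hn : 0 < ‖z‖ := norm_pos_iff.2 hz
  field_simp

theorem sum_kernelK_diag (z : E3) : ∑ i, kernelK i i z = 0 := by
  have h : ‖z‖ ^ 2 = z 0 ^ 2 + z 1 ^ 2 + z 2 ^ 2 := by
    rw [EuclideanSpace.norm_sq_eq]; simp [Fin.sum_univ_three]
  simp only [kernelK, Fin.sum_univ_three, if_true]
  rw [← add_div, ← add_div]
  simp [h]
  left; ring

theorem contDiffAt_kernelK (i j : Fin 3) {z : E3} (hz : z ≠ 0) :
    ContDiffAt ℝ ∞ (kernelK i j) z := by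
  have hn : 0 < ‖z‖ := norm_pos_iff.2 hz
  have hc : ∀ k : Fin 3, ContDiff ℝ ∞ fun z : E3 => z k := fun k =>
    (EuclideanSpace.proj k : E3 →L[ℝ] ℝ).contDiff
  have : kernelK i j = regKernel 0 i j := by
    funext z; rw [regKernel_zero]
  rw [this]
  unfold regKernel
  refine contDiffAt_const.mul (ContDiffAt.mul ?_ (contDiffAt_japanese _ (by positivity)))
  exact ((contDiff_const.mul (contDiff_norm_sq ℝ)).add
    ((contDiff_const.mul (hc i)).mul (hc j))).contDiffAt

theorem measurable_kernelK (i j : Fin 3) : Measurable (kernelK i j) := by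
  unfold kernelK; fun_prop

theorem measurable_regKernel (a : ℝ) (i j : Fin 3) : Measurable (regKernel a i j) := by
  unfold regKernel japanese; fun_prop

theorem measurable_regNewton (a : ℝ) : Measurable (regNewton a) := by
  unfold regNewton japanese; fun_prop

end

/-! ### Zero mean of the kernel and convergence of the principal value -/

section

theorem integrableOn_ball_norm_rpow {p : ℝ} (hp : -3 < p) (r : ℝ) :
    IntegrableOn (fun z : E3 => ‖z‖ ^ p) (Metric.ball 0 r) := by
  rw [integrableOn_fun_norm_addHaar (μ := (volume : Measure E3)) (f := fun s : ℝ => s ^ p)]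
  simp only [finrank_euclideanSpace, Fintype.card_fin, smul_eq_mul]
  rcases le_or_gt r 0 with hr | hr
  · simp [Ioo_eq_empty (not_lt.2 hr)]
  have h : IntegrableOn (fun s : ℝ => s ^ (p + 2)) (Ioo 0 r) :=
    (intervalIntegral.integrableOn_Ioo_rpow_iff hr).2 (by linarith)
  refine h.congr_fun (fun s hs => ?_) measurableSet_Ioo
  have hs' : 0 < s := hs.1
  simp only
  rw [Real.rpow_add hs', mul_comm]
  norm_num

theorem ball_subset_of_hasCompactSupport {g : E3 → ℝ} (hg : HasCompactSupport g) :
    ∃ ρ : ℝ, 0 < ρ ∧ ∀ z, ρ ≤ ‖z‖ → g z = 0 := by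
  obtain ⟨ρ, h0, h⟩ := hg.isCompact.isBounded.subset_ball_lt 0 0
  refine ⟨ρ, h0, fun z hz => image_eq_zero_of_notMem_tsupport fun h' => ?_⟩
  have := h h'
  simp at this
  linarith

theorem integrable_norm_rpow_mul {p : ℝ} (hp : -3 < p) {f : E3 → ℝ} (hf : AEStronglyMeasurable f)
    {ρ C : ℝ} (hC : ∀ z, |f z| ≤ C) (hρ : ∀ z, ρ ≤ ‖z‖ → f z = 0) :
    Integrable fun z => ‖z‖ ^ p * f z := by
  have h1 : IntegrableOn (fun z : E3 => ‖z‖ ^ p * f z) (Metric.ball 0 ρ) :=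
    (integrableOn_ball_norm_rpow hp ρ).mul_bdd (c := C) hf.restrict
      (Eventually.of_forall fun z => hC z)
  rw [IntegrableOn] at h1
  rw [← integrableOn_iff_integrable_of_support_subset (s := Metric.ball 0 ρ)]
  · exact h1
  · intro z hz
    by_contra h
    apply hz
    simp at h
    simp [hρ z h]

/-! ### Symmetry -/

/-- The reflection of the `i`-th coordinate. -/
def reflect (i : Fin 3) : E3 ≃ₗᵢ[ℝ] E3 :=
  LinearIsometryEquiv.piLpCongrRight 2 fun k =>
    if k = i then LinearIsometryEquiv.neg ℝ else LinearIsometryEquiv.refl ℝ ℝ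

theorem reflect_apply (i k : Fin 3) (z : E3) :
    reflect i z k = if k = i then - z k else z k := by
  simp only [reflect, LinearIsometryEquiv.piLpCongrRight_apply]
  split_ifs <;> simp

/-- The permutation of coordinates. -/
def permute (σ : Equiv.Perm (Fin 3)) : E3 ≃ₗᵢ[ℝ] E3 :=
  LinearIsometryEquiv.piLpCongrLeft 2 ℝ ℝ σ

theorem permute_apply (σ : Equiv.Perm (Fin 3)) (z : E3) (k : Fin 3) :
    permute σ z k = z (σ.symm k) := by
  simp [permute, Equiv.piCongrLeft'_apply]

/-- Off the diagonal, reflecting the i-th coordinate changes the sign of the integrand. On the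
diagonal, permuting coordinates shows that the three integrals agree, and their sum vanishes because
the integrands add up to zero. -/
theorem integral_trace_free_eq_zero (w : ℝ → ℝ)
    (hw : ∀ i j : Fin 3, Integrable fun z : E3 =>
      (-(if i = j then 1 else 0) * ‖z‖ ^ 2 + 3 * z i * z j) * w ‖z‖) (i j : Fin 3) :
    ∫ z : E3, (-(if i = j then 1 else 0) * ‖z‖ ^ 2 + 3 * z i * z j) * w ‖z‖ = 0 := by
  set k : Fin 3 → Fin 3 → E3 → ℝ := fun i j z =>
    (-(if i = j then 1 else 0) * ‖z‖ ^ 2 + 3 * z i * z j) * w ‖z‖ with hk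
  change ∫ z, k i j z = 0
  have hinv : ∀ (e : E3 ≃ₗᵢ[ℝ] E3) (f : E3 → ℝ), ∫ z, f (e z) = ∫ z, f z := fun e f =>
    e.measurePreserving.integral_comp e.toHomeomorph.measurableEmbedding f
  by_cases hij : i = j
  · subst hij
    have hperm : ∀ l, ∫ z, k l l z = ∫ z, k i i z := by
      intro l
      rw [← hinv (permute (Equiv.swap i l)) (k l l)]
      congr 1; funext z
      simp [hk, permute_apply]
    have hsum : ∑ l, ∫ z, k l l z = 0 := by
      rw [← integral_finsetSum _ fun l _ => hw l l]
      refine integral_eq_zero_of_ae (Eventually.of_forall fun z => ?_)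
      have h : ‖z‖ ^ 2 = z 0 ^ 2 + z 1 ^ 2 + z 2 ^ 2 := by
        rw [EuclideanSpace.norm_sq_eq]; simp [Fin.sum_univ_three]
      simp only [if_true, Fin.sum_univ_three, Pi.zero_apply, h]
      ring
    simp_rw [hperm] at hsum
    simpa using hsum
  · have h1 := hinv (reflect i) (k i j)
    have h2 : ∀ z, k i j (reflect i z) = - k i j z := by
      intro z
      simp [hk, reflect_apply, hij, Ne.symm hij]
    simp_rw [h2, integral_neg] at h1
    linarith

/-! ### The principal value integral -/

theorem lipschitz_of_isTest {g : E3 → ℝ} (hg : IsTest g) :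
    ∃ C : ℝ, 0 ≤ C ∧ ∀ x y, |g x - g y| ≤ C * ‖x - y‖ := by
  obtain ⟨C, hC⟩ := hg.smooth.lipschitzWith_of_hasCompactSupport hg.supp (by simp)
  exact ⟨C, C.2, fun x y => by simpa [dist_eq_norm] using hC.dist_le_mul x y⟩

/-- The increment `g(x - z) - g(x) 1_{|z| < 1}`. -/
def increment (g : E3 → ℝ) (x z : E3) : ℝ :=
  g (x - z) - g x * (Metric.ball (0 : E3) 1).indicator 1 z

theorem measurable_increment {g : E3 → ℝ} (hg : IsTest g) (x : E3) : Measurable (increment g x) := by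
  unfold increment
  refine (hg.smooth.continuous.measurable.comp (by fun_prop)).sub (measurable_const.mul ?_)
  exact measurable_one.indicator measurableSet_ball

/-- Inside the unit ball this is the Lipschitz bound for g. Outside it the increment is g(x - z),
bounded by the supremum of |g| and hence by that supremum times |z|. -/
theorem exists_increment_bound {g : E3 → ℝ} (hg : IsTest g) (x : E3) :
    ∃ C ρ : ℝ, (∀ z, |increment g x z| ≤ C * ‖z‖) ∧ (∀ z, ρ ≤ ‖z‖ → increment g x z = 0) := by
  obtain ⟨C, hC0, hC⟩ := lipschitz_of_isTest hg
  obtain ⟨ρ, hρ0, hρ⟩ := ball_subset_of_hasCompactSupport (hg.comp_sub x).supp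
  obtain ⟨M, hM⟩ := hg.smooth.continuous.bounded_above_of_compact_support hg.supp
  have hM0 : 0 ≤ M := (norm_nonneg _).trans (hM 0)
  refine ⟨C + M, max ρ 1, fun z => ?_, fun z hz => ?_⟩
  · unfold increment
    by_cases h : z ∈ Metric.ball (0 : E3) 1
    · have h1 := hC (x - z) x
      simp [indicator_of_mem h] at h1 ⊢
      nlinarith [norm_nonneg z]
    · have h1 := hM (x - z)
      simp [indicator_of_notMem h] at h1 ⊢
      simp at h
      nlinarith
  · have h1 := hρ z ((le_max_left _ _).trans hz)
    have h2 : z ∉ Metric.ball (0 : E3) 1 := by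
      simpa using (le_max_right _ _).trans hz
    simp [increment, h1, indicator_of_notMem h2]

/-- Dividing the increment by |z| leaves a bounded function of bounded support, so the singularity
is only |z|^{-2}, integrable in dimension three. This is the common majorant for truncating and for
regularizing the kernel. -/
theorem integrable_norm_rpow_mul_increment {g : E3 → ℝ} (hg : IsTest g) (x : E3) :
    Integrable fun z => ‖z‖ ^ (-3 : ℝ) * |increment g x z| := by
  obtain ⟨C, ρ, hC, hρ⟩ := exists_increment_bound hg x
  have h := integrable_norm_rpow_mul (p := -2) (by norm_num) (f := fun z => |increment g x z| / ‖z‖)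
    (((measurable_increment hg x).abs.div measurable_norm).aestronglyMeasurable) (ρ := ρ)
    (C := max C 0) (fun z => ?_) (fun z hz => by simp [hρ z hz])
  · refine h.congr (Eventually.of_forall fun z => ?_)
    rcases eq_or_ne z 0 with rfl | hz
    · have := hC 0
      simp at this
      simp [this]
    have hn : 0 < ‖z‖ := norm_pos_iff.2 hz
    simp only
    rw [show (-3 : ℝ) = -2 - 1 by norm_num, Real.rpow_sub_one hn.ne']
    ring
  · rw [abs_div, abs_abs, abs_norm]
    rcases eq_or_ne z 0 with rfl | hz
    · simp
    rw [div_le_iff₀ (norm_pos_iff.2 hz)]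
    exact (hC z).trans (by gcongr; exact le_max_left _ _)

theorem integrable_regKernel_mul_increment {g : E3 → ℝ} (hg : IsTest g) (x : E3) {a : ℝ}
    (ha : 0 ≤ a) (i j : Fin 3) : Integrable fun z => regKernel a i j z * increment g x z := by
  refine (integrable_norm_rpow_mul_increment hg x).mono'
    ((measurable_regKernel a i j).mul (measurable_increment hg x)).aestronglyMeasurable ?_
  filter_upwards [volume.ae_ne (0 : E3)] with z hz
  rw [norm_mul]
  exact mul_le_mul_of_nonneg_right (abs_regKernel_le ha i j hz) (abs_nonneg _)

theorem integrable_kernelK_mul_increment {g : E3 → ℝ} (hg : IsTest g) (x : E3) (i j : Fin 3) :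
    Integrable fun z => kernelK i j z * increment g x z := by
  simpa only [regKernel_zero] using integrable_regKernel_mul_increment hg x le_rfl i j

theorem integral_kernelK_annulus (i j : Fin 3) {ε : ℝ} (hε : 0 < ε) :
    ∫ z in {z : E3 | ε < ‖z‖}, kernelK i j z * (Metric.ball (0 : E3) 1).indicator 1 z = 0 := by
  have hms : MeasurableSet {z : E3 | ε < ‖z‖} := measurableSet_lt measurable_const measurable_norm
  rw [← integral_indicator hms]
  have := integral_trace_free_eq_zero
    (fun r => (Ioo ε 1).indicator (fun r => (4 * Real.pi * r ^ 5)⁻¹) r) (fun i j => ?_) i j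
  · rw [← this]
    congr 1; funext z
    by_cases h1 : ε < ‖z‖
    · by_cases h2 : ‖z‖ < 1
      · simp [indicator, h1, h2, kernelK, div_eq_mul_inv]
      · simp [indicator, h1, h2]
    · simp [indicator, h1]
  · refine Measure.integrableOn_of_bounded (s := Metric.ball 0 1) (M := ε ^ (-3 : ℝ))
      measure_ball_lt_top.ne ?_ ?_ |>.integrable_of_forall_notMem_eq_zero fun z hz => ?_
    · have : Measurable fun r => (Ioo ε 1).indicator (fun r : ℝ => (4 * Real.pi * r ^ 5)⁻¹) r :=
        Measurable.indicator (by fun_prop) measurableSet_Ioo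
      exact (Measurable.mul (by fun_prop) (this.comp measurable_norm)).aestronglyMeasurable
    · refine Eventually.of_forall fun z => ?_
      by_cases h : ‖z‖ ∈ Ioo ε 1
      · rw [indicator_of_mem h, ← div_eq_mul_inv]
        refine (abs_kernelK_le i j z).trans ?_
        exact Real.rpow_le_rpow_of_nonpos hε h.1.le (by norm_num)
      · simp [indicator_of_notMem h]; positivity
    · have : ‖z‖ ∉ Ioo ε 1 := fun h => hz (by simpa using h.2)
      simp [indicator_of_notMem this]

theorem integral_regKernel_ball {a : ℝ} (ha : 0 < a) (i j : Fin 3) :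
    ∫ z : E3, regKernel a i j z * (Metric.ball (0 : E3) 1).indicator 1 z = 0 := by
  have := integral_trace_free_eq_zero
    (fun r => (Iio 1).indicator (fun r => (4 * Real.pi)⁻¹ * (r ^ 2 + a) ^ (-(5 / 2) : ℝ)) r)
    (fun i j => ?_) i j
  · rw [← this]
    congr 1; funext z
    by_cases h2 : ‖z‖ < 1
    · simp [indicator, h2, regKernel, japanese]; ring
    · simp [indicator, h2]
  · have h : Continuous fun z : E3 => (-(if i = j then 1 else 0) * ‖z‖ ^ 2 + 3 * z i * z j) *
        ((4 * Real.pi)⁻¹ * (‖z‖ ^ 2 + a) ^ (-(5 / 2) : ℝ)) := by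
      refine Continuous.mul (by fun_prop) (continuous_const.mul ?_)
      exact Continuous.rpow_const (by fun_prop) fun z => Or.inl (by positivity)
    have h' : IntegrableOn _ (Metric.ball (0 : E3) 1) :=
      (h.locallyIntegrable.integrableOn_isCompact (isCompact_closedBall 0 1)).mono_set Metric.ball_subset_closedBall
    rw [← integrable_indicator_iff measurableSet_ball] at h'
    refine h'.congr (Eventually.of_forall fun z => ?_)
    by_cases h2 : ‖z‖ < 1
    · simp [indicator, h2]
    · simp [indicator, h2]

/-- The principal value integral defining `R_i R_j` converges. -/
theorem tendsto_truncated_kernelK {g : E3 → ℝ} (hg : IsTest g) (x : E3) (i j : Fin 3) :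
    Tendsto (fun ε : ℝ => ∫ y in {y : E3 | ε < ‖x - y‖}, kernelK i j (x - y) * g y) (𝓝[>] 0)
      (𝓝 (∫ z, kernelK i j z * increment g x z)) := by
  have hI := integrable_kernelK_mul_increment hg x i j
  have h1 : Tendsto (fun ε : ℝ => ∫ z in {z : E3 | ε < ‖z‖}, kernelK i j z * increment g x z)
      (𝓝[>] 0) (𝓝 (∫ z, kernelK i j z * increment g x z)) := by
    have : ∀ ε : ℝ, ∫ z in {z : E3 | ε < ‖z‖}, kernelK i j z * increment g x z =
        ∫ z, {z : E3 | ε < ‖z‖}.indicator (fun z => kernelK i j z * increment g x z) z := fun ε =>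
      (integral_indicator (measurableSet_lt measurable_const measurable_norm)).symm
    simp_rw [this]
    refine tendsto_integral_filter_of_dominated_convergence _ ?_ ?_ hI.norm ?_
    · exact Eventually.of_forall fun ε => hI.aestronglyMeasurable.indicator
        (measurableSet_lt measurable_const measurable_norm)
    · exact Eventually.of_forall fun ε => Eventually.of_forall fun z =>
        norm_indicator_le_norm_self _ _
    · filter_upwards [volume.ae_ne (0 : E3)] with z hz
      refine tendsto_const_nhds.congr' ?_
      have : ∀ᶠ ε in 𝓝[>] (0 : ℝ), ε < ‖z‖ :=
        nhdsWithin_le_nhds (Iio_mem_nhds (norm_pos_iff.2 hz))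
      filter_upwards [this] with ε hε
      rw [indicator_of_mem (by exact hε)]
  refine h1.congr' ?_
  filter_upwards [self_mem_nhdsWithin] with ε hε
  have hms : MeasurableSet {z : E3 | ε < ‖z‖} := measurableSet_lt measurable_const measurable_norm
  have hms' : MeasurableSet {y : E3 | ε < ‖x - y‖} :=
    measurableSet_lt measurable_const (by fun_prop)
  have hK : IntegrableOn (fun z => kernelK i j z * g (x - z)) {z : E3 | ε < ‖z‖} := by
    refine ((hg.comp_sub x).integrable.restrict (s := {z : E3 | ε < ‖z‖})).bdd_mul
      (c := ε ^ (-3 : ℝ)) (measurable_kernelK i j).aestronglyMeasurable ?_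
    filter_upwards [ae_restrict_mem hms] with z hz
    exact (abs_kernelK_le i j z).trans (Real.rpow_le_rpow_of_nonpos hε (le_of_lt hz) (by norm_num))
  have h2 : ∫ y in {y : E3 | ε < ‖x - y‖}, kernelK i j (x - y) * g y =
      ∫ z in {z : E3 | ε < ‖z‖}, kernelK i j z * g (x - z) := by
    rw [← integral_indicator hms, ← integral_indicator hms',
      ← integral_sub_left_eq_self _ volume x]
    congr 1; funext z
    simp [indicator]
  rw [h2]
  -- The subtracted value g(x) on the unit ball costs nothing, since K_ij has mean zero on the
  -- annulus ε < |z| < 1.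
  have h3 : ∀ z, kernelK i j z * increment g x z = kernelK i j z * g (x - z) -
      g x * (kernelK i j z * (Metric.ball (0 : E3) 1).indicator 1 z) := by
    intro z; unfold increment; ring
  have h4 : ∀ z, g x * (kernelK i j z * (Metric.ball (0 : E3) 1).indicator 1 z) =
      kernelK i j z * g (x - z) - kernelK i j z * increment g x z := by
    intro z; unfold increment; ring
  simp_rw [h3]
  rw [integral_sub hK, integral_const_mul, integral_kernelK_annulus i j hε]
  · simp
  · simp_rw [h4]
    exact hK.sub hI.integrableOn

theorem rieszRR_eq {g : E3 → ℝ} (hg : IsTest g) (x : E3) (i j : Fin 3) :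
    rieszRR i j g x = -(1 / 3) * (if i = j then 1 else 0) * g x +
      ∫ z, kernelK i j z * increment g x z := by
  rw [rieszRR, (tendsto_truncated_kernelK hg x i j).limUnder_eq]

/-- K_ij is trace-free, so only the three local terms -g/3 remain. -/
theorem sum_rieszRR_diag {g : E3 → ℝ} (hg : IsTest g) (x : E3) :
    ∑ i, rieszRR i i g x = - g x := by
  simp_rw [rieszRR_eq hg, Finset.sum_add_distrib]
  rw [← integral_finsetSum _ fun i _ => integrable_kernelK_mul_increment hg x i i]
  simp_rw [← Finset.sum_mul, sum_kernelK_diag]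
  simp

/-- Away from the support, `R_i R_j g` is the convolution with `K_ij`. -/
theorem rieszRR_eq_integral {g : E3 → ℝ} {x : E3} (hx : x ∉ tsupport g) (i j : Fin 3) :
    rieszRR i j g x = ∫ y, kernelK i j (x - y) * g y := by
  have h0 : g x = 0 := image_eq_zero_of_notMem_tsupport hx
  rw [rieszRR, h0, mul_zero, zero_add]
  refine Tendsto.limUnder_eq (tendsto_const_nhds.congr' ?_)
  obtain ⟨δ, hδ, h⟩ := Metric.isOpen_iff.1 (isClosed_tsupport g).isOpen_compl x hx
  have : ∀ᶠ ε in 𝓝[>] (0 : ℝ), ε < δ := nhdsWithin_le_nhds (Iio_mem_nhds hδ)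
  filter_upwards [this] with ε hε
  refine (setIntegral_eq_integral_of_forall_compl_eq_zero fun y hy => ?_).symm
  have : y ∈ Metric.ball x δ := by
    simp only [mem_ofPred_eq, not_lt] at hy
    rw [Metric.mem_ball, dist_comm, dist_eq_norm]
    linarith
  rw [image_eq_zero_of_notMem_tsupport (h this), mul_zero]

end

/-! ### An approximate identity, and R_iR_j as a convolution with the Newton potential -/

section

/-- The unit-scale approximate identity `-Δ (1 / (4π √(|z|² + 1)))`. -/
def unitPeak (z : E3) : ℝ := 3 * ((4 * Real.pi)⁻¹ * japanese 1 (-(5 / 2)) z)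

theorem unitPeak_nonneg (z : E3) : 0 ≤ unitPeak z := by
  have := japanese_nonneg zero_le_one (-(5 / 2)) z
  unfold unitPeak; positivity

/-- The integrand has the explicit primitive r³ (r² + 1)^{-3/2}, which tends to 1 at infinity. -/
theorem integral_Ioi_sq_mul_rpow :
    ∫ r in Ioi (0 : ℝ), 3 * r ^ 2 * (r ^ 2 + 1) ^ (-(5 / 2) : ℝ) = 1 := by
  have hd : ∀ r ∈ Ici (0 : ℝ), HasDerivAt (fun r : ℝ => r ^ 3 * (r ^ 2 + 1) ^ (-(3 / 2) : ℝ))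
      (3 * r ^ 2 * (r ^ 2 + 1) ^ (-(5 / 2) : ℝ)) r := by
    intro r _
    have hpos : 0 < r ^ 2 + 1 := by positivity
    have h1 : HasDerivAt (fun r : ℝ => r ^ 2 + 1) (2 * r) r := by
      simpa using (hasDerivAt_pow 2 r).add_const 1
    have h2 := (hasDerivAt_pow 3 r).mul (h1.rpow_const (p := -(3 / 2)) (Or.inl hpos.ne'))
    refine h2.congr_deriv ?_
    have h3 : (r ^ 2 + 1) ^ (-(3 / 2) : ℝ) = (r ^ 2 + 1) * (r ^ 2 + 1) ^ (-(5 / 2) : ℝ) := by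
      rw [← Real.rpow_one_add' hpos.le (by norm_num)]; norm_num
    rw [show (-(3 / 2) - 1 : ℝ) = -(5 / 2) by norm_num, h3]
    push_cast
    ring
  have ht : Tendsto (fun r : ℝ => r ^ 3 * (r ^ 2 + 1) ^ (-(3 / 2) : ℝ)) atTop (𝓝 1) := by
    have h1 : Tendsto (fun r : ℝ => 1 - (r ^ 2 + 1)⁻¹) atTop (𝓝 (1 - 0)) :=
      tendsto_const_nhds.sub (tendsto_inv_atTop_zero.comp
        (tendsto_atTop_add_const_right _ _ (tendsto_pow_atTop two_ne_zero)))
    have h2 := h1.rpow_const (p := 3 / 2) (Or.inl (by norm_num))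
    rw [sub_zero, Real.one_rpow] at h2
    refine h2.congr' ?_
    filter_upwards [Ioi_mem_atTop 0] with r hr
    have hr : 0 < r := hr
    have e : 1 - (r ^ 2 + 1)⁻¹ = r ^ 2 / (r ^ 2 + 1) := by field_simp; ring
    rw [e, Real.div_rpow (by positivity) (by positivity), Real.rpow_neg (by positivity),
      ← div_eq_mul_inv, ← Real.rpow_natCast, ← Real.rpow_mul hr.le]
    congr 1
    rw [← Real.rpow_natCast]; norm_num
  have := integral_Ioi_of_hasDerivAt_of_nonneg' hd (fun r _ => by positivity) ht
  rw [this]; simp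

theorem integral_unitPeak : ∫ z, unitPeak z = 1 := by
  have h := integral_fun_norm_addHaar (volume : Measure E3)
    (fun r : ℝ => 3 * ((4 * Real.pi)⁻¹ * (r ^ 2 + 1) ^ (-(5 / 2) : ℝ)))
  unfold unitPeak japanese
  rw [h]
  have hv : (volume : Measure E3).real (Metric.ball 0 1) = 4 * Real.pi / 3 := by
    rw [Measure.real, InnerProductSpace.volume_ball_of_dim_odd (k := 1) (by simp)]
    simp [Nat.doubleFactorial]
    rw [ENNReal.toReal_ofReal (by positivity)]
    ring
  rw [hv]
  have : ∀ r : ℝ, r ^ (Module.finrank ℝ E3 - 1) •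
      (3 * ((4 * Real.pi)⁻¹ * (r ^ 2 + 1) ^ (-(5 / 2) : ℝ))) =
      (4 * Real.pi)⁻¹ * (3 * r ^ 2 * (r ^ 2 + 1) ^ (-(5 / 2) : ℝ)) := by
    intro r; simp; ring
  simp_rw [this]
  rw [integral_const_mul, integral_Ioi_sq_mul_rpow]
  simp
  field_simp

theorem tendsto_unitPeak :
    Tendsto (fun z : E3 => ‖z‖ ^ Module.finrank ℝ E3 * unitPeak z)
      (Bornology.cobounded E3) (𝓝 0) := by
  have h1 : Tendsto (fun z : E3 => 3 * (4 * Real.pi)⁻¹ * ‖z‖ ^ (-2 : ℝ))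
      (Bornology.cobounded E3) (𝓝 (3 * (4 * Real.pi)⁻¹ * 0)) :=
    tendsto_const_nhds.mul
      ((tendsto_rpow_neg_atTop (by norm_num : (0 : ℝ) < 2)).comp tendsto_norm_cobounded_atTop)
  rw [mul_zero] at h1
  refine squeeze_zero' (Eventually.of_forall fun z => mul_nonneg (by positivity)
    (unitPeak_nonneg z)) ?_ h1
  filter_upwards [Bornology.eventually_ne_cobounded 0] with z hz
  have hn : 0 < ‖z‖ := norm_pos_iff.2 hz
  have := japanese_le (a := 1) (p := -(5 / 2)) zero_le_one (by norm_num) hz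
  rw [japanese_zero, show (2 * -(5 / 2) : ℝ) = -5 by norm_num] at this
  have h2 : ‖z‖ ^ 3 * ‖z‖ ^ (-5 : ℝ) = ‖z‖ ^ (-2 : ℝ) := by
    rw [← Real.rpow_natCast, ← Real.rpow_add hn]; norm_num
  rw [unitPeak, ← h2]
  simp only [finrank_euclideanSpace, Fintype.card_fin]
  calc _ ≤ ‖z‖ ^ 3 * (3 * ((4 * Real.pi)⁻¹ * ‖z‖ ^ (-5 : ℝ))) := by gcongr
    _ = _ := by ring

/-- With a = c^{-2}, the diagonal remainder of the regularized Hessian is a dilation of `unitPeak`,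
with the factor c³ that preserves its mass. -/
theorem japanese_rescale {c : ℝ} (hc : 0 < c) (z : E3) :
    (c ^ 2)⁻¹ * japanese (c ^ 2)⁻¹ (-(5 / 2)) z = c ^ 3 * japanese 1 (-(5 / 2)) (c • z) := by
  unfold japanese
  have e : ‖c • z‖ ^ 2 + 1 = c ^ 2 * (‖z‖ ^ 2 + (c ^ 2)⁻¹) := by
    rw [norm_smul, Real.norm_eq_abs, abs_of_pos hc]; field_simp
  rw [e, Real.mul_rpow (by positivity) (by positivity), ← mul_assoc]
  congr 1
  rw [← Real.rpow_natCast c 2, ← Real.rpow_neg hc.le, ← Real.rpow_mul hc.le,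
    ← Real.rpow_natCast c 3, ← Real.rpow_add hc]
  norm_num

theorem tendsto_regularization : Tendsto (fun c : ℝ => (c ^ 2)⁻¹) atTop (𝓝 0) :=
  tendsto_inv_atTop_zero.comp (tendsto_pow_atTop two_ne_zero)

theorem tendsto_japanese {z : E3} (hz : z ≠ 0) (p : ℝ) :
    Tendsto (fun c : ℝ => japanese (c ^ 2)⁻¹ p z) atTop (𝓝 (japanese 0 p z)) := by
  have hn : 0 < ‖z‖ := norm_pos_iff.2 hz
  exact (tendsto_const_nhds.add tendsto_regularization).rpow_const (Or.inl (by positivity))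

theorem integrable_newton_mul {f : E3 → ℝ} (hf : Continuous f) (hs : HasCompactSupport f) :
    Integrable fun z => regNewton 0 z * f z := by
  obtain ⟨ρ, -, hρ⟩ := ball_subset_of_hasCompactSupport hs
  obtain ⟨C, hC⟩ := hf.bounded_above_of_compact_support hs
  have := (integrable_norm_rpow_mul (p := -1) (by norm_num) hf.aestronglyMeasurable hC hρ).const_mul
    (4 * Real.pi)⁻¹
  refine this.congr (Eventually.of_forall fun z => ?_)
  simp only [regNewton_zero, Real.rpow_neg_one]; ring

theorem regNewton_nonneg {a : ℝ} (ha : 0 ≤ a) (z : E3) : 0 ≤ regNewton a z := by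
  have := japanese_nonneg ha (-(1 / 2)) z
  unfold regNewton; positivity

theorem tendsto_integral_regNewton {f : E3 → ℝ} (hf : Continuous f) (hs : HasCompactSupport f) :
    Tendsto (fun c : ℝ => ∫ z, regNewton (c ^ 2)⁻¹ z * f z) atTop
      (𝓝 (∫ z, regNewton 0 z * f z)) := by
  refine tendsto_integral_filter_of_dominated_convergence _ ?_ ?_
    (integrable_newton_mul hf hs).norm ?_
  · exact Eventually.of_forall fun c =>
      ((measurable_regNewton _).mul hf.measurable).aestronglyMeasurable
  · refine Eventually.of_forall fun c => ?_
    filter_upwards [volume.ae_ne (0 : E3)] with z hz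
    rw [norm_mul, norm_mul, Real.norm_of_nonneg (regNewton_nonneg (by positivity) z),
      Real.norm_of_nonneg (regNewton_nonneg le_rfl z)]
    unfold regNewton
    gcongr
    exact japanese_le (by positivity) (by norm_num) hz
  · filter_upwards [volume.ae_ne (0 : E3)] with z hz
    exact (tendsto_const_nhds.mul (tendsto_japanese hz _)).mul_const _

theorem tendsto_integral_regKernel {g : E3 → ℝ} (hg : IsTest g) (x : E3) (i j : Fin 3) :
    Tendsto (fun c : ℝ => ∫ z, regKernel (c ^ 2)⁻¹ i j z * increment g x z) atTop
      (𝓝 (∫ z, kernelK i j z * increment g x z)) := by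
  refine tendsto_integral_filter_of_dominated_convergence _ ?_ ?_
    (integrable_norm_rpow_mul_increment hg x) ?_
  · exact Eventually.of_forall fun c =>
      ((measurable_regKernel _ i j).mul (measurable_increment hg x)).aestronglyMeasurable
  · refine Eventually.of_forall fun c => ?_
    filter_upwards [volume.ae_ne (0 : E3)] with z hz
    rw [norm_mul]
    exact mul_le_mul_of_nonneg_right (abs_regKernel_le (by positivity) i j hz) (abs_nonneg _)
  · filter_upwards [volume.ae_ne (0 : E3)] with z hz
    rw [← regKernel_zero]
    exact (tendsto_const_nhds.mul (tendsto_const_nhds.mul (tendsto_japanese hz _))).mul_const _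

/-- `R_i R_j g = E * ∂_i ∂_j g`, with `E` the Newton potential. -/
theorem integral_newton_mul_pd_pd {g : E3 → ℝ} (hg : IsTest g) (x : E3) (i j : Fin 3) :
    ∫ z, regNewton 0 z * pd i (pd j g) (x - z) = rieszRR i j g x := by
  have ht := ((hg.pd j).pd i).comp_sub x
  refine tendsto_nhds_unique (tendsto_integral_regNewton ht.smooth.continuous ht.supp) ?_
  rw [rieszRR_eq hg, add_comm]
  have h1 := tendsto_integral_regKernel hg x i j
  -- The dilated peaks concentrate at z = 0, where g(x - z) takes the value g(x).
  have h2 : Tendsto (fun c : ℝ => ∫ z, (c ^ 3 * unitPeak (c • z)) * g (x - z)) atTop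
      (𝓝 (g x)) := by
    have := tendsto_integral_comp_smul_smul_of_integrable (μ := (volume : Measure E3))
      unitPeak_nonneg integral_unitPeak tendsto_unitPeak (g := fun z => g (x - z))
      (hg.comp_sub x).integrable (hg.comp_sub x).smooth.continuous.continuousAt
    simpa using this
  refine (h1.add (h2.const_mul (-(1 / 3) * (if i = j then 1 else 0)))).congr' ?_
  filter_upwards [Ioi_mem_atTop 0] with c hc
  have hc : 0 < c := hc
  have ha : 0 < (c ^ 2)⁻¹ := by positivity
  rw [integral_mul_pd_pd_comp_sub (contDiff_regNewton ha) hg]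
  -- Three pieces: the increment against the trace-free kernel, whose limit is the principal value;
  -- g(x) times that kernel on the unit ball, which integrates to zero; and the approximate identity
  -- with coefficient -δ_ij/3.
  have e : ∀ z, pd i (pd j (regNewton (c ^ 2)⁻¹)) z * g (x - z) =
      (regKernel (c ^ 2)⁻¹ i j z * increment g x z +
        g x * (regKernel (c ^ 2)⁻¹ i j z * (Metric.ball (0 : E3) 1).indicator 1 z)) +
      -(1 / 3) * (if i = j then 1 else 0) * ((c ^ 3 * unitPeak (c • z)) * g (x - z)) := by
    intro z
    have h3 : c ^ 3 * unitPeak (c • z) =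
        3 * (4 * Real.pi)⁻¹ * ((c ^ 2)⁻¹ * japanese (c ^ 2)⁻¹ (-(5 / 2)) z) := by
      rw [japanese_rescale hc, unitPeak]; ring
    rw [h3, pd_pd_regNewton (by positivity), increment]
    ring
  have hI1 := integrable_regKernel_mul_increment hg x ha.le i j
  have hcont : Continuous (pd i (pd j (regNewton (c ^ 2)⁻¹))) :=
    (contDiff_pd (contDiff_pd (contDiff_regNewton ha) j) i).continuous
  have hgx := hg.comp_sub x
  have hcp : Continuous unitPeak := by
    unfold unitPeak
    have : Continuous (japanese 1 (-(5 / 2))) :=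
      (contDiff_iff_contDiffAt.2 fun z =>
        contDiffAt_japanese _ (by positivity) : ContDiff ℝ ∞ _).continuous
    fun_prop
  have hI2 : Integrable fun z => (c ^ 3 * unitPeak (c • z)) * g (x - z) :=
    ((continuous_const.mul (hcp.comp (continuous_const_smul c))).mul
      hgx.smooth.continuous).integrable_of_hasCompactSupport hgx.supp.mul_left
  have hI3 : Integrable fun z => pd i (pd j (regNewton (c ^ 2)⁻¹)) z * g (x - z) :=
    (hcont.mul hgx.smooth.continuous).integrable_of_hasCompactSupport hgx.supp.mul_left
  have hI4 : Integrable fun z =>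
      g x * (regKernel (c ^ 2)⁻¹ i j z * (Metric.ball (0 : E3) 1).indicator 1 z) := by
    refine ((hI3.sub hI1).sub
      (hI2.const_mul (-(1 / 3) * (if i = j then 1 else 0)))).congr (Eventually.of_forall fun z => ?_)
    simp only [Pi.sub_apply]
    rw [e z]; ring
  have hI5 : Integrable fun z => regKernel (c ^ 2)⁻¹ i j z * increment g x z +
      g x * (regKernel (c ^ 2)⁻¹ i j z * (Metric.ball (0 : E3) 1).indicator 1 z) := hI1.add hI4
  simp_rw [e]
  rw [integral_add hI5 (hI2.const_mul _), integral_add hI1 hI4, integral_const_mul,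
    integral_const_mul, integral_regKernel_ball ha]
  ring

end

/-! ### Decay estimates for the kernels, and truncation at scale R -/

section

/-- The weight `(1 + |y|)^{-4}`. -/
def weight (y : E3) : ℝ := ((1 + ‖y‖) ^ 4)⁻¹

theorem weight_pos (y : E3) : 0 < weight y := by unfold weight; positivity

@[fun_prop]
theorem continuous_weight : Continuous weight := by
  unfold weight
  exact Continuous.inv₀ (by fun_prop) fun y => by positivity

/-! ### Lipschitz estimates for the kernel -/

theorem norm_fderiv_kernelK_bound (i j : Fin 3) :
    ∃ C : ℝ, 0 ≤ C ∧ ∀ z : E3, 1 / 2 ≤ ‖z‖ → ‖z‖ ≤ 3 / 2 → ‖fderiv ℝ (kernelK i j) z‖ ≤ C := by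
  have hc : IsCompact {z : E3 | 1 / 2 ≤ ‖z‖ ∧ ‖z‖ ≤ 3 / 2} := by
    refine (isCompact_closedBall (0 : E3) (3 / 2)).of_isClosed_subset ?_ ?_
    · exact (isClosed_le continuous_const continuous_norm).inter
        (isClosed_le continuous_norm continuous_const)
    · intro z hz; simpa using hz.2
  have hcont : ContinuousOn (fderiv ℝ (kernelK i j)) {z : E3 | 1 / 2 ≤ ‖z‖ ∧ ‖z‖ ≤ 3 / 2} := by
    intro z hz
    have hz0 : z ≠ 0 := by
      rintro rfl
      have := hz.1
      norm_num at this
    exact ((contDiffAt_kernelK i j hz0).fderiv_right (m := 0) (by simp)).continuousAt.continuousWithinAt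
  obtain ⟨C, hC⟩ := hc.exists_bound_of_continuousOn hcont
  exact ⟨max C 0, le_max_right _ _, fun z h1 h2 => (hC z ⟨h1, h2⟩).trans (le_max_left _ _)⟩

/-- K_ij is homogeneous of degree -3, so it suffices to treat |y| = 1. There the segment from y to x
stays in 1/2 ≤ |z| ≤ 3/2, where the gradient is bounded by compactness; rescaling produces |y|^{-4}.
-/
theorem kernelK_lipschitz (i j : Fin 3) :
    ∃ C : ℝ, 0 ≤ C ∧ ∀ x y : E3, y ≠ 0 → ‖x - y‖ ≤ ‖y‖ / 2 →
      |kernelK i j x - kernelK i j y| ≤ C * ‖x - y‖ / ‖y‖ ^ 4 := by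
  obtain ⟨C, hC0, hC⟩ := norm_fderiv_kernelK_bound i j
  have unit : ∀ x y : E3, ‖y‖ = 1 → ‖x - y‖ ≤ 1 / 2 →
      |kernelK i j x - kernelK i j y| ≤ C * ‖x - y‖ := by
    intro x y hy hxy
    have hb : ∀ z ∈ Metric.closedBall y (1 / 2), 1 / 2 ≤ ‖z‖ ∧ ‖z‖ ≤ 3 / 2 := by
      intro z hz
      rw [Metric.mem_closedBall, dist_eq_norm] at hz
      have h1 := norm_sub_norm_le y z
      have h2 := norm_sub_norm_le z y
      rw [norm_sub_rev] at h1
      constructor <;> linarith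
    refine (convex_closedBall y (1 / 2)).norm_image_sub_le_of_norm_fderiv_le (𝕜 := ℝ)
      (fun z hz => ?_) (fun z hz => hC z (hb z hz).1 (hb z hz).2)
      (Metric.mem_closedBall_self (by norm_num)) ?_
    · have : z ≠ 0 := by
        rintro rfl
        have := (hb 0 hz).1
        norm_num at this
      exact (contDiffAt_kernelK i j this).differentiableAt (by simp)
    · rwa [Metric.mem_closedBall, dist_eq_norm]
  refine ⟨C, hC0, fun x y hy hxy => ?_⟩
  have hs : 0 < ‖y‖ := norm_pos_iff.2 hy
  set s := ‖y‖ with hsdef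
  have ex : x = s • (s⁻¹ • x) := by rw [smul_smul, mul_inv_cancel₀ hs.ne', one_smul]
  have ey : y = s • (s⁻¹ • y) := by rw [smul_smul, mul_inv_cancel₀ hs.ne', one_smul]
  have hd : ‖s⁻¹ • x - s⁻¹ • y‖ = s⁻¹ * ‖x - y‖ := by
    rw [← smul_sub, norm_smul, norm_inv, Real.norm_of_nonneg hs.le]
  have h1 := unit (s⁻¹ • x) (s⁻¹ • y)
    (by rw [norm_smul, norm_inv, Real.norm_of_nonneg hs.le, ← hsdef, inv_mul_cancel₀ hs.ne'])
    (by rw [hd, inv_mul_le_iff₀ hs]; linarith)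
  rw [hd] at h1
  rw [ex, ey, kernelK_smul i j hs, kernelK_smul i j hs, ← mul_sub, abs_mul,
    abs_of_pos (by positivity), ← ex, ← ey]
  calc _ ≤ (s ^ 3)⁻¹ * (C * (s⁻¹ * ‖x - y‖)) := by gcongr
    _ = _ := by field_simp

theorem abs_pd_le (f : E3 → ℝ) (i : Fin 3) (z : E3) : |pd i f z| ≤ ‖fderiv ℝ f z‖ := by
  have := (fderiv ℝ f z).le_opNorm (basisVec i)
  simpa [pd] using this

theorem pd_kernelK_bound (i j k : Fin 3) :
    ∃ C : ℝ, 0 ≤ C ∧ ∀ z : E3, z ≠ 0 → |pd k (kernelK i j) z| ≤ C / ‖z‖ ^ 4 := by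
  obtain ⟨C, hC0, hC⟩ := kernelK_lipschitz i j
  refine ⟨C, hC0, fun z hz => (abs_pd_le _ _ _).trans ?_⟩
  have hn : 0 < ‖z‖ := norm_pos_iff.2 hz
  refine norm_fderiv_le_of_lip' ℝ (by positivity) ?_
  have : ∀ᶠ x in 𝓝 z, x ∈ Metric.ball z (‖z‖ / 2) := Metric.ball_mem_nhds z (by positivity)
  filter_upwards [this] with x hx
  rw [Metric.mem_ball, dist_eq_norm] at hx
  refine (hC x z hz hx.le).trans (le_of_eq ?_)
  ring

/-! ### The truncated Newton potential -/

/-- A smooth cut-off, `1` on the unit ball and `0` off the ball of radius `√2`. -/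
def bump (z : E3) : ℝ := Real.smoothTransition (2 - ‖z‖ ^ 2)

theorem contDiff_bump : ContDiff ℝ ∞ bump :=
  Real.smoothTransition.contDiff.comp (contDiff_const.sub (contDiff_norm_sq ℝ))

theorem bump_eq_one {z : E3} (hz : ‖z‖ ≤ 1) : bump z = 1 := by
  refine Real.smoothTransition.one_of_one_le ?_
  nlinarith [norm_nonneg z]

theorem bump_eq_zero {z : E3} (hz : 2 ≤ ‖z‖ ^ 2) : bump z = 0 :=
  Real.smoothTransition.zero_of_nonpos (by linarith)

theorem abs_bump_le (z : E3) : |bump z| ≤ 1 := by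
  rw [bump, abs_of_nonneg (Real.smoothTransition.nonneg _)]
  exact Real.smoothTransition.le_one _

/-- The Newton potential with its singularity cut off. -/
def outerNewton (z : E3) : ℝ := (1 - bump z) * regNewton 0 z

/-- The function vanishes on the unit ball, and away from the origin both factors are smooth. -/
theorem contDiff_outerNewton : ContDiff ℝ ∞ outerNewton := by
  refine contDiff_iff_contDiffAt.2 fun z => ?_
  rcases eq_or_ne z 0 with rfl | hz
  · have : outerNewton =ᶠ[𝓝 0] fun _ => 0 := by
      filter_upwards [Metric.ball_mem_nhds (0 : E3) one_pos] with y hy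
      rw [outerNewton, bump_eq_one (by simpa using (Metric.mem_ball.1 hy).le)]
      ring
    exact contDiffAt_const.congr_of_eventuallyEq this
  · exact (contDiffAt_const.sub contDiff_bump.contDiffAt).mul
      (contDiffAt_regNewton (by positivity))

/-- Second derivatives of the Newton potential with its singularity cut off. -/
def outerKernel (i j : Fin 3) : E3 → ℝ := pd i (pd j outerNewton)

theorem contDiff_outerKernel (i j : Fin 3) : ContDiff ℝ ∞ (outerKernel i j) :=
  contDiff_pd (contDiff_pd contDiff_outerNewton j) i

theorem outerKernel_eventuallyEq (i j : Fin 3) {z : E3} (hz : 2 < ‖z‖ ^ 2) :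
    outerKernel i j =ᶠ[𝓝 z] kernelK i j := by
  have hopen : ∀ᶠ y in 𝓝 z, 2 < ‖y‖ ^ 2 :=
    (isOpen_lt continuous_const (by fun_prop : Continuous fun y : E3 => ‖y‖ ^ 2)).mem_nhds hz
  have h1 : outerNewton =ᶠ[𝓝 z] regNewton 0 := by
    filter_upwards [hopen] with y hy
    rw [outerNewton, bump_eq_zero hy.le]; ring
  refine (pd_eventuallyEq (pd_eventuallyEq h1 j) i).trans ?_
  filter_upwards [hopen] with y hy
  exact pd_pd_newton (by rintro rfl; norm_num at hy) i j

theorem pd_outerKernel_bound (i j k : Fin 3) :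
    ∃ C : ℝ, 0 ≤ C ∧ ∀ z : E3, |pd k (outerKernel i j) z| ≤ C * weight z := by
  obtain ⟨C₁, hC₁, h₁⟩ := pd_kernelK_bound i j k
  obtain ⟨C₂, h₂⟩ := (isCompact_closedBall (0 : E3) 2).exists_bound_of_continuousOn
    (contDiff_pd (contDiff_outerKernel i j) k).continuous.continuousOn
  have hC₂ : 0 ≤ C₂ := (norm_nonneg _).trans (h₂ 0 (by simp))
  -- The two constants come from 1 + |z| ≤ 3 on |z| ≤ 2, where compactness is used, and 1 + |z| ≤
  -- 2|z| beyond, where the kernel is K_ij.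
  refine ⟨C₁ * 2 ^ 4 + C₂ * 3 ^ 4, by positivity, fun z => ?_⟩
  unfold weight
  rw [← div_eq_mul_inv, le_div_iff₀ (by positivity)]
  by_cases hz : ‖z‖ ≤ 2
  · have h3 := h₂ z (by simpa using hz)
    rw [Real.norm_eq_abs] at h3
    calc _ ≤ C₂ * 3 ^ 4 := by gcongr; linarith
      _ ≤ _ := le_add_of_nonneg_left (by positivity)
  · push Not at hz
    have hz0 : z ≠ 0 := by rintro rfl; norm_num at hz
    have hn : 0 < ‖z‖ := norm_pos_iff.2 hz0
    have h3 := h₁ z hz0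
    rw [pd_congr (outerKernel_eventuallyEq i j (by nlinarith)) k]
    calc _ ≤ C₁ / ‖z‖ ^ 4 * (2 * ‖z‖) ^ 4 := by gcongr; linarith
      _ = C₁ * 2 ^ 4 := by field_simp
      _ ≤ _ := le_add_of_nonneg_right (by positivity)

theorem sum_outerKernel_diag_eq_zero {z : E3} (hz : 2 < ‖z‖ ^ 2) : ∑ i, outerKernel i i z = 0 := by
  rw [← sum_kernelK_diag z]
  exact Finset.sum_congr rfl fun i _ => (outerKernel_eventuallyEq i i hz).eq_of_nhds

/-- The kernel `∂_i ∂_j ((1 - η_R) E)` at scale `R`. -/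
def scaledKernel (R : ℝ) (i j : Fin 3) (z : E3) : ℝ := (R ^ 3)⁻¹ * outerKernel i j (R⁻¹ • z)

/-- The Newton potential cut off at radius `R`. -/
def truncNewton (R : ℝ) (z : E3) : ℝ := bump (R⁻¹ • z) * regNewton 0 z

theorem pd_comp_smul {f : E3 → ℝ} (hf : Differentiable ℝ f) (s : ℝ) (i : Fin 3) (z : E3) :
    pd i (fun z => f (s • z)) z = s * pd i f (s • z) := by
  have h := (hf (s • z)).hasFDerivAt.comp z ((hasFDerivAt_id z).const_smul s)
  unfold pd
  change fderiv ℝ (f ∘ fun z => s • z) z _ = _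
  have h' : HasFDerivAt (f ∘ fun z => s • z) _ z := h
  rw [h'.fderiv]
  simp

theorem contDiff_scaledKernel (R : ℝ) (i j : Fin 3) : ContDiff ℝ ∞ (scaledKernel R i j) :=
  contDiff_const.mul ((contDiff_outerKernel i j).comp (contDiff_const_smul _))

theorem pd_pd_outerNewton_scaled {R : ℝ} (hR : 0 < R) (i j : Fin 3) :
    pd i (pd j fun z => R⁻¹ * outerNewton (R⁻¹ • z)) = scaledKernel R i j := by
  have hd := contDiff_outerNewton.differentiable (by simp)
  have h1 : (pd j fun z => R⁻¹ * outerNewton (R⁻¹ • z)) =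
      fun z => R⁻¹ * R⁻¹ * pd j outerNewton (R⁻¹ • z) := by
    funext z
    rw [pd_const_mul (f := fun z => outerNewton (R⁻¹ • z)), pd_comp_smul hd]; ring
  rw [h1]
  funext z
  rw [pd_const_mul (f := fun z => pd j outerNewton (R⁻¹ • z)),
    pd_comp_smul ((contDiff_pd contDiff_outerNewton j).differentiable (by simp)), scaledKernel,
    outerKernel]
  field_simp

/-- Since E is homogeneous of degree -1, the discarded part (1 - η_R)E is the rescaling of
`outerNewton`. Hence every R-dependent estimate below reduces to scale one. -/
theorem truncNewton_eq {R : ℝ} (hR : 0 < R) (z : E3) :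
    truncNewton R z = regNewton 0 z - R⁻¹ * outerNewton (R⁻¹ • z) := by
  have : regNewton 0 (R⁻¹ • z) = R * regNewton 0 z := by
    rw [regNewton_zero, regNewton_zero, norm_smul, norm_inv, Real.norm_of_nonneg hR.le,
      mul_inv R⁻¹, inv_inv]
    ring
  rw [truncNewton, outerNewton, this]
  field_simp
  ring

theorem pd_scaledKernel (R : ℝ) (i j k : Fin 3) (z : E3) :
    pd k (scaledKernel R i j) z = (R ^ 4)⁻¹ * pd k (outerKernel i j) (R⁻¹ • z) := by
  have : pd k (scaledKernel R i j) z = _ :=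
    pd_const_mul (f := fun z => outerKernel i j (R⁻¹ • z)) _ z k
  rw [this, pd_comp_smul ((contDiff_outerKernel i j).differentiable (by simp)), ← mul_assoc,
    ← mul_inv, pow_succ R 3]

theorem locallyIntegrable_regNewton : LocallyIntegrable (regNewton 0) := by
  have h : ∀ r, IntegrableOn (regNewton 0) (Metric.ball 0 r) := fun r => by
    refine ((integrableOn_ball_norm_rpow (p := -1) (by norm_num) r).const_mul
      (4 * Real.pi)⁻¹).congr (Eventually.of_forall fun z => ?_)
    simp only [regNewton_zero, Real.rpow_neg_one]
  intro x
  exact ⟨Metric.ball 0 (‖x‖ + 1), Metric.isOpen_ball.mem_nhds (by simp), h _⟩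

theorem locallyIntegrable_truncNewton (R : ℝ) : LocallyIntegrable (truncNewton R) := by
  have hb : Continuous fun z => bump (R⁻¹ • z) :=
    contDiff_bump.continuous.comp (continuous_const_smul _)
  have := locallyIntegrable_regNewton.continuous_smul hb
  exact this

theorem truncNewton_eq_zero {R : ℝ} (hR : 0 < R) {z : E3} (hz : 2 * R ≤ ‖z‖) :
    truncNewton R z = 0 := by
  rw [truncNewton, bump_eq_zero, zero_mul]
  rw [norm_smul, norm_inv, Real.norm_of_nonneg hR.le]
  have : 2 ≤ R⁻¹ * ‖z‖ := by rw [le_inv_mul_iff₀ hR]; linarith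
  nlinarith

theorem integrable_mul_comp_sub {k g : E3 → ℝ} (hk : Continuous k) (hg : IsTest g) (x : E3) :
    Integrable fun z => k z * g (x - z) := by
  have hgx := hg.comp_sub x
  exact (hk.mul hgx.smooth.continuous).integrable_of_hasCompactSupport hgx.supp.mul_left

/-- Split η_R E as E minus a smooth function: the first part gives R_iR_j g, and in the second both
derivatives move onto the smooth kernel. -/
theorem integral_truncNewton_mul_pd_pd {g : E3 → ℝ} (hg : IsTest g) {R : ℝ} (hR : 0 < R) (x : E3)
    (i j : Fin 3) : ∫ z, truncNewton R z * pd i (pd j g) (x - z) =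
      rieszRR i j g x - ∫ z, scaledKernel R i j z * g (x - z) := by
  have ht := ((hg.pd j).pd i).comp_sub x
  have hs : ContDiff ℝ ∞ fun z => R⁻¹ * outerNewton (R⁻¹ • z) :=
    contDiff_const.mul (contDiff_outerNewton.comp (contDiff_const_smul _))
  simp_rw [truncNewton_eq hR, sub_mul]
  rw [integral_sub (integrable_newton_mul ht.smooth.continuous ht.supp)
    (integrable_mul_comp_sub hs.continuous ((hg.pd j).pd i) x),
    integral_newton_mul_pd_pd hg, integral_mul_pd_pd_comp_sub hs hg, pd_pd_outerNewton_scaled hR]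

theorem abs_integral_mul_comp_sub_le {k g : E3 → ℝ} {A M ρ : ℝ} {x : E3} (hA : 0 ≤ A)
    (hg : ∀ z, |g z| ≤ M) (hρ : ∀ z, ρ ≤ ‖z‖ → g z = 0) (hk : ∀ z, ‖x - z‖ < ρ → |k z| ≤ A) :
    |∫ z, k z * g (x - z)| ≤ A * M * volume.real (Metric.ball (0 : E3) ρ) := by
  have hM : 0 ≤ M := (abs_nonneg _).trans (hg 0)
  have h1 : ∫ z, k z * g (x - z) = ∫ z in Metric.ball x ρ, k z * g (x - z) := by
    refine (setIntegral_eq_integral_of_forall_compl_eq_zero fun z hz => ?_).symm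
    rw [Metric.mem_ball, dist_comm, dist_eq_norm, not_lt] at hz
    rw [hρ _ hz, mul_zero]
  have h2 : volume.real (Metric.ball (0 : E3) ρ) = volume.real (Metric.ball x ρ) := by
    simp [Measure.real, Measure.addHaar_ball_center]
  rw [h1, h2, ← Real.norm_eq_abs]
  refine norm_setIntegral_le_of_norm_le_const (μ := volume) (s := Metric.ball x ρ)
    measure_ball_lt_top fun z hz => ?_
  rw [Metric.mem_ball, dist_comm, dist_eq_norm] at hz
  rw [norm_mul]
  exact mul_le_mul (hk z hz) (hg _) (abs_nonneg _) hA

/-- Decay of the far part of the truncated potential applied to a derivative. -/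
theorem scaledKernel_conv_pd_bound (i j k : Fin 3) (ρ : ℝ) (hρ0 : 0 < ρ) :
    ∃ C : ℝ, 0 ≤ C ∧ ∀ (g : E3 → ℝ) (M R : ℝ), IsTest g → (∀ z, |g z| ≤ M) →
      (∀ z, ρ ≤ ‖z‖ → g z = 0) → 1 ≤ R → ∀ x,
      |∫ z, scaledKernel R i j z * pd k g (x - z)| ≤ C * M * weight x ∧
      |∫ z, scaledKernel R i j z * pd k g (x - z)| ≤ C * M * (R ^ 4)⁻¹ := by
  obtain ⟨C, hC0, hC⟩ := pd_outerKernel_bound i j k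
  set V := volume.real (Metric.ball (0 : E3) ρ)
  have hV : 0 ≤ V := measureReal_nonneg
  refine ⟨C * (1 + ρ) ^ 4 * V, by positivity, fun g M R hg hM hρ hR x => ?_⟩
  have hM0 : 0 ≤ M := (abs_nonneg _).trans (hM 0)
  have hR0 : 0 < R := by linarith
  -- Moving the derivative onto the kernel gains one order of decay, from cubic to quartic in R +
  -- |z|. Both bounds follow from this: R ≥ 1 and |x - z| < ρ give 1 + |x| ≤ (1 + ρ)(R + |z|).
  rw [integral_mul_pd_comp_sub (contDiff_scaledKernel R i j) hg]
  have hb : ∀ z, |pd k (scaledKernel R i j) z| ≤ C * ((R + ‖z‖) ^ 4)⁻¹ := by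
    intro z
    rw [pd_scaledKernel, abs_mul, abs_of_pos (by positivity)]
    refine (mul_le_mul_of_nonneg_left (hC _) (by positivity)).trans (le_of_eq ?_)
    rw [weight, norm_smul, norm_inv, Real.norm_of_nonneg hR0.le]
    rw [mul_left_comm, ← mul_inv, ← mul_pow]
    congr 4
    field_simp
  constructor
  · have h1 := abs_integral_mul_comp_sub_le (k := pd k (scaledKernel R i j)) (x := x)
      (A := C * (1 + ρ) ^ 4 * weight x)
      (by have := (weight_pos x).le; positivity) hM hρ fun z hz => (hb z).trans ?_
    · refine h1.trans (le_of_eq ?_); ring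
    · rw [mul_assoc]
      refine mul_le_mul_of_nonneg_left ?_ hC0
      rw [weight, ← div_eq_mul_inv, le_div_iff₀ (by positivity), inv_mul_le_iff₀ (by positivity),
        ← mul_pow]
      gcongr
      have := norm_le_norm_add_norm_sub' x z
      nlinarith [norm_nonneg z, norm_nonneg x]
  · have h1 := abs_integral_mul_comp_sub_le (k := pd k (scaledKernel R i j)) (x := x)
      (A := C * (R ^ 4)⁻¹) (by positivity) hM hρ fun z hz => (hb z).trans ?_
    · refine h1.trans ?_
      have : (1 : ℝ) ≤ (1 + ρ) ^ 4 := one_le_pow₀ (by linarith)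
      calc _ = C * 1 * V * M * (R ^ 4)⁻¹ := by ring
        _ ≤ _ := by gcongr
    · gcongr
      linarith [norm_nonneg z]

/-- The compactly supported kernel `-Δ(η_R E)` off the origin. -/
def traceKernel (R : ℝ) (z : E3) : ℝ := ∑ i, scaledKernel R i i z

theorem contDiff_traceKernel (R : ℝ) : ContDiff ℝ ∞ (traceKernel R) :=
  ContDiff.sum fun i _ => contDiff_scaledKernel R i i

theorem traceKernel_eq_zero {R : ℝ} (hR : 0 < R) {z : E3} (hz : 2 * R ≤ ‖z‖) :
    traceKernel R z = 0 := by
  simp only [traceKernel, scaledKernel]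
  rw [← Finset.mul_sum, sum_outerKernel_diag_eq_zero, mul_zero]
  rw [norm_smul, norm_inv, Real.norm_of_nonneg hR.le]
  have : 2 ≤ R⁻¹ * ‖z‖ := by rw [le_inv_mul_iff₀ hR]; linarith
  nlinarith

/-- At scale one the trace vanishes for |z|² > 2, since there it is the trace of K. So it is
bounded, and scaling supplies R^{-3}. -/
theorem abs_traceKernel_bound :
    ∃ C : ℝ, 0 ≤ C ∧ ∀ R z, 0 < R → |traceKernel R z| ≤ C * (R ^ 3)⁻¹ := by
  have hcont : Continuous fun z => ∑ i, outerKernel i i z :=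
    continuous_finsetSum _ fun i _ => (contDiff_outerKernel i i).continuous
  obtain ⟨C, h⟩ := (isCompact_closedBall (0 : E3) 2).exists_bound_of_continuousOn
    hcont.continuousOn
  have hC : 0 ≤ C := (norm_nonneg _).trans (h 0 (by simp))
  refine ⟨C, hC, fun R z hR => ?_⟩
  simp only [traceKernel, scaledKernel]
  rw [← Finset.mul_sum, abs_mul, abs_of_pos (by positivity), mul_comm]
  gcongr
  by_cases hz : ‖R⁻¹ • z‖ ≤ 2
  · exact h _ (by simpa using hz)
  · rw [sum_outerKernel_diag_eq_zero (by push Not at hz; nlinarith)]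
    simpa using hC

/-- The truncated potential inverts -Δ up to an error of bounded range: this is the trace of the
formula for its second derivatives, combined with Σ R_iR_i g = -g. -/
theorem integral_truncNewton_mul_laplacian {g : E3 → ℝ} (hg : IsTest g) {R : ℝ} (hR : 0 < R)
    (x : E3) : ∑ i, ∫ z, truncNewton R z * pd i (pd i g) (x - z) =
      - g x - ∫ z, traceKernel R z * g (x - z) := by
  simp_rw [integral_truncNewton_mul_pd_pd hg hR, Finset.sum_sub_distrib, sum_rieszRR_diag hg]
  rw [← integral_finsetSum _ fun i _ =>
    integrable_mul_comp_sub (contDiff_scaledKernel R i i).continuous hg x]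
  simp_rw [← Finset.sum_mul]
  rfl

end

/-! ### The normalization of the expansion and the decay of R_iR_j g at infinity -/

section

/-- The normalization `(1 - θ_R(x₀ - y)) K_ij(x₀ - y)` of the local pressure expansion. -/
def anchor (Θ : E3 → ℝ) (x₀ : E3) (R : ℝ) (i j : Fin 3) (y : E3) : ℝ :=
  (1 - cutoff Θ R (x₀ - y)) * kernelK i j (x₀ - y)

theorem cutoff_eq_one {Θ : E3 → ℝ} (hΘ : IsCutoff Θ) {R : ℝ} (hR : 0 < R) {z : E3}
    (hz : ‖z‖ < 2 * R) : cutoff Θ R z = 1 := by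
  refine hΘ.eq_one _ ?_
  rw [mem_ball_zero_iff, norm_smul, norm_inv, Real.norm_of_nonneg hR.le, inv_mul_lt_iff₀ hR]
  linarith

theorem cutoff_eq_zero {Θ : E3 → ℝ} (hΘ : IsCutoff Θ) {R : ℝ} (hR : 0 < R) {z : E3}
    (hz : 4 * R ≤ ‖z‖) : cutoff Θ R z = 0 := by
  refine image_eq_zero_of_notMem_tsupport (f := Θ) fun h => ?_
  have := hΘ.supp h
  rw [mem_ball_zero_iff, norm_smul, norm_inv, Real.norm_of_nonneg hR.le, inv_mul_lt_iff₀ hR] at this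
  linarith

theorem continuous_cutoff {Θ : E3 → ℝ} (hΘ : IsCutoff Θ) (R : ℝ) : Continuous (cutoff Θ R) :=
  hΘ.smooth.continuous.comp (continuous_const_smul _)

theorem exists_cutoff_bound {Θ : E3 → ℝ} (hΘ : IsCutoff Θ) :
    ∃ B : ℝ, 0 ≤ B ∧ ∀ R z, |cutoff Θ R z| ≤ B ∧ |1 - cutoff Θ R z| ≤ B := by
  have hc : HasCompactSupport Θ :=
    (isCompact_closedBall (0 : E3) 4).of_isClosed_subset (isClosed_tsupport Θ)
      (hΘ.supp.trans Metric.ball_subset_closedBall)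
  obtain ⟨B, hB⟩ := hΘ.smooth.continuous.bounded_above_of_compact_support hc
  have hB0 : 0 ≤ B := (norm_nonneg _).trans (hB 0)
  refine ⟨1 + B, by positivity, fun R z => ⟨?_, ?_⟩⟩
  · have := hB (R⁻¹ • z)
    rw [Real.norm_eq_abs] at this
    exact this.trans (by linarith)
  · have := hB (R⁻¹ • z)
    rw [Real.norm_eq_abs] at this
    refine (abs_sub _ _).trans ?_
    rw [abs_one]
    exact add_le_add le_rfl this

theorem measurable_anchor {Θ : E3 → ℝ} (hΘ : IsCutoff Θ) (x₀ : E3) (R : ℝ) (i j : Fin 3) :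
    Measurable (anchor Θ x₀ R i j) :=
  (measurable_const.sub ((continuous_cutoff hΘ R).measurable.comp (by fun_prop))).mul
    ((measurable_kernelK i j).comp (by fun_prop))

theorem abs_anchor_le {Θ : E3 → ℝ} (hΘ : IsCutoff Θ) :
    ∃ B : ℝ, 0 ≤ B ∧ ∀ (R : ℝ) (x₀ : E3) (i j : Fin 3) (y : E3), 0 < R →
      |anchor Θ x₀ R i j y| ≤ B * (2 * R) ^ (-3 : ℝ) := by
  obtain ⟨B, hB0, hB⟩ := exists_cutoff_bound hΘ
  refine ⟨B, hB0, fun R x₀ i j y hR => ?_⟩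
  unfold anchor
  rcases lt_or_ge ‖x₀ - y‖ (2 * R) with h | h
  · rw [cutoff_eq_one hΘ hR h]
    simp
    positivity
  · rw [abs_mul]
    refine mul_le_mul (hB R _).2 ((abs_kernelK_le i j _).trans ?_) (abs_nonneg _) hB0
    exact Real.rpow_le_rpow_of_nonpos (by positivity) h (by norm_num)

theorem integral_eq_setIntegral_ball {f : E3 → ℝ} {ρ : ℝ} (h : ∀ z, ρ ≤ ‖z‖ → f z = 0) :
    ∫ z, f z = ∫ z in Metric.ball 0 ρ, f z := by
  refine (setIntegral_eq_integral_of_forall_compl_eq_zero fun z hz => ?_).symm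
  rw [mem_ball_zero_iff, not_lt] at hz
  exact h z hz

theorem abs_integral_le_of_ball {f : E3 → ℝ} {ρ M : ℝ} (h : ∀ z, ρ ≤ ‖z‖ → f z = 0)
    (hM : ∀ z, ‖z‖ < ρ → |f z| ≤ M) :
    |∫ z, f z| ≤ M * volume.real (Metric.ball (0 : E3) ρ) := by
  rw [integral_eq_setIntegral_ball h, ← Real.norm_eq_abs]
  exact norm_setIntegral_le_of_norm_le_const measure_ball_lt_top fun z hz => hM z (by simpa using hz)

/-- `R_i R_j g` is bounded near the support of `g`. -/
theorem abs_rieszRR_le_near (ρ L : ℝ) : ∃ C : ℝ, 0 ≤ C ∧ ∀ (g : E3 → ℝ) (M : ℝ) (i j : Fin 3),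
    IsTest g → (∀ z, ρ ≤ ‖z‖ → g z = 0) → (∀ z, |pd i (pd j g) z| ≤ M) →
    ∀ y, ‖y‖ < L → |rieszRR i j g y| ≤ C * M := by
  -- In E * ∂_i∂_j g at |y| < L, only |z| < L + ρ contributes, so the constant is the mass of E on
  -- that ball.
  refine ⟨∫ z in Metric.ball 0 (L + ρ), regNewton 0 z, integral_nonneg fun z =>
    regNewton_nonneg le_rfl z, fun g M i j hg hρ hM y hy => ?_⟩
  rw [← integral_newton_mul_pd_pd hg]
  have hsupp : ∀ z, ρ < ‖z‖ → pd i (pd j g) z = 0 := by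
    intro z hz
    refine image_eq_zero_of_notMem_tsupport fun h => ?_
    have h1 : z ∈ tsupport g := tsupport_pd_subset _ _ (tsupport_pd_subset _ _ h)
    have h2 : tsupport g ⊆ Metric.closedBall 0 ρ := by
      refine closure_minimal (fun w hw => ?_) Metric.isClosed_closedBall
      by_contra h
      rw [mem_closedBall_zero_iff, not_le] at h
      exact hw (hρ w h.le)
    have := h2 h1
    rw [mem_closedBall_zero_iff] at this
    linarith
  have hI : IntegrableOn (regNewton 0) (Metric.ball (0 : E3) (L + ρ)) :=
    (locallyIntegrable_regNewton.integrableOn_isCompact (isCompact_closedBall 0 _)).mono_set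
      Metric.ball_subset_closedBall
  rw [integral_eq_setIntegral_ball (ρ := L + ρ) fun z hz => ?_, ← integral_mul_const,
    ← Real.norm_eq_abs]
  · refine norm_integral_le_of_norm_le (hI.mul_const M) (Eventually.of_forall fun z => ?_)
    rw [norm_mul, Real.norm_of_nonneg (regNewton_nonneg le_rfl z)]
    exact mul_le_mul_of_nonneg_left (hM _) (regNewton_nonneg le_rfl z)
  · rw [hsupp _ ?_, mul_zero]
    have := norm_sub_norm_le z y
    rw [norm_sub_rev] at this
    linarith

/-- `R_i R_j g` minus its leading term at infinity decays like `|y|^{-4}`. -/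
theorem rieszRR_sub_anchor_bound {Θ : E3 → ℝ} (hΘ : IsCutoff Θ) (x₀ : E3) {R : ℝ} (hR : 0 < R)
    {ρ : ℝ} (hρ0 : 0 < ρ) (i j : Fin 3) :
    ∃ C : ℝ, 0 ≤ C ∧ ∀ (g : E3 → ℝ) (M : ℝ), IsTest g → (∀ z, ρ ≤ ‖z‖ → g z = 0) →
      (∀ z, |g z| ≤ M) → (∀ z, |pd i (pd j g) z| ≤ M) →
      ∀ y, |rieszRR i j g y - anchor Θ x₀ R i j y * ∫ z, g z| ≤ C * M * weight y := by
  obtain ⟨B, hB0, hB⟩ := abs_anchor_le hΘ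
  obtain ⟨CK, hCK0, hCK⟩ := kernelK_lipschitz i j
  set V := volume.real (Metric.ball (0 : E3) ρ)
  have hV : 0 ≤ V := measureReal_nonneg
  -- For |y| ≥ L the cut-off vanishes at x₀ - y, y lies outside the support of g, ρ + |x₀| ≤ |y -
  -- x₀|/2 as the Lipschitz estimate requires, and 1 + |y| ≤ 4|y - x₀|.
  set L := 3 * ‖x₀‖ + 2 * ρ + 4 * R + 1 with hL
  have hL0 : 0 ≤ L := by positivity
  obtain ⟨CN, hCN0, hCN⟩ := abs_rieszRR_le_near ρ L
  set A := CN + B * (2 * R) ^ (-3 : ℝ) * V with hA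
  have hA0 : 0 ≤ A := by positivity
  set F := CK * (ρ + ‖x₀‖) * 4 ^ 4 * V with hF
  have hF0 : 0 ≤ F := by positivity
  refine ⟨A * (1 + L) ^ 4 + F, by positivity, fun g M hg hρ hM hM2 y => ?_⟩
  have hM0 : 0 ≤ M := (abs_nonneg _).trans (hM 0)
  rcases lt_or_ge ‖y‖ L with hy | hy
  · have h1 : |rieszRR i j g y - anchor Θ x₀ R i j y * ∫ z, g z| ≤ A * M := by
      refine (abs_sub _ _).trans ?_
      rw [abs_mul]
      have h2 := hCN g M i j hg hρ hM2 y hy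
      have h3 := mul_le_mul (hB R x₀ i j y hR) (abs_integral_le_of_ball hρ fun z _ => hM z)
        (abs_nonneg _) (by positivity)
      refine (add_le_add h2 h3).trans (le_of_eq ?_)
      rw [hA]; ring
    have hw : 1 ≤ (1 + L) ^ 4 * weight y := by
      unfold weight
      rw [← div_eq_mul_inv, le_div_iff₀ (by positivity), one_mul]
      gcongr
    calc _ ≤ A * M * 1 := by rwa [mul_one]
      _ ≤ A * M * ((1 + L) ^ 4 * weight y) := by gcongr
      _ = A * (1 + L) ^ 4 * M * weight y := by ring
      _ ≤ _ := by
        have := (weight_pos y).le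
        gcongr
        linarith
  · have hyx : ‖y‖ - ‖x₀‖ ≤ ‖y - x₀‖ := norm_sub_norm_le y x₀
    have hx0 := norm_nonneg x₀
    have hcut : cutoff Θ R (x₀ - y) = 0 := cutoff_eq_zero hΘ hR (by rw [norm_sub_rev]; linarith)
    have hanchor : anchor Θ x₀ R i j y = kernelK i j (y - x₀) := by
      rw [anchor, hcut, ← kernelK_neg, neg_sub]; ring
    have hy0 : 0 < ‖y - x₀‖ := by linarith
    have hyn : y ∉ tsupport g := by
      intro h
      have h2 : tsupport g ⊆ Metric.closedBall 0 ρ := by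
        refine closure_minimal (fun w hw => ?_) Metric.isClosed_closedBall
        by_contra h
        rw [mem_closedBall_zero_iff, not_le] at h
        exact hw (hρ w h.le)
      have := h2 h
      rw [mem_closedBall_zero_iff] at this
      linarith
    set D := CK * (ρ + ‖x₀‖) / ‖y - x₀‖ ^ 4 with hD
    have hD0 : 0 ≤ D := by positivity
    have hbd : ∀ z, ‖z‖ < ρ → |kernelK i j (y - z) - kernelK i j (y - x₀)| ≤ D := by
      intro z hz
      have e : (y - z) - (y - x₀) = x₀ - z := by abel
      have h4 : ‖(y - z) - (y - x₀)‖ ≤ ρ + ‖x₀‖ := by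
        rw [e]
        linarith [norm_sub_le x₀ z]
      refine (hCK (y - z) (y - x₀) (norm_pos_iff.1 hy0) (by linarith)).trans ?_
      rw [hD]
      gcongr
    have hmeas : Measurable fun z => kernelK i j (y - z) - kernelK i j (y - x₀) :=
      ((measurable_kernelK i j).comp (by fun_prop)).sub measurable_const
    have hprod : ∀ z, |(kernelK i j (y - z) - kernelK i j (y - x₀)) * g z| ≤ D * |g z| := by
      intro z
      rw [abs_mul]
      rcases lt_or_ge ‖z‖ ρ with h | h
      · exact mul_le_mul_of_nonneg_right (hbd z h) (abs_nonneg _)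
      · simp [hρ z h]
    have hI : Integrable fun z => (kernelK i j (y - z) - kernelK i j (y - x₀)) * g z :=
      (hg.integrable.norm.const_mul D).mono'
        (hmeas.aestronglyMeasurable.mul hg.integrable.aestronglyMeasurable)
        (Eventually.of_forall hprod)
    -- Far out, subtracting the anchor replaces K_ij(y - z) by its increment from z = x₀, which
    -- gains one power of |y|.
    have hint : rieszRR i j g y - anchor Θ x₀ R i j y * ∫ z, g z =
        ∫ z, (kernelK i j (y - z) - kernelK i j (y - x₀)) * g z := by
      have e : ∀ z, kernelK i j (y - z) * g z = (kernelK i j (y - z) - kernelK i j (y - x₀)) * g z +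
          kernelK i j (y - x₀) * g z := fun z => by ring
      rw [rieszRR_eq_integral hyn, hanchor]
      simp_rw [e]
      rw [integral_add hI (hg.integrable.const_mul _), integral_const_mul]
      ring
    rw [hint]
    have h5 := abs_integral_le_of_ball (f := fun z =>
        (kernelK i j (y - z) - kernelK i j (y - x₀)) * g z) (ρ := ρ) (M := D * M)
      (fun z hz => by simp [hρ z hz])
      (fun z _ => (hprod z).trans (by gcongr; exact hM z))
    refine h5.trans ?_
    have h6 : (‖y - x₀‖ ^ 4)⁻¹ ≤ 4 ^ 4 * weight y := by
      unfold weight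
      rw [← div_eq_mul_inv, le_div_iff₀ (by positivity), inv_mul_le_iff₀ (by positivity), ← mul_pow]
      gcongr
      linarith
    calc D * M * V = CK * (ρ + ‖x₀‖) * M * V * (‖y - x₀‖ ^ 4)⁻¹ := by rw [hD]; ring
      _ ≤ CK * (ρ + ‖x₀‖) * M * V * (4 ^ 4 * weight y) := by gcongr
      _ = F * M * weight y := by rw [hF]; ring
      _ ≤ _ := by
        have := (weight_pos y).le
        gcongr
        exact le_add_of_nonneg_left (by positivity)

theorem isTest_bump : IsTest bump := by
  refine ⟨contDiff_bump, HasCompactSupport.intro (isCompact_closedBall (0 : E3) 2) fun z hz => ?_⟩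
  refine bump_eq_zero ?_
  rw [mem_closedBall_zero_iff, not_le] at hz
  nlinarith

theorem integral_bump_pos : 0 < ∫ z, bump z := by
  refine isTest_bump.smooth.continuous.integral_pos_of_hasCompactSupport_nonneg_nonzero
    isTest_bump.supp (fun z => Real.smoothTransition.nonneg _) (x := 0) ?_
  rw [bump_eq_one (by simp)]
  exact one_ne_zero

/-- Both anchors approximate R_iR_j of one fixed bump, divided by its positive integral, to order
|y|^{-4}. Subtracting the two approximations eliminates the Riesz transform. -/
theorem anchor_sub_anchor_bound {Θ : E3 → ℝ} (hΘ : IsCutoff Θ) (x₀ x₁ : E3) {R S : ℝ} (hR : 0 < R)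
    (hS : 0 < S) (i j : Fin 3) :
    ∃ C : ℝ, 0 ≤ C ∧ ∀ y, |anchor Θ x₀ R i j y - anchor Θ x₁ S i j y| ≤ C * weight y := by
  obtain ⟨C₁, hC₁, h₁⟩ := rieszRR_sub_anchor_bound hΘ x₀ hR two_pos i j
  obtain ⟨C₂, hC₂, h₂⟩ := rieszRR_sub_anchor_bound hΘ x₁ hS two_pos i j
  have ht := isTest_bump
  have hz : ∀ z, 2 ≤ ‖z‖ → bump z = 0 := fun z hz => bump_eq_zero (by nlinarith)
  obtain ⟨M, hM⟩ := ((ht.pd j).pd i).smooth.continuous.bounded_above_of_compact_support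
    ((ht.pd j).pd i).supp
  set N := max M 1
  have hN0 : 0 ≤ N := le_max_of_le_right zero_le_one
  set I := ∫ z, bump z with hI
  have hI0 : 0 < I := integral_bump_pos
  refine ⟨(C₁ * N + C₂ * N) / I, by positivity, fun y => ?_⟩
  have e₁ := h₁ bump N ht hz (fun z => (abs_bump_le z).trans (le_max_right _ _))
    (fun z => (hM z).trans (le_max_left _ _)) y
  have e₂ := h₂ bump N ht hz (fun z => (abs_bump_le z).trans (le_max_right _ _))
    (fun z => (hM z).trans (le_max_left _ _)) y
  rw [div_mul_eq_mul_div, le_div_iff₀ hI0, ← abs_of_pos hI0, ← abs_mul]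
  have e : (anchor Θ x₀ R i j y - anchor Θ x₁ S i j y) * I =
      (rieszRR i j bump y - anchor Θ x₁ S i j y * I) -
        (rieszRR i j bump y - anchor Θ x₀ R i j y * I) := by ring
  rw [e]
  refine (abs_sub _ _).trans ((add_le_add e₂ e₁).trans (le_of_eq ?_))
  ring

end

section

/-! ### Convolution in the space variable -/

/-- Convolution of `ψ` with `k` in the space variable. -/
def spaceConv (k : E3 → ℝ) (ψ : ST → ℝ) (z : ST) : ℝ := ∫ w, k w * ψ (z.1 - w, z.2)

section

open scoped Convolution

variable {k : E3 → ℝ} {ψ : ST → ℝ}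

/-- Time is a parameter of the convolution. The swap puts the parameter first, the order used in the
theorems on convolutions depending on a parameter. -/
theorem spaceConv_eq_convolution (k : E3 → ℝ) (ψ : ST → ℝ) :
    spaceConv k ψ = (fun q : ℝ × E3 =>
      (k ⋆[ContinuousLinearMap.mul ℝ ℝ, volume] (fun t x => ψ (x, t)) q.1) q.2) ∘ Prod.swap := by
  funext z
  simp [spaceConv, convolution]

theorem exists_compact_fst (hs : HasCompactSupport ψ) :
    ∃ K : Set E3, IsCompact K ∧ ∀ (t : ℝ) (x : E3), x ∉ K → (x, t) ∉ tsupport ψ := by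
  refine ⟨Prod.fst '' tsupport ψ, hs.isCompact.image continuous_fst, fun t x hx h => ?_⟩
  exact hx ⟨(x, t), h, rfl⟩

theorem contDiff_spaceConv (hk : LocallyIntegrable k) (hψ : ContDiff ℝ ∞ ψ)
    (hs : HasCompactSupport ψ) : ContDiff ℝ ∞ (spaceConv k ψ) := by
  obtain ⟨K, hK, hK0⟩ := exists_compact_fst hs
  have h := contDiffOn_convolution_right_with_param (μ := volume) (f := k) (n := ⊤) (𝕜 := ℝ)
    (ContinuousLinearMap.mul ℝ ℝ) (g := fun (t : ℝ) (x : E3) => ψ (x, t)) isOpen_univ hK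
    (fun p x _ hx => image_eq_zero_of_notMem_tsupport (hK0 p x hx)) hk
    (hψ.comp (contDiff_snd.prodMk contDiff_fst)).contDiffOn
  rw [univ_prod_univ, contDiffOn_univ] at h
  rw [spaceConv_eq_convolution]
  exact h.comp (contDiff_snd.prodMk contDiff_fst)

theorem fderiv_spaceConv (hk : LocallyIntegrable k) (hψ : ContDiff ℝ ∞ ψ)
    (hs : HasCompactSupport ψ) (z v : ST) :
    fderiv ℝ (spaceConv k ψ) z v = spaceConv k (fun z => fderiv ℝ ψ z v) z := by
  obtain ⟨K, hK, hK0⟩ := exists_compact_fst hs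
  have hψ' : ContDiff ℝ ∞ fun q : ℝ × E3 => ψ (q.2, q.1) :=
    hψ.comp (contDiff_snd.prodMk contDiff_fst)
  have h := hasFDerivAt_convolution_right_with_param (μ := volume) (f := k) (𝕜 := ℝ)
    (ContinuousLinearMap.mul ℝ ℝ) (g := fun (t : ℝ) (x : E3) => ψ (x, t)) isOpen_univ hK
    (fun p x _ hx => image_eq_zero_of_notMem_tsupport (hK0 p x hx)) hk
    (hψ'.of_le (by simp)).contDiffOn
    (z.2, z.1) (mem_univ _)
  have hsw : HasFDerivAt (fun z : ST => (z.2, z.1))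
      ((ContinuousLinearMap.snd ℝ E3 ℝ).prod (ContinuousLinearMap.fst ℝ E3 ℝ)) z :=
    hasFDerivAt_snd.prodMk hasFDerivAt_fst
  have h2 := h.comp (f := fun z : ST => (z.2, z.1)) z hsw
  rw [spaceConv_eq_convolution]
  have h3 : HasFDerivAt ((fun q : ℝ × E3 =>
      (k ⋆[ContinuousLinearMap.mul ℝ ℝ, volume] (fun t x => ψ (x, t)) q.1) q.2) ∘ Prod.swap) _ z :=
    h2
  rw [h3.fderiv]
  set ψs : ℝ × E3 → ℝ := fun q => ψ (q.2, q.1) with hψs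
  have hfd : ∀ q : ℝ × E3, fderiv ℝ ψs q =
      (fderiv ℝ ψ (q.2, q.1)).comp
        ((ContinuousLinearMap.snd ℝ ℝ E3).prod (ContinuousLinearMap.fst ℝ ℝ E3)) := by
    intro q
    have hsw : HasFDerivAt (fun q : ℝ × E3 => (q.2, q.1))
      ((ContinuousLinearMap.snd ℝ ℝ E3).prod (ContinuousLinearMap.fst ℝ ℝ E3)) q :=
      hasFDerivAt_snd.prodMk hasFDerivAt_fst
    exact ((hψ.differentiable (by simp) (q.2, q.1)).hasFDerivAt.comp q hsw).fderiv
  change ((k ⋆[(ContinuousLinearMap.mul ℝ ℝ).precompR (ℝ × E3), volume]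
    fun x : E3 => fderiv ℝ ψs (z.2, x)) z.1) (v.2, v.1) = _
  have hcs : HasCompactSupport fun x : E3 => fderiv ℝ ψs (z.2, x) := by
    refine HasCompactSupport.intro hK fun x hx => ?_
    have h0 : fderiv ℝ ψ (x, z.2) = 0 :=
      image_eq_zero_of_notMem_tsupport fun h => hK0 _ _ hx (tsupport_fderiv_subset ℝ h)
    rw [hfd, h0, ContinuousLinearMap.zero_comp]
  rw [convolution_precompR_apply _ hk hcs]
  · simp only [spaceConv, convolution, hfd]
    simp
  · exact ((hψ'.continuous_fderiv (by simp))).comp (by fun_prop)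

end

theorem spaceConv_eq_zero {k : E3 → ℝ} {ψ : ST → ℝ} {z : ST} {ρ r : ℝ}
    (hk : ∀ w, ρ ≤ ‖w‖ → k w = 0) (hψ : ∀ z : ST, r ≤ ‖z.1‖ → ψ z = 0) (hz : ρ + r ≤ ‖z.1‖) :
    spaceConv k ψ z = 0 := by
  refine integral_eq_zero_of_ae (Eventually.of_forall fun w => ?_)
  rcases le_or_gt ρ ‖w‖ with h | h
  · simp [hk w h]
  · have := norm_sub_norm_le z.1 w
    simp [hψ (z.1 - w, z.2) (by simp only; linarith)]

theorem tsupport_spaceConv_subset {k : E3 → ℝ} {ψ : ST → ℝ} {ρ : ℝ}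
    (hk : ∀ w, ρ ≤ ‖w‖ → k w = 0) (hs : HasCompactSupport ψ) :
    tsupport (spaceConv k ψ) ⊆
      (fun q : ST × E3 => (q.1.1 + q.2, q.1.2)) '' (tsupport ψ ×ˢ Metric.closedBall 0 ρ) := by
  have hc : IsCompact ((fun q : ST × E3 => (q.1.1 + q.2, q.1.2)) ''
      (tsupport ψ ×ˢ Metric.closedBall 0 ρ)) :=
    (hs.isCompact.prod (isCompact_closedBall _ _)).image (by fun_prop)
  refine closure_minimal (fun z hz => ?_) hc.isClosed
  by_contra h
  apply hz
  refine integral_eq_zero_of_ae (Eventually.of_forall fun w => ?_)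
  rcases le_or_gt ρ ‖w‖ with hw | hw
  · simp [hk w hw]
  · have : ψ (z.1 - w, z.2) = 0 := by
      refine image_eq_zero_of_notMem_tsupport fun h' => h ?_
      exact ⟨((z.1 - w, z.2), w), ⟨h', by simpa using hw.le⟩, by simp⟩
    simp [this]

variable {a b : EReal}

/-- The spatial slice of a space-time function. -/
def slice {Ω : TopologicalSpace.Opens ST} (ψ : 𝓓(Ω, ℝ)) (t : ℝ) (x : E3) : ℝ := ψ (x, t)

theorem lineDeriv_apply {Ω : TopologicalSpace.Opens ST} (ψ : 𝓓(Ω, ℝ)) (v z : ST) :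
    (∂_{v} ψ) z = fderiv ℝ ψ z v := by
  rw [TestFunction.lineDerivOp_eq_lineDerivCLM ℝ, TestFunction.lineDerivCLM_eq_fderivCLM,
    TestFunction.fderivCLM_apply_of_le _ (by simp)]

theorem isTest_slice {Ω : TopologicalSpace.Opens ST} (ψ : 𝓓(Ω, ℝ)) (t : ℝ) :
    IsTest (slice ψ t) := by
  obtain ⟨K, hK, hK0⟩ := exists_compact_fst ψ.hasCompactSupport
  exact ⟨ψ.contDiff.comp (contDiff_id.prodMk contDiff_const), HasCompactSupport.intro hK fun x hx =>
    image_eq_zero_of_notMem_tsupport (f := ψ) (hK0 t x hx)⟩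

theorem slice_lineDeriv {Ω : TopologicalSpace.Opens ST} (ψ : 𝓓(Ω, ℝ)) (i : Fin 3) (t : ℝ) :
    slice (∂_{spaceDir i} ψ) t = pd i (slice ψ t) := by
  funext x
  have h : HasFDerivAt (fun x : E3 => (x, t)) (ContinuousLinearMap.inl ℝ E3 ℝ) x :=
    hasFDerivAt_prodMk_left x t
  have h2 := ((ψ.contDiff.differentiable (by simp)) (x, t)).hasFDerivAt.comp x h
  unfold slice pd
  rw [lineDeriv_apply]
  change _ = fderiv ℝ (ψ ∘ fun x => (x, t)) x (basisVec i)
  rw [h2.fderiv]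
  rfl

theorem lineDeriv_comm {Ω : TopologicalSpace.Opens ST} (ψ : 𝓓(Ω, ℝ)) (v w : ST) :
    ∂_{v} (∂_{w} ψ) = ∂_{w} (∂_{v} ψ) := by
  ext z
  have h : ∀ a b : ST, (∂_{b} (∂_{a} ψ)) z = fderiv ℝ (fderiv ℝ ψ) z b a := by
    intro a b
    have e : ((∂_{a} ψ : 𝓓(Ω, ℝ)) : ST → ℝ) = fun y => fderiv ℝ ψ y a := by
      funext y; exact lineDeriv_apply ψ a y
    rw [lineDeriv_apply, e, fderiv_clm_apply]
    · simp
    · exact ((ψ.contDiff.fderiv_right (m := ∞) (by simp)).differentiable (by simp)).differentiableAt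
    · exact differentiableAt_const _
  rw [h, h]
  exact (ψ.contDiff.contDiffAt.isSymmSndFDerivAt (by simpa using ENat.LEInfty.out)) _ _

/-- A locally integrable kernel of bounded support. -/
structure IsKernel (k : E3 → ℝ) : Prop where
  locallyIntegrable : LocallyIntegrable k
  support : ∃ ρ : ℝ, ∀ w, ρ ≤ ‖w‖ → k w = 0

/-- Convolution in the space variable, on test functions. -/
def testConv {k : E3 → ℝ} (hk : IsKernel k) (ψ : 𝓓(slab a b, ℝ)) : 𝓓(slab a b, ℝ) where
  toFun := spaceConv k ψ
  contDiff' := contDiff_spaceConv hk.locallyIntegrable ψ.contDiff ψ.hasCompactSupport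
  hasCompactSupport' := by
    obtain ⟨ρ, hρ⟩ := hk.support
    refine HasCompactSupport.of_support_subset_isCompact
      ((ψ.hasCompactSupport.isCompact.prod (isCompact_closedBall (0 : E3) ρ)).image
        (by fun_prop : Continuous fun q : ST × E3 => (q.1.1 + q.2, q.1.2))) ?_
    exact (subset_tsupport _).trans (tsupport_spaceConv_subset hρ ψ.hasCompactSupport)
  tsupport_subset' := by
    obtain ⟨ρ, hρ⟩ := hk.support
    refine (tsupport_spaceConv_subset hρ ψ.hasCompactSupport).trans ?_
    rintro _ ⟨q, ⟨hq, -⟩, rfl⟩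
    have h := ψ.tsupport_subset hq
    exact h

theorem testConv_apply {k : E3 → ℝ} (hk : IsKernel k) (ψ : 𝓓(slab a b, ℝ)) (z : ST) :
    testConv hk ψ z = ∫ w, k w * slice ψ z.2 (z.1 - w) := rfl

theorem lineDeriv_testConv {k : E3 → ℝ} (hk : IsKernel k) (ψ : 𝓓(slab a b, ℝ)) (v : ST) :
    ∂_{v} (testConv hk ψ) = testConv hk (∂_{v} ψ) := by
  ext z
  rw [lineDeriv_apply]
  have e : ((∂_{v} ψ : 𝓓(slab a b, ℝ)) : ST → ℝ) = fun y => fderiv ℝ ψ y v := by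
    funext y; exact lineDeriv_apply ψ v y
  change fderiv ℝ (spaceConv k ψ) z v = spaceConv k (∂_{v} ψ : 𝓓(slab a b, ℝ)) z
  rw [e]
  exact fderiv_spaceConv hk.locallyIntegrable ψ.contDiff ψ.hasCompactSupport z v

theorem isKernel_truncNewton {R : ℝ} (hR : 0 < R) : IsKernel (truncNewton R) :=
  ⟨locallyIntegrable_truncNewton R, 2 * R, fun _ => truncNewton_eq_zero hR⟩

theorem isKernel_traceKernel {R : ℝ} (hR : 0 < R) : IsKernel (traceKernel R) :=
  ⟨(contDiff_traceKernel R).continuous.locallyIntegrable, 2 * R, fun _ => traceKernel_eq_zero hR⟩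

/-- Joint continuity in space and time is not visible from the principal value; it is inherited from
the convolution of E with ∂_i∂_jψ. -/
theorem continuous_rieszRR_slice {Ω : TopologicalSpace.Opens ST} (ψ : 𝓓(Ω, ℝ)) (i j : Fin 3) :
    Continuous fun z : ST => rieszRR i j (slice ψ z.2) z.1 := by
  set φ := ∂_{spaceDir i} (∂_{spaceDir j} ψ)
  have h := (contDiff_spaceConv locallyIntegrable_regNewton φ.contDiff
    φ.hasCompactSupport).continuous
  have e : (fun z : ST => rieszRR i j (slice ψ z.2) z.1) = spaceConv (regNewton 0) φ := by
    funext z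
    rw [← integral_newton_mul_pd_pd (isTest_slice ψ z.2), ← slice_lineDeriv, ← slice_lineDeriv]
    rfl
  rwa [e]

theorem exists_support_radius {Ω : TopologicalSpace.Opens ST} (ψ : 𝓓(Ω, ℝ)) :
    ∃ ρ : ℝ, 0 < ρ ∧ ∀ z : ST, (ρ ≤ ‖z.1‖ ∨ ρ ≤ |z.2|) → z ∉ tsupport ψ := by
  obtain ⟨ρ, h0, h⟩ := ψ.hasCompactSupport.isCompact.isBounded.subset_ball_lt 0 0
  refine ⟨ρ, h0, fun z hz h' => ?_⟩
  have := h h'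
  rw [mem_ball_zero_iff, Prod.norm_def, max_lt_iff] at this
  rcases hz with hz | hz
  · linarith [this.1]
  · have := this.2
    rw [Real.norm_eq_abs] at this
    linarith

theorem exists_test_bound {Ω : TopologicalSpace.Opens ST} (ψ : 𝓓(Ω, ℝ)) :
    ∃ M : ℝ, 0 ≤ M ∧ ∀ z, |ψ z| ≤ M := by
  obtain ⟨M, hM⟩ := ψ.continuous.bounded_above_of_compact_support ψ.hasCompactSupport
  exact ⟨M, (norm_nonneg _).trans (hM 0), hM⟩

end

section

/-! ### Consequences of the decay of the velocity -/

/-- Lebesgue measure on the slab `ℝ³ × (0, T)`. -/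
abbrev slabMeasure (T : EReal) : Measure ST := volume.restrict (slab 0 T)

theorem restrict_slab_prod (T : EReal) (s : Set E3) :
    (slabMeasure T).restrict (s ×ˢ univ) =
      (volume.restrict s).prod (volume.restrict (timeInterval 0 T)) := by
  rw [Measure.prod_restrict, ← Measure.volume_eq_prod,
    Measure.restrict_restrict' (slab 0 T).isOpen.measurableSet]
  congr 1
  ext z
  simp [slab]

theorem slabMeasure_eq_prod (T : EReal) :
    slabMeasure T = volume.prod (volume.restrict (timeInterval 0 T)) := by
  have := restrict_slab_prod T univ
  rwa [univ_prod_univ, Measure.restrict_univ, Measure.restrict_univ] at this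

theorem setLIntegral_slab {T : EReal} {u : ST → E3}
    (hu : AEStronglyMeasurable u (slabMeasure T)) (ρ : ℝ) :
    ∫⁻ z in Metric.ball 0 ρ ×ˢ univ, ‖u z‖ₑ ^ 2 ∂(slabMeasure T) =
      ∫⁻ t in timeInterval 0 T, ∫⁻ x in Metric.ball (0 : E3) ρ, ‖u (x, t)‖ₑ ^ 2 := by
  have h : AEMeasurable (fun z => ‖u z‖ₑ ^ 2)
      ((slabMeasure T).restrict (Metric.ball 0 ρ ×ˢ univ)) :=
    (hu.enorm.pow_const 2).restrict
  rw [restrict_slab_prod] at h ⊢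
  rw [lintegral_prod_symm _ h]

/-- The integrability and decay properties of the velocity used in the construction of the
pressure. -/
structure VelocityDecay (T : EReal) (u : ST → E3) : Prop where
  aestronglyMeasurable : AEStronglyMeasurable u (slabMeasure T)
  integrableOn_ball : ∀ ρ : ℝ,
    IntegrableOn (fun z => ‖u z‖ ^ 2) (Metric.ball 0 ρ ×ˢ univ) (slabMeasure T)
  integrable_weight : Integrable (fun z => ‖u z‖ ^ 2 * weight z.1) (slabMeasure T)
  tendsto_average : Tendsto (fun R : ℝ =>
    (R ^ 3)⁻¹ * ∫ z in Metric.ball 0 (3 * R) ×ˢ univ, ‖u z‖ ^ 2 ∂(slabMeasure T)) atTop (𝓝 0)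

/-- The term with 2^n ≤ 1 + |y| < 2^{n+1} already dominates. This dyadic form allows |u|² times the
weight to be integrated using only its integrals over balls. -/
theorem weight_le_tsum (y : E3) : ENNReal.ofReal (weight y) ≤
    ∑' n : ℕ, ENNReal.ofReal ((2 ^ (4 * n))⁻¹) *
      (Metric.ball (0 : E3) (2 ^ (n + 1))).indicator 1 y := by
  obtain ⟨n, h1, h2⟩ := exists_nat_pow_near (x := 1 + ‖y‖) (y := 2)
    (by linarith [norm_nonneg y]) (by norm_num)
  refine le_trans ?_ (ENNReal.le_tsum n)
  rw [indicator_of_mem (by rw [mem_ball_zero_iff]; linarith)]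
  simp only [Pi.one_apply, mul_one]
  refine ENNReal.ofReal_le_ofReal ?_
  unfold weight
  gcongr
  rw [mul_comm, pow_mul]
  gcongr

/-- The decay hypothesis bounds the integral of |u|² over balls by a cubic polynomial in the radius.
In the dyadic sum for the weight, 2^{-4n} against 2^{3n} leaves a convergent geometric series. -/
theorem velocityDecay_of_tendsto {T : EReal} {u : ST → E3}
    (hu : AEStronglyMeasurable u (slabMeasure T))
    (hd : Tendsto (fun R : ℝ =>
      (∫⁻ t in timeInterval 0 T, ∫⁻ x in Metric.ball (0 : E3) R, ‖u (x, t)‖ₑ ^ 2) /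
        ENNReal.ofReal (R ^ 3)) atTop (𝓝 0)) : VelocityDecay T u := by
  set en : ℝ → ENNReal := fun ρ =>
    ∫⁻ z in Metric.ball 0 ρ ×ˢ univ, ‖u z‖ₑ ^ 2 ∂(slabMeasure T) with hen
  simp_rw [← setLIntegral_slab hu] at hd
  change Tendsto (fun R : ℝ => en R / ENNReal.ofReal (R ^ 3)) atTop (𝓝 0) at hd
  have hmono : Monotone en := fun r s hrs =>
    lintegral_mono_set (prod_mono (Metric.ball_subset_ball hrs) le_rfl)
  obtain ⟨r₀, hr₀⟩ := eventually_atTop.1 (hd.eventually (gt_mem_nhds zero_lt_one))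
  set r₁ := max r₀ 1
  have hr₁ : 1 ≤ r₁ := le_max_right _ _
  -- Enlarging the radius by r₁ puts it beyond the threshold after which the average is at most 1,
  -- so the bound covers small balls too.
  have hbound : ∀ ρ, 0 ≤ ρ → en ρ ≤ ENNReal.ofReal ((r₁ + ρ) ^ 3) := by
    intro ρ hρ
    refine (hmono (by linarith : ρ ≤ r₁ + ρ)).trans ?_
    have h := (hr₀ (r₁ + ρ) (by linarith [le_max_left r₀ 1])).le
    have hpos : 0 < (r₁ + ρ) ^ 3 := by positivity
    rwa [ENNReal.div_le_iff (by simpa using hpos) ENNReal.ofReal_ne_top, one_mul] at h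
  have hfin : ∀ ρ, en ρ < ⊤ := fun ρ =>
    (hmono (le_max_left ρ 0)).trans_lt ((hbound _ (le_max_right _ _)).trans_lt ENNReal.ofReal_lt_top)
  have hms : ∀ ρ : ℝ, MeasurableSet (Metric.ball (0 : E3) ρ ×ˢ (univ : Set ℝ)) := fun ρ =>
    measurableSet_ball.prod MeasurableSet.univ
  have hsq : ∀ z, ‖‖u z‖ ^ 2‖ₑ = ‖u z‖ₑ ^ 2 := fun z => by simp
  have hball : ∀ ρ : ℝ,
      IntegrableOn (fun z => ‖u z‖ ^ 2) (Metric.ball 0 ρ ×ˢ univ) (slabMeasure T) := by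
    intro ρ
    refine ⟨(hu.norm.pow 2).restrict, ?_⟩
    rw [hasFiniteIntegral_iff_enorm]
    simp_rw [hsq]
    exact hfin ρ
  refine ⟨hu, hball, ⟨(hu.norm.pow 2).mul
    (continuous_weight.comp continuous_fst).aestronglyMeasurable, ?_⟩, ?_⟩
  · rw [hasFiniteIntegral_iff_enorm]
    have h1 : ∀ z, ‖‖u z‖ ^ 2 * weight z.1‖ₑ ≤ ∑' n : ℕ, ENNReal.ofReal ((2 ^ (4 * n))⁻¹) *
        (Metric.ball (0 : E3) (2 ^ (n + 1)) ×ˢ univ).indicator (fun z => ‖u z‖ₑ ^ 2) z := by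
      intro z
      rw [enorm_mul, hsq, Real.enorm_of_nonneg (weight_pos _).le]
      refine (mul_le_mul_right (weight_le_tsum z.1) _).trans (le_of_eq ?_)
      rw [← ENNReal.tsum_mul_left]
      refine tsum_congr fun n => ?_
      by_cases hz : z.1 ∈ Metric.ball (0 : E3) (2 ^ (n + 1))
      · have hz' : z ∈ Metric.ball (0 : E3) (2 ^ (n + 1)) ×ˢ (univ : Set ℝ) := ⟨hz, mem_univ _⟩
        rw [indicator_of_mem hz, indicator_of_mem hz']
        simp [mul_comm]
      · have hz' : z ∉ Metric.ball (0 : E3) (2 ^ (n + 1)) ×ˢ (univ : Set ℝ) := fun h => hz h.1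
        rw [indicator_of_notMem hz, indicator_of_notMem hz']
        simp
    refine (lintegral_mono h1).trans_lt ?_
    rw [lintegral_tsum fun n => ((hu.enorm.pow_const 2).indicator (hms _)).const_mul _]
    have h2 : ∀ n : ℕ, ∫⁻ z, ENNReal.ofReal ((2 ^ (4 * n))⁻¹) *
        (Metric.ball (0 : E3) (2 ^ (n + 1)) ×ˢ univ).indicator (fun z => ‖u z‖ₑ ^ 2) z
          ∂(slabMeasure T) ≤ ENNReal.ofReal ((r₁ + 2) ^ 3 * (1 / 2) ^ n) := by
      intro n
      rw [lintegral_const_mul'' _ ((hu.enorm.pow_const 2).indicator (hms _)),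
        lintegral_indicator (hms _)]
      refine (mul_le_mul_right (hbound (2 ^ (n + 1)) (by positivity)) _).trans ?_
      rw [← ENNReal.ofReal_mul (by positivity)]
      refine ENNReal.ofReal_le_ofReal ?_
      rw [inv_mul_le_iff₀ (by positivity)]
      have h3 : r₁ + 2 ^ (n + 1) ≤ (r₁ + 2) * 2 ^ n := by
        have : (1 : ℝ) ≤ 2 ^ n := one_le_pow₀ (by norm_num)
        rw [pow_succ]
        nlinarith
      calc _ ≤ ((r₁ + 2) * 2 ^ n) ^ 3 := by gcongr
        _ = _ := by
          rw [div_pow, one_pow, mul_comm 4 n, pow_mul]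
          field_simp
    refine (ENNReal.tsum_le_tsum h2).trans_lt ?_
    rw [← ENNReal.ofReal_tsum_of_nonneg (fun n => by positivity)
      (summable_geometric_two.mul_left _)]
    exact ENNReal.ofReal_lt_top
  -- The factor 27 = 3³ passes from averages normalized by (3R)³ to averages normalized by R³.
  · have h1 : Tendsto (fun R : ℝ => 27 * (en (3 * R) / ENNReal.ofReal ((3 * R) ^ 3)).toReal) atTop
        (𝓝 (27 * (0 : ENNReal).toReal)) :=
      ((ENNReal.tendsto_toReal ENNReal.zero_ne_top).comp
        (hd.comp (tendsto_id.const_mul_atTop (by norm_num : (0 : ℝ) < 3)))).const_mul 27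
    rw [ENNReal.toReal_zero, mul_zero] at h1
    refine h1.congr' ?_
    filter_upwards [Ioi_mem_atTop 0] with R hR
    have hR : 0 < R := hR
    have h2 : ∫ z in Metric.ball 0 (3 * R) ×ˢ univ, ‖u z‖ ^ 2 ∂(slabMeasure T) =
        (en (3 * R)).toReal := by
      rw [integral_eq_lintegral_of_nonneg_ae (Eventually.of_forall fun z => sq_nonneg _)
        (hball _).aestronglyMeasurable]
      congr 1
      refine lintegral_congr fun z => ?_
      rw [ENNReal.ofReal_pow (norm_nonneg _), ofReal_norm]
    rw [h2, ENNReal.toReal_div, ENNReal.toReal_ofReal (by positivity)]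
    field_simp
    norm_num

theorem volume_slab_cylinder_lt_top (T : EReal) (r ρ : ℝ) :
    slabMeasure T (Metric.ball (0 : E3) r ×ˢ Ioo (-ρ) ρ) < ⊤ := by
  refine (Measure.restrict_le_self _).trans_lt ?_
  rw [Measure.volume_eq_prod, Measure.prod_prod]
  exact ENNReal.mul_lt_top measure_ball_lt_top (by simp)

theorem slab_cylinder_real_le (T : EReal) {r ρ : ℝ} (hr : 0 ≤ r) (hρ : 0 < ρ) :
    (slabMeasure T).real (Metric.ball (0 : E3) r ×ˢ Ioo (-ρ) ρ) ≤
      r ^ 3 * (volume.real (Metric.ball (0 : E3) 1) * (2 * ρ)) := by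
  have h1 : (slabMeasure T).real (Metric.ball (0 : E3) r ×ˢ Ioo (-ρ) ρ) ≤
      (volume : Measure ST).real (Metric.ball (0 : E3) r ×ˢ Ioo (-ρ) ρ) := by
    refine ENNReal.toReal_mono ?_ (Measure.restrict_le_self _)
    rw [Measure.volume_eq_prod, Measure.prod_prod]
    exact (ENNReal.mul_lt_top measure_ball_lt_top (by simp)).ne
  refine h1.trans (le_of_eq ?_)
  rw [Measure.volume_eq_prod, measureReal_prod_prod, Measure.real,
    Measure.addHaar_ball _ _ hr]
  simp [Measure.real]
  rw [ENNReal.toReal_ofReal (by positivity : 0 ≤ r ^ 3),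
    ENNReal.toReal_ofReal (by positivity : 0 ≤ ρ + ρ)]
  ring

variable {T : EReal} {u : ST → E3}

theorem VelocityDecay.integrableOn_cylinder (hu : VelocityDecay T u) (r ρ : ℝ) :
    IntegrableOn (fun z => ‖u z‖ + ‖u z‖ ^ 2) (Metric.ball (0 : E3) r ×ˢ Ioo (-ρ) ρ)
      (slabMeasure T) := by
  have h2 : IntegrableOn (fun z => ‖u z‖ ^ 2) (Metric.ball (0 : E3) r ×ˢ Ioo (-ρ) ρ)
      (slabMeasure T) := (hu.integrableOn_ball r).mono_set (prod_mono le_rfl (subset_univ _))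
  have h1 : IntegrableOn (fun _ : ST => (1 : ℝ)) (Metric.ball (0 : E3) r ×ˢ Ioo (-ρ) ρ)
      (slabMeasure T) := integrableOn_const (volume_slab_cylinder_lt_top T r ρ).ne
  refine Integrable.add ((h1.add h2).mono' hu.aestronglyMeasurable.norm.restrict
    (Eventually.of_forall fun z => ?_)) h2
  simp only [norm_norm, Pi.add_apply]
  nlinarith [sq_nonneg (‖u z‖ - 1)]

/-- The linear term is absorbed by |u| ≤ δ + δ^{-1}|u|². On a bounded time interval the cylinder has
volume O(R³), so δ contributes O(δ) to the average, while the quadratic part tends to zero for each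
fixed δ. -/
theorem VelocityDecay.tendsto_cylinder (hu : VelocityDecay T u) {ρ : ℝ} (hρ : 0 < ρ) :
    Tendsto (fun R : ℝ => (R ^ 3)⁻¹ * ∫ z in Metric.ball (0 : E3) (3 * R) ×ˢ Ioo (-ρ) ρ,
      (‖u z‖ + ‖u z‖ ^ 2) ∂(slabMeasure T)) atTop (𝓝 0) := by
  set V := volume.real (Metric.ball (0 : E3) 1) * (2 * ρ)
  have hV : 0 ≤ V := by positivity
  rw [Metric.tendsto_atTop']
  intro ε hε
  obtain ⟨δ, hδ0, hδ⟩ : ∃ δ : ℝ, 0 < δ ∧ δ * (27 * V) < ε / 2 := by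
    refine ⟨ε / 2 / (27 * V + 1), by positivity, ?_⟩
    rw [div_mul_eq_mul_div, div_lt_iff₀ (by positivity)]
    nlinarith
  have hlim := (hu.tendsto_average.const_mul (δ⁻¹ + 1))
  rw [mul_zero] at hlim
  obtain ⟨N, hN⟩ := eventually_atTop.1 (hlim.eventually (gt_mem_nhds (half_pos hε)))
  refine ⟨max N 0, fun R hR => ?_⟩
  have hR0 : 0 < R := (le_max_right _ _).trans_lt hR
  have hRN := hN R ((le_max_left _ _).trans hR.le)
  have hset : Metric.ball (0 : E3) (3 * R) ×ˢ Ioo (-ρ) ρ ⊆ Metric.ball (0 : E3) (3 * R) ×ˢ univ :=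
    prod_mono le_rfl (subset_univ _)
  have h2 := (hu.integrableOn_ball (3 * R)).mono_set hset
  have hone : IntegrableOn (fun _ : ST => δ) (Metric.ball (0 : E3) (3 * R) ×ˢ Ioo (-ρ) ρ)
      (slabMeasure T) := integrableOn_const (volume_slab_cylinder_lt_top T _ ρ).ne
  have hle : ∫ z in Metric.ball (0 : E3) (3 * R) ×ˢ Ioo (-ρ) ρ,
      (‖u z‖ + ‖u z‖ ^ 2) ∂(slabMeasure T) ≤ δ * ((3 * R) ^ 3 * V) +
        (δ⁻¹ + 1) * ∫ z in Metric.ball 0 (3 * R) ×ˢ univ, ‖u z‖ ^ 2 ∂(slabMeasure T) := by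
    calc _ ≤ ∫ z in Metric.ball (0 : E3) (3 * R) ×ˢ Ioo (-ρ) ρ,
          (δ + (δ⁻¹ + 1) * ‖u z‖ ^ 2) ∂(slabMeasure T) := by
          refine integral_mono (hu.integrableOn_cylinder _ ρ) (hone.add (h2.const_mul _))
            fun z => ?_
          have : ‖u z‖ ≤ δ + δ⁻¹ * ‖u z‖ ^ 2 := by
            rw [← sub_nonneg]
            have e : δ + δ⁻¹ * ‖u z‖ ^ 2 - ‖u z‖ =
                δ⁻¹ * ((‖u z‖ - δ / 2) ^ 2 + 3 / 4 * δ ^ 2) := by field_simp; ring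
            rw [e]; positivity
          simp only
          linarith
      _ = δ * (slabMeasure T).real (Metric.ball (0 : E3) (3 * R) ×ˢ Ioo (-ρ) ρ) + (δ⁻¹ + 1) *
          ∫ z in Metric.ball (0 : E3) (3 * R) ×ˢ Ioo (-ρ) ρ, ‖u z‖ ^ 2 ∂(slabMeasure T) := by
          rw [integral_add hone (h2.const_mul _), integral_const_mul, setIntegral_const,
            smul_eq_mul, mul_comm δ]
      _ ≤ _ := by
          gcongr
          · exact slab_cylinder_real_le T (by positivity) hρ
          · exact Eventually.of_forall fun z => sq_nonneg _
          · exact hu.integrableOn_ball _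
  rw [dist_zero_right, Real.norm_of_nonneg (mul_nonneg (by positivity)
    (integral_nonneg fun z => by positivity))]
  calc _ ≤ (R ^ 3)⁻¹ * (δ * ((3 * R) ^ 3 * V) +
        (δ⁻¹ + 1) * ∫ z in Metric.ball 0 (3 * R) ×ˢ univ, ‖u z‖ ^ 2 ∂(slabMeasure T)) := by gcongr
    _ = δ * (27 * V) + (δ⁻¹ + 1) * ((R ^ 3)⁻¹ *
        ∫ z in Metric.ball 0 (3 * R) ×ˢ univ, ‖u z‖ ^ 2 ∂(slabMeasure T)) := by
        field_simp; ring
    _ < ε / 2 + ε / 2 := add_lt_add hδ hRN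
    _ = ε := by ring

theorem abs_velocity_mul_le (u : ST → E3) (i j : Fin 3) (z : ST) :
    |u z i * u z j| ≤ ‖u z‖ ^ 2 := by
  rw [abs_mul, sq]
  exact mul_le_mul (abs_coord_le _ i) (abs_coord_le _ j) (abs_nonneg _) (norm_nonneg _)

theorem VelocityDecay.aestronglyMeasurable_coord (hu : VelocityDecay T u) (i : Fin 3) :
    AEStronglyMeasurable (fun z => u z i) (slabMeasure T) :=
  (EuclideanSpace.proj i : E3 →L[ℝ] ℝ).continuous.comp_aestronglyMeasurable hu.aestronglyMeasurable

theorem VelocityDecay.integrable_mul (hu : VelocityDecay T u) (i j : Fin 3) {f : ST → ℝ} {C : ℝ}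
    (hf : AEStronglyMeasurable f (slabMeasure T)) (hC : ∀ z, |f z| ≤ C * weight z.1) :
    Integrable (fun z => u z i * u z j * f z) (slabMeasure T) := by
  refine (hu.integrable_weight.const_mul C).mono'
    (((hu.aestronglyMeasurable_coord i).mul (hu.aestronglyMeasurable_coord j)).mul hf)
    (Eventually.of_forall fun z => ?_)
  rw [norm_mul]
  calc _ ≤ ‖u z‖ ^ 2 * (C * weight z.1) :=
        mul_le_mul (abs_velocity_mul_le u i j z) (hC z) (abs_nonneg _) (by positivity)
    _ = _ := by ring

theorem VelocityDecay.abs_integral_mul_le (hu : VelocityDecay T u) (i j : Fin 3) {f : ST → ℝ}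
    {C : ℝ} (hC : ∀ z, |f z| ≤ C * weight z.1) :
    |∫ z, u z i * u z j * f z ∂(slabMeasure T)| ≤
      C * ∫ z, ‖u z‖ ^ 2 * weight z.1 ∂(slabMeasure T) := by
  rw [← integral_const_mul, ← Real.norm_eq_abs]
  refine norm_integral_le_of_norm_le (hu.integrable_weight.const_mul C)
    (Eventually.of_forall fun z => ?_)
  rw [norm_mul]
  calc _ ≤ ‖u z‖ ^ 2 * (C * weight z.1) :=
        mul_le_mul (abs_velocity_mul_le u i j z) (hC z) (abs_nonneg _) (by positivity)
    _ = _ := by ring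

end

section

/-! ### The expansion pressure -/

variable {Θ : E3 → ℝ} {T : EReal} {u : ST → E3}

/-- `R_i R_j g - (1 - θ_R(x₀ - ·)) K_ij(x₀ - ·) ∫ g`, the function dual to `u_i u_j` in the local
pressure expansion. -/
def expansionDensity (Θ : E3 → ℝ) (x₀ : E3) (R : ℝ) (i j : Fin 3) (g : 𝓓(slab 0 T, ℝ))
    (z : ST) : ℝ :=
  rieszRR i j (slice g z.2) z.1 - anchor Θ x₀ R i j z.1 * ∫ x, slice g z.2 x

theorem measurable_integral_slice (g : 𝓓(slab 0 T, ℝ)) :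
    Measurable fun t : ℝ => ∫ x, slice g t x := by
  have h : StronglyMeasurable fun q : ℝ × E3 => g (q.2, q.1) :=
    g.stronglyMeasurable.comp_measurable (by fun_prop)
  exact (h.integral_prod_right (ν := volume)).measurable

theorem measurable_expansionDensity (hΘ : IsCutoff Θ) (x₀ : E3) (R : ℝ) (i j : Fin 3)
    (g : 𝓓(slab 0 T, ℝ)) : Measurable (expansionDensity Θ x₀ R i j g) :=
  (continuous_rieszRR_slice g i j).measurable.sub
    (((measurable_anchor hΘ x₀ R i j).comp measurable_fst).mul
      ((measurable_integral_slice g).comp measurable_snd))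

theorem expansionDensity_bound (hΘ : IsCutoff Θ) (x₀ : E3) {R : ℝ} (hR : 0 < R) {ρ : ℝ}
    (hρ0 : 0 < ρ) (i j : Fin 3) :
    ∃ C : ℝ, 0 ≤ C ∧ ∀ (g : 𝓓(slab 0 T, ℝ)) (M : ℝ), (∀ z : ST, ρ ≤ ‖z.1‖ → g z = 0) →
      (∀ z, |g z| ≤ M) → (∀ z, |(∂_{spaceDir i} (∂_{spaceDir j} g)) z| ≤ M) →
      ∀ z, |expansionDensity Θ x₀ R i j g z| ≤ C * M * weight z.1 := by
  obtain ⟨C, hC0, hC⟩ := rieszRR_sub_anchor_bound hΘ x₀ hR hρ0 i j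
  refine ⟨C, hC0, fun g M hρ hM hM2 z => ?_⟩
  refine hC (slice g z.2) M (isTest_slice g z.2) (fun x hx => hρ (x, z.2) hx)
    (fun x => hM (x, z.2)) (fun x => ?_) z.1
  rw [← slice_lineDeriv, ← slice_lineDeriv]
  exact hM2 (x, z.2)

theorem exists_expansionDensity_bound (hΘ : IsCutoff Θ) (x₀ : E3) {R : ℝ} (hR : 0 < R)
    (i j : Fin 3) (g : 𝓓(slab 0 T, ℝ)) :
    ∃ C : ℝ, ∀ z, |expansionDensity Θ x₀ R i j g z| ≤ C * weight z.1 := by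
  obtain ⟨ρ, hρ0, hρ⟩ := exists_support_radius g
  obtain ⟨C, hC0, hC⟩ := expansionDensity_bound (T := T) hΘ x₀ hR hρ0 i j
  obtain ⟨M₁, hM₁0, hM₁⟩ := exists_test_bound g
  obtain ⟨M₂, hM₂0, hM₂⟩ := exists_test_bound (∂_{spaceDir i} (∂_{spaceDir j} g))
  exact ⟨C * (M₁ + M₂), hC g (M₁ + M₂)
    (fun z hz => image_eq_zero_of_notMem_tsupport (hρ z (Or.inl hz)))
    (fun z => (hM₁ z).trans (by linarith)) (fun z => (hM₂ z).trans (by linarith))⟩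

theorem integrable_expansionDensity (hΘ : IsCutoff Θ) (hu : VelocityDecay T u) (x₀ : E3) {R : ℝ}
    (hR : 0 < R) (i j : Fin 3) (g : 𝓓(slab 0 T, ℝ)) :
    Integrable (fun z => u z i * u z j * expansionDensity Θ x₀ R i j g z) (slabMeasure T) := by
  obtain ⟨C, hC⟩ := exists_expansionDensity_bound hΘ x₀ hR i j g
  exact hu.integrable_mul i j (measurable_expansionDensity hΘ x₀ R i j g).aestronglyMeasurable hC

theorem slice_add (g h : 𝓓(slab 0 T, ℝ)) (t : ℝ) : slice (g + h) t = slice g t + slice h t := rfl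

theorem slice_smul (c : ℝ) (g : 𝓓(slab 0 T, ℝ)) (t : ℝ) : slice (c • g) t = c • slice g t := rfl

/-- An absolutely convergent form of R_iR_j, from which linearity in g is immediate. -/
theorem rieszRR_slice (g : 𝓓(slab 0 T, ℝ)) (i j : Fin 3) (t : ℝ) (x : E3) :
    rieszRR i j (slice g t) x =
      ∫ z, regNewton 0 z * slice (∂_{spaceDir i} (∂_{spaceDir j} g)) t (x - z) := by
  rw [slice_lineDeriv, slice_lineDeriv, integral_newton_mul_pd_pd (isTest_slice g t)]

theorem integrable_newton_mul_slice (g : 𝓓(slab 0 T, ℝ)) (t : ℝ) (x : E3) :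
    Integrable fun z => regNewton 0 z * slice g t (x - z) :=
  integrable_newton_mul ((isTest_slice g t).comp_sub x).smooth.continuous
    ((isTest_slice g t).comp_sub x).supp

theorem expansionDensity_add (x₀ : E3) (R : ℝ) (i j : Fin 3) (g h : 𝓓(slab 0 T, ℝ)) (z : ST) :
    expansionDensity Θ x₀ R i j (g + h) z =
      expansionDensity Θ x₀ R i j g z + expansionDensity Θ x₀ R i j h z := by
  unfold expansionDensity
  rw [rieszRR_slice, rieszRR_slice, rieszRR_slice, LineDeriv.lineDerivOp_add,
    LineDeriv.lineDerivOp_add]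
  simp only [slice_add, Pi.add_apply, mul_add]
  rw [integral_add (integrable_newton_mul_slice _ _ _) (integrable_newton_mul_slice _ _ _),
    integral_add (isTest_slice g _).integrable (isTest_slice h _).integrable]
  ring

theorem expansionDensity_smul (x₀ : E3) (R : ℝ) (i j : Fin 3) (c : ℝ) (g : 𝓓(slab 0 T, ℝ))
    (z : ST) : expansionDensity Θ x₀ R i j (c • g) z = c * expansionDensity Θ x₀ R i j g z := by
  unfold expansionDensity
  rw [rieszRR_slice, rieszRR_slice, LineDeriv.lineDerivOp_smul, LineDeriv.lineDerivOp_smul]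
  simp only [slice_smul, Pi.smul_apply, smul_eq_mul, mul_left_comm _ c]
  rw [integral_const_mul, integral_const_mul]
  ring

/-- The functional `g ↦ ∫ u_i u_j (R_i R_j g - (1 - θ_R(x₀ - ·)) K_ij(x₀ - ·) ∫ g)`. -/
def expansionFunctional (Θ : E3 → ℝ) (u : ST → E3) (x₀ : E3) (R : ℝ) (g : 𝓓(slab 0 T, ℝ)) : ℝ :=
  ∑ i : Fin 3, ∑ j : Fin 3, ∫ z in slab 0 T, u z i * u z j * expansionDensity Θ x₀ R i j g z

theorem expansionFunctional_add (hΘ : IsCutoff Θ) (hu : VelocityDecay T u) (x₀ : E3) {R : ℝ}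
    (hR : 0 < R) (g h : 𝓓(slab 0 T, ℝ)) :
    expansionFunctional Θ u x₀ R (g + h) =
      expansionFunctional Θ u x₀ R g + expansionFunctional Θ u x₀ R h := by
  unfold expansionFunctional
  simp_rw [← Finset.sum_add_distrib, expansionDensity_add, mul_add]
  refine Finset.sum_congr rfl fun i _ => Finset.sum_congr rfl fun j _ => ?_
  exact integral_add (integrable_expansionDensity hΘ hu x₀ hR i j g)
    (integrable_expansionDensity hΘ hu x₀ hR i j h)

theorem expansionFunctional_smul (x₀ : E3) (R : ℝ) (c : ℝ) (g : 𝓓(slab 0 T, ℝ)) :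
    expansionFunctional Θ u x₀ R (c • g) = c * expansionFunctional Θ u x₀ R g := by
  unfold expansionFunctional
  simp_rw [Finset.mul_sum, expansionDensity_smul, mul_left_comm _ c]
  simp_rw [integral_const_mul]

/-- Sum of the sup norms of a test function and of its second spatial derivatives. -/
def testNorm (g : 𝓓(slab 0 T, ℝ)) : ℝ :=
  ‖TestFunction.toBoundedContinuousFunctionCLM ℝ g‖ + ∑ i : Fin 3, ∑ j : Fin 3,
    ‖TestFunction.toBoundedContinuousFunctionCLM ℝ (∂_{spaceDir i} (∂_{spaceDir j} g))‖

theorem continuous_testNorm : Continuous (testNorm (T := T)) := by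
  unfold testNorm
  have hB := (TestFunction.toBoundedContinuousFunctionCLM ℝ (Ω := slab 0 T) (F := ℝ)
    (n := ⊤)).continuous
  refine hB.norm.add (continuous_finsetSum _ fun i _ => continuous_finsetSum _ fun j _ => ?_)
  exact (hB.comp ((LineDeriv.continuous_lineDerivOp _).comp
    (LineDeriv.continuous_lineDerivOp _))).norm

theorem testNorm_zero : testNorm (0 : 𝓓(slab 0 T, ℝ)) = 0 := by
  simp only [testNorm, LineDeriv.lineDerivOp_zero, map_zero, norm_zero, Finset.sum_const_zero,
    add_zero]

theorem abs_le_testNorm (g : 𝓓(slab 0 T, ℝ)) (z : ST) : |g z| ≤ testNorm g := by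
  refine ((TestFunction.toBoundedContinuousFunctionCLM ℝ g).norm_coe_le_norm z).trans ?_
  exact le_add_of_nonneg_right (Finset.sum_nonneg fun i _ => Finset.sum_nonneg fun j _ =>
    norm_nonneg _)

theorem abs_lineDeriv_le_testNorm (g : 𝓓(slab 0 T, ℝ)) (i j : Fin 3) (z : ST) :
    |(∂_{spaceDir i} (∂_{spaceDir j} g)) z| ≤ testNorm g := by
  refine ((TestFunction.toBoundedContinuousFunctionCLM ℝ
    (∂_{spaceDir i} (∂_{spaceDir j} g))).norm_coe_le_norm z).trans ?_
  refine le_trans ?_ (le_add_of_nonneg_left (norm_nonneg _))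
  refine le_trans ?_ (Finset.single_le_sum (fun i _ => Finset.sum_nonneg fun j _ => norm_nonneg _)
    (Finset.mem_univ i))
  exact Finset.single_le_sum (f := fun j => ‖TestFunction.toBoundedContinuousFunctionCLM ℝ
    (∂_{spaceDir i} (∂_{spaceDir j} g))‖) (fun j _ => norm_nonneg _) (Finset.mem_univ j)

theorem exists_expansionFunctional_bound (hΘ : IsCutoff Θ) (hu : VelocityDecay T u) (x₀ : E3)
    {R : ℝ} (hR : 0 < R) {ρ : ℝ} (hρ0 : 0 < ρ) :
    ∃ C : ℝ, ∀ g : 𝓓(slab 0 T, ℝ), (∀ z : ST, ρ ≤ ‖z.1‖ → g z = 0) →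
      |expansionFunctional Θ u x₀ R g| ≤ C * testNorm g := by
  choose C hC0 hC using fun i j => expansionDensity_bound (T := T) hΘ x₀ hR hρ0 i j
  set I := ∫ z, ‖u z‖ ^ 2 * weight z.1 ∂(slabMeasure T)
  refine ⟨∑ i, ∑ j, C i j * I, fun g hg => ?_⟩
  unfold expansionFunctional
  simp_rw [Finset.sum_mul]
  refine (Finset.abs_sum_le_sum_abs _ _).trans (Finset.sum_le_sum fun i _ => ?_)
  refine (Finset.abs_sum_le_sum_abs _ _).trans (Finset.sum_le_sum fun j _ => ?_)
  refine (hu.abs_integral_mul_le i j (hC i j g _ hg (abs_le_testNorm g)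
    (abs_lineDeriv_le_testNorm g i j))).trans (le_of_eq ?_)
  ring

/-- Additivity reduces continuity to the origin, where the continuous majorant squeezes L to zero.
-/
theorem continuous_of_additive_of_bound {V : Type*} [AddCommGroup V] [TopologicalSpace V]
    [IsTopologicalAddGroup V] {L N : V → ℝ} (hL : ∀ v w, L (v + w) = L v + L w)
    (hN : Continuous N) (hN0 : N 0 = 0) (h : ∀ v, |L v| ≤ N v) : Continuous L := by
  refine continuous_of_continuousAt_zero (AddMonoidHom.mk' L hL) ?_
  rw [ContinuousAt, map_zero]
  have h0 := hN.tendsto 0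
  rw [hN0] at h0
  exact squeeze_zero_norm h h0

/-- Continuity of a distribution is tested on functions supported in one compact set. There a single
support radius ρ is available, which makes the constant in the bound by `testNorm` uniform. -/
theorem continuous_expansionFunctional_comp (hΘ : IsCutoff Θ) (hu : VelocityDecay T u) (x₀ : E3)
    {R : ℝ} (hR : 0 < R) (K : TopologicalSpace.Compacts ST) (hK : (K : Set ST) ⊆ slab 0 T) :
    Continuous (expansionFunctional Θ u x₀ R ∘
      (TestFunction.ofSupportedIn hK : 𝓓^{⊤}_{K}(ST, ℝ) → 𝓓(slab 0 T, ℝ))) := by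
  obtain ⟨ρ, hρ0, hρ⟩ := K.isCompact.isBounded.subset_ball_lt 0 0
  obtain ⟨C, hC⟩ := exists_expansionFunctional_bound hΘ hu x₀ hR hρ0
  have hadd : ∀ f g : 𝓓^{⊤}_{K}(ST, ℝ), TestFunction.ofSupportedIn hK (f + g) =
      TestFunction.ofSupportedIn hK f + TestFunction.ofSupportedIn hK g := fun f g =>
    map_add (TestFunction.ofSupportedInCLM ℝ hK) f g
  have hzero : TestFunction.ofSupportedIn hK (0 : 𝓓^{⊤}_{K}(ST, ℝ)) = 0 :=
    map_zero (TestFunction.ofSupportedInCLM ℝ hK)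
  refine continuous_of_additive_of_bound
    (N := fun f => C * testNorm (TestFunction.ofSupportedIn hK f)) (fun f g => ?_) ?_ ?_ fun f => ?_
  · rw [Function.comp_apply, hadd, expansionFunctional_add hΘ hu x₀ hR]
    rfl
  · exact (continuous_const.mul continuous_testNorm).comp (TestFunction.continuous_ofSupportedIn hK)
  · simp only [hzero, testNorm_zero, mul_zero]
  · refine hC _ fun z hz => ?_
    refine image_eq_zero_of_notMem_tsupport (f := f) fun h => ?_
    have h2 := hρ (f.tsupport_subset h)
    rw [mem_ball_zero_iff] at h2
    linarith [norm_fst_le z]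

/-- The distribution given by the local pressure expansion normalized at `(x₀, R)`. -/
def expansionPressure (hΘ : IsCutoff Θ) (hu : VelocityDecay T u) (x₀ : E3) {R : ℝ} (hR : 0 < R) :
    𝓓'(slab 0 T, ℝ) :=
  TestFunction.mkCLM ℝ (expansionFunctional Θ u x₀ R) (expansionFunctional_add hΘ hu x₀ hR)
    (expansionFunctional_smul x₀ R) (continuous_expansionFunctional_comp hΘ hu x₀ hR)

theorem expansionPressure_apply (hΘ : IsCutoff Θ) (hu : VelocityDecay T u) (x₀ : E3) {R : ℝ}
    (hR : 0 < R) (g : 𝓓(slab 0 T, ℝ)) :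
    expansionPressure hΘ hu x₀ hR g = expansionFunctional Θ u x₀ R g := rfl

end

section

/-! ### The near and far terms of the expansion -/

variable {Θ : E3 → ℝ} {T : EReal} {u : ST → E3}

/-- The function dual to `u_i u_j` in the near term. -/
def nearDensity (Θ : E3 → ℝ) (x₀ : E3) (R : ℝ) (i j : Fin 3) (g : 𝓓(slab 0 T, ℝ)) (z : ST) : ℝ :=
  cutoff Θ R (x₀ - z.1) * rieszRR i j (slice g z.2) z.1

theorem exists_nearDensity_bound (hΘ : IsCutoff Θ) (x₀ : E3) {R : ℝ} (hR : 0 < R)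
    (i j : Fin 3) (g : 𝓓(slab 0 T, ℝ)) :
    ∃ C : ℝ, ∀ z, |nearDensity Θ x₀ R i j g z| ≤ C * weight z.1 := by
  obtain ⟨ρ, hρ0, hρ⟩ := exists_support_radius g
  obtain ⟨B, hB0, hB⟩ := exists_cutoff_bound hΘ
  obtain ⟨M, hM0, hM⟩ := exists_test_bound (∂_{spaceDir i} (∂_{spaceDir j} g))
  set L := ‖x₀‖ + 4 * R with hL
  have hL0 : 0 < L := by positivity
  obtain ⟨C, hC0, hC⟩ := abs_rieszRR_le_near ρ L
  refine ⟨B * (C * M) * (1 + L) ^ 4, fun z => ?_⟩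
  have hw := weight_pos z.1
  rcases lt_or_ge ‖z.1‖ L with hz | hz
  · have h1 := hC (slice g z.2) M i j (isTest_slice g z.2)
      (fun x hx => image_eq_zero_of_notMem_tsupport (f := g) (hρ (x, z.2) (Or.inl hx)))
      (fun x => by rw [← slice_lineDeriv, ← slice_lineDeriv]; exact hM (x, z.2)) z.1 hz
    have h2 : |nearDensity Θ x₀ R i j g z| ≤ B * (C * M) := by
      rw [nearDensity, abs_mul]
      exact mul_le_mul (hB R _).1 h1 (abs_nonneg _) hB0
    have h3 : 1 ≤ (1 + L) ^ 4 * weight z.1 := by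
      unfold weight
      rw [← div_eq_mul_inv, le_div_iff₀ (by positivity), one_mul]
      gcongr
    calc _ ≤ B * (C * M) * 1 := by rwa [mul_one]
      _ ≤ B * (C * M) * ((1 + L) ^ 4 * weight z.1) := by gcongr
      _ = _ := by ring
  · have h1 : cutoff Θ R (x₀ - z.1) = 0 := by
      refine cutoff_eq_zero hΘ hR ?_
      have := norm_sub_norm_le z.1 x₀
      rw [norm_sub_rev] at this
      linarith
    rw [nearDensity, h1, zero_mul, abs_zero]
    positivity

theorem integrable_nearDensity (hΘ : IsCutoff Θ) (hu : VelocityDecay T u) (x₀ : E3) {R : ℝ}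
    (hR : 0 < R) (i j : Fin 3) (g : 𝓓(slab 0 T, ℝ)) :
    Integrable (fun z => u z i * u z j * nearDensity Θ x₀ R i j g z) (slabMeasure T) := by
  obtain ⟨C, hC⟩ := exists_nearDensity_bound hΘ x₀ hR i j g
  refine hu.integrable_mul i j ?_ hC
  exact (((continuous_cutoff hΘ R).comp (by fun_prop)).mul
    (continuous_rieszRR_slice g i j)).aestronglyMeasurable

theorem nearIntegrand_eq (x₀ : E3) (R : ℝ) (i j : Fin 3) (g : 𝓓(slab 0 T, ℝ)) :
    nearIntegrand Θ u x₀ R g i j = fun z => u z i * u z j * nearDensity Θ x₀ R i j g z := by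
  funext z
  rw [nearIntegrand, nearDensity, mul_assoc]
  rfl

/-- The kernel of the far term. -/
def farFactor (Θ : E3 → ℝ) (x₀ : E3) (R : ℝ) (i j : Fin 3) (x y : E3) : ℝ :=
  (kernelK i j (x - y) - kernelK i j (x₀ - y)) * (1 - cutoff Θ R (x₀ - y))

theorem farFactor_bound (hΘ : IsCutoff Θ) (x₀ : E3) {R : ℝ} (hR : 0 < R) (i j : Fin 3) :
    ∃ C : ℝ, 0 ≤ C ∧ ∀ x ∈ Metric.ball x₀ R, ∀ y, |farFactor Θ x₀ R i j x y| ≤ C * weight y := by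
  obtain ⟨B, hB0, hB⟩ := exists_cutoff_bound hΘ
  obtain ⟨C, hC0, hC⟩ := kernelK_lipschitz i j
  -- Chosen so that 1 + |y| ≤ A |x₀ - y| wherever |x₀ - y| ≥ 2R, the only region in which the factor
  -- is nonzero.
  set A := (1 + ‖x₀‖) / (2 * R) + 1 with hA
  have hA0 : 0 < A := by positivity
  refine ⟨C * R * A ^ 4 * B, by positivity, fun x hx y => ?_⟩
  rw [Metric.mem_ball, dist_eq_norm] at hx
  have hw := weight_pos y
  unfold farFactor
  rcases lt_or_ge ‖x₀ - y‖ (2 * R) with h | h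
  · rw [cutoff_eq_one hΘ hR h, sub_self, mul_zero, abs_zero]
    positivity
  · have hpos : 0 < ‖x₀ - y‖ := by linarith
    have e : x - y - (x₀ - y) = x - x₀ := by abel
    have h1 := hC (x - y) (x₀ - y) (norm_pos_iff.1 hpos) (by rw [e]; linarith)
    rw [e] at h1
    have h2 : (‖x₀ - y‖ ^ 4)⁻¹ ≤ A ^ 4 * weight y := by
      unfold weight
      rw [← div_eq_mul_inv, le_div_iff₀ (by positivity), inv_mul_le_iff₀ (by positivity), ← mul_pow]
      gcongr
      have h3 : ‖y‖ ≤ ‖x₀‖ + ‖x₀ - y‖ := by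
        have := norm_sub_norm_le y x₀
        rw [norm_sub_rev] at this
        linarith
      have h4 : (1 + ‖x₀‖) / (2 * R) * (2 * R) = 1 + ‖x₀‖ := by field_simp
      have h5 : (1 + ‖x₀‖) / (2 * R) * (2 * R) ≤ (1 + ‖x₀‖) / (2 * R) * ‖x₀ - y‖ := by gcongr
      rw [hA]
      linarith
    rw [abs_mul]
    calc _ ≤ (C * ‖x - x₀‖ / ‖x₀ - y‖ ^ 4) * B :=
          mul_le_mul h1 (hB R _).2 (abs_nonneg _) (by positivity)
      _ = C * ‖x - x₀‖ * B * (‖x₀ - y‖ ^ 4)⁻¹ := by ring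
      _ ≤ C * R * B * (A ^ 4 * weight y) := by gcongr
      _ = _ := by ring

theorem measurable_farFactor (hΘ : IsCutoff Θ) (x₀ : E3) (R : ℝ) (i j : Fin 3) :
    Measurable fun q : E3 × E3 => farFactor Θ x₀ R i j q.1 q.2 := by
  have hK := measurable_kernelK i j
  have hc := (continuous_cutoff hΘ R).measurable
  unfold farFactor
  exact ((hK.comp (measurable_fst.sub measurable_snd)).sub
    (hK.comp (measurable_const.sub measurable_snd))).mul
    (measurable_const.sub (hc.comp (measurable_const.sub measurable_snd)))

/-- The integrand of the far term, in the variables `(x, (y, t))`. -/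
def farSwapped (Θ : E3 → ℝ) (u : ST → E3) (x₀ : E3) (R : ℝ) (i j : Fin 3) (g : 𝓓(slab 0 T, ℝ))
    (q : E3 × ST) : ℝ :=
  u q.2 i * u q.2 j * (farFactor Θ x₀ R i j q.1 q.2.1 * g (q.1, q.2.2))

/-- Reordering ((x, t), y) as (x, (y, t)) lets Fubini integrate in x first, so that the far kernel
falls on the test function. -/
theorem measurePreserving_swapVariables (T : EReal) :
    MeasurePreserving (fun w : ST × E3 => (w.1.1, (w.2, w.1.2)))
      ((slabMeasure T).prod volume) (volume.prod (slabMeasure T)) := by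
  rw [slabMeasure_eq_prod]
  have h1 := measurePreserving_prodAssoc (volume : Measure E3)
    (volume.restrict (timeInterval 0 T) : Measure ℝ) (volume : Measure E3)
  have h2 := (MeasurePreserving.id (volume : Measure E3)).prod
    (Measure.measurePreserving_swap (μ := (volume.restrict (timeInterval 0 T) : Measure ℝ))
      (ν := (volume : Measure E3)))
  exact h2.comp h1

theorem aestronglyMeasurable_farSwapped (hΘ : IsCutoff Θ) (hu : VelocityDecay T u) (x₀ : E3)
    (R : ℝ) (i j : Fin 3) (g : 𝓓(slab 0 T, ℝ)) :
    AEStronglyMeasurable (farSwapped Θ u x₀ R i j g) (volume.prod (slabMeasure T)) := by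
  have h1 : Measurable fun q : E3 × ST => farFactor Θ x₀ R i j q.1 q.2.1 :=
    (measurable_farFactor hΘ x₀ R i j).comp (g := fun p : E3 × E3 => farFactor Θ x₀ R i j p.1 p.2)
      (f := fun q : E3 × ST => (q.1, q.2.1)) (measurable_fst.prodMk measurable_snd.fst)
  have h2 : Measurable fun q : E3 × ST => g (q.1, q.2.2) :=
    g.continuous.measurable.comp (by fun_prop : Measurable fun q : E3 × ST => (q.1, q.2.2))
  have h3 : AEStronglyMeasurable (fun z : ST => u z i * u z j) (slabMeasure T) :=
    (hu.aestronglyMeasurable_coord i).mul (hu.aestronglyMeasurable_coord j)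
  have h4 : AEStronglyMeasurable (fun q : E3 × ST => u q.2 i * u q.2 j)
      ((volume : Measure E3).prod (slabMeasure T)) := h3.comp_snd
  exact h4.mul (h1.mul h2).aestronglyMeasurable

theorem abs_farSwapped_le {x₀ : E3} {R C M : ℝ} {i j : Fin 3} {g : 𝓓(slab 0 T, ℝ)} (hC0 : 0 ≤ C)
    (hC : ∀ x ∈ Metric.ball x₀ R, ∀ y, |farFactor Θ x₀ R i j x y| ≤ C * weight y)
    (hM : ∀ z, |g z| ≤ M) (hg : tsupport g ⊆ Metric.ball x₀ R ×ˢ (univ : Set ℝ)) (q : E3 × ST) :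
    |farSwapped Θ u x₀ R i j g q| ≤
      C * M * ((Metric.ball x₀ R).indicator (1 : E3 → ℝ) q.1 * (‖u q.2‖ ^ 2 * weight q.2.1)) := by
  rw [farSwapped, abs_mul, abs_mul (farFactor _ _ _ _ _ _ _)]
  have hw := weight_pos q.2.1
  by_cases hq : q.1 ∈ Metric.ball x₀ R
  · rw [indicator_of_mem hq]
    have h3 := mul_le_mul (abs_velocity_mul_le u i j q.2)
      (mul_le_mul (hC q.1 hq q.2.1) (hM (q.1, q.2.2)) (abs_nonneg _) (by positivity))
      (by positivity) (by positivity)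
    refine h3.trans (le_of_eq ?_)
    simp only [Pi.one_apply]
    ring
  · have : g (q.1, q.2.2) = 0 := image_eq_zero_of_notMem_tsupport fun h => hq (hg h).1
    rw [this, abs_zero, mul_zero, mul_zero, indicator_of_notMem hq, zero_mul, mul_zero]

theorem integrable_farSwapped (hΘ : IsCutoff Θ) (hu : VelocityDecay T u) (x₀ : E3) {R : ℝ}
    (hR : 0 < R) (i j : Fin 3) (g : 𝓓(slab 0 T, ℝ))
    (hg : tsupport g ⊆ Metric.ball x₀ R ×ˢ (univ : Set ℝ)) :
    Integrable (farSwapped Θ u x₀ R i j g) (volume.prod (slabMeasure T)) := by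
  obtain ⟨C, hC0, hC⟩ := farFactor_bound hΘ x₀ hR i j
  obtain ⟨M, hM0, hM⟩ := exists_test_bound g
  have h1 : Integrable ((Metric.ball x₀ R).indicator (1 : E3 → ℝ)) :=
    (integrable_indicator_iff measurableSet_ball).2
      (integrableOn_const (C := (1 : ℝ)) measure_ball_lt_top.ne)
  have h2 := (h1.mul_prod hu.integrable_weight).const_mul (C * M)
  exact h2.mono' (aestronglyMeasurable_farSwapped hΘ hu x₀ R i j g)
    (Eventually.of_forall (abs_farSwapped_le hC0 hC hM hg))

theorem farKernel_mul_eq (x₀ : E3) (R : ℝ) (i j : Fin 3) (g : 𝓓(slab 0 T, ℝ)) :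
    (fun w : ST × E3 => farKernel Θ u x₀ R i j w.1 w.2 * g w.1) =
      farSwapped Θ u x₀ R i j g ∘ fun w : ST × E3 => (w.1.1, (w.2, w.1.2)) := by
  funext w
  simp only [farKernel, farSwapped, farFactor, Function.comp_apply]
  ring

theorem integrable_farKernel (hΘ : IsCutoff Θ) (hu : VelocityDecay T u) (x₀ : E3) {R : ℝ}
    (hR : 0 < R) (i j : Fin 3) (g : 𝓓(slab 0 T, ℝ))
    (hg : tsupport g ⊆ Metric.ball x₀ R ×ˢ (univ : Set ℝ)) :
    Integrable (fun w : ST × E3 => farKernel Θ u x₀ R i j w.1 w.2 * g w.1)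
      ((slabMeasure T).prod volume) := by
  rw [farKernel_mul_eq]
  exact (measurePreserving_swapVariables T).integrable_comp_of_integrable
    (integrable_farSwapped hΘ hu x₀ hR i j g hg)

/-- For |x₀ - y| < 2R both sides carry the factor 1 - θ_R = 0. Otherwise y is outside the support of
g, and R_iR_j g(y) is the plain integral of K_ij(y - x) g(x), with K_ij even. -/
theorem integral_farFactor_mul (hΘ : IsCutoff Θ) (x₀ : E3) {R : ℝ}
    (hR : 0 < R) (i j : Fin 3) (g : 𝓓(slab 0 T, ℝ))
    (hg : tsupport g ⊆ Metric.ball x₀ R ×ˢ (univ : Set ℝ)) (z : ST) :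
    ∫ x, farFactor Θ x₀ R i j x z.1 * g (x, z.2) =
      expansionDensity Θ x₀ R i j g z - nearDensity Θ x₀ R i j g z := by
  have hslice : ∀ x, x ∉ Metric.ball x₀ R → slice g z.2 x = 0 := fun x hx =>
    image_eq_zero_of_notMem_tsupport (f := g) fun h => hx (hg h).1
  have e : expansionDensity Θ x₀ R i j g z - nearDensity Θ x₀ R i j g z =
      (1 - cutoff Θ R (x₀ - z.1)) *
        (rieszRR i j (slice g z.2) z.1 - kernelK i j (x₀ - z.1) * ∫ x, slice g z.2 x) := by
    rw [expansionDensity, nearDensity, anchor]; ring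
  rw [e]
  rcases lt_or_ge ‖x₀ - z.1‖ (2 * R) with h | h
  · simp [farFactor, cutoff_eq_one hΘ hR h]
  · have hz : z.1 ∉ tsupport (slice g z.2) := by
      have h2 : tsupport (slice g z.2) ⊆ Metric.closedBall x₀ R := by
        refine closure_minimal (fun w hw => ?_) Metric.isClosed_closedBall
        by_contra h
        exact hw (hslice w fun h' => h (Metric.ball_subset_closedBall h'))
      intro h3
      have := h2 h3
      rw [Metric.mem_closedBall, dist_comm, dist_eq_norm] at this
      linarith
    rw [rieszRR_eq_integral hz]
    have hI : Integrable fun x => kernelK i j (z.1 - x) * slice g z.2 x := by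
      refine ((isTest_slice g z.2).integrable.norm.const_mul (R ^ (-3 : ℝ))).mono'
        (((measurable_kernelK i j).comp (by fun_prop)).aestronglyMeasurable.mul
          (isTest_slice g z.2).integrable.aestronglyMeasurable) (Eventually.of_forall fun x => ?_)
      rw [norm_mul]
      by_cases hx : x ∈ Metric.ball x₀ R
      · refine mul_le_mul_of_nonneg_right ?_ (norm_nonneg _)
        refine (abs_kernelK_le i j _).trans (Real.rpow_le_rpow_of_nonpos hR ?_ (by norm_num))
        rw [Metric.mem_ball, dist_eq_norm] at hx
        have h4 := norm_sub_le (z.1 - x) (x₀ - x)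
        have e2 : z.1 - x - (x₀ - x) = -(x₀ - z.1) := by abel
        rw [e2, norm_neg, norm_sub_rev x₀ x] at h4
        linarith
      · simp [hslice x hx]
    rw [← integral_const_mul, ← integral_sub hI ((isTest_slice g z.2).integrable.const_mul _),
      ← integral_const_mul]
    refine integral_congr_ae (Eventually.of_forall fun x => ?_)
    simp only [farFactor, slice]
    rw [← kernelK_neg i j (x - z.1), neg_sub]
    ring

theorem integral_farKernel (hΘ : IsCutoff Θ) (hu : VelocityDecay T u) (x₀ : E3) {R : ℝ}
    (hR : 0 < R) (i j : Fin 3) (g : 𝓓(slab 0 T, ℝ))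
    (hg : tsupport g ⊆ Metric.ball x₀ R ×ˢ (univ : Set ℝ)) :
    ∫ z in slab 0 T, (∫ y, farKernel Θ u x₀ R i j z y) * g z =
      ∫ z in slab 0 T, u z i * u z j *
        (expansionDensity Θ x₀ R i j g z - nearDensity Θ x₀ R i j g z) := by
  have hI := integrable_farKernel hΘ hu x₀ hR i j g hg
  have hS := integrable_farSwapped hΘ hu x₀ hR i j g hg
  simp_rw [← integral_mul_const]
  rw [← integral_prod (fun w : ST × E3 => farKernel Θ u x₀ R i j w.1 w.2 * g w.1) hI,
    farKernel_mul_eq]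
  have hmp := measurePreserving_swapVariables T
  have h1 : ∫ w, (farSwapped Θ u x₀ R i j g ∘ fun w : ST × E3 => (w.1.1, (w.2, w.1.2))) w
      ∂((slabMeasure T).prod volume) =
      ∫ q, farSwapped Θ u x₀ R i j g q ∂(volume.prod (slabMeasure T)) := by
    rw [← hmp.map_eq, integral_map hmp.measurable.aemeasurable]
    · rfl
    · rw [hmp.map_eq]; exact hS.aestronglyMeasurable
  rw [h1, integral_prod_symm _ hS]
  refine integral_congr_ae (Eventually.of_forall fun z => ?_)
  simp only [farSwapped]
  rw [integral_const_mul, integral_farFactor_mul hΘ x₀ hR i j g hg]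

theorem near_add_far_eq (hΘ : IsCutoff Θ) (hu : VelocityDecay T u) (x₀ : E3) {R : ℝ}
    (hR : 0 < R) (g : 𝓓(slab 0 T, ℝ)) (hg : tsupport g ⊆ Metric.ball x₀ R ×ˢ (univ : Set ℝ)) :
    nearTerm Θ T u x₀ R g + farTerm Θ T u x₀ R g = expansionFunctional Θ u x₀ R g := by
  unfold nearTerm farTerm expansionFunctional
  simp_rw [← Finset.sum_add_distrib]
  refine Finset.sum_congr rfl fun i _ => Finset.sum_congr rfl fun j _ => ?_
  have hn := integrable_nearDensity hΘ hu x₀ hR i j g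
  have hd := integrable_expansionDensity hΘ hu x₀ hR i j g
  rw [integral_farKernel hΘ hu x₀ hR i j g hg, nearIntegrand_eq]
  simp_rw [mul_sub]
  rw [integral_sub hd hn]
  ring

/-- The function of time by which the expansions normalized at `(x₁, S)` and `(x₀, R)` differ. -/
def timeShift (Θ : E3 → ℝ) (u : ST → E3) (x₁ x₀ : E3) (S R : ℝ) (t : ℝ) : ℝ :=
  ∑ i : Fin 3, ∑ j : Fin 3, ∫ y, u (y, t) i * u (y, t) j *
    (anchor Θ x₀ R i j y - anchor Θ x₁ S i j y)

theorem integrable_anchor_sub (hΘ : IsCutoff Θ) (hu : VelocityDecay T u) (x₁ x₀ : E3) {S R : ℝ}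
    (hS : 0 < S) (hR : 0 < R) (i j : Fin 3) :
    Integrable (fun z => u z i * u z j * (anchor Θ x₀ R i j z.1 - anchor Θ x₁ S i j z.1))
      (slabMeasure T) := by
  obtain ⟨C, -, hC⟩ := anchor_sub_anchor_bound hΘ x₀ x₁ hR hS i j
  refine hu.integrable_mul i j ?_ fun z => hC z.1
  exact (((measurable_anchor hΘ x₀ R i j).sub (measurable_anchor hΘ x₁ S i j)).comp
    measurable_fst).aestronglyMeasurable

theorem integrableOn_timeShift (hΘ : IsCutoff Θ) (hu : VelocityDecay T u) (x₁ x₀ : E3) {S R : ℝ}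
    (hS : 0 < S) (hR : 0 < R) :
    IntegrableOn (timeShift Θ u x₁ x₀ S R) (timeInterval 0 T) := by
  refine integrable_finsetSum _ fun i _ => integrable_finsetSum _ fun j _ => ?_
  have h := integrable_anchor_sub hΘ hu x₁ x₀ hS hR i j
  rw [slabMeasure_eq_prod] at h
  exact h.integral_prod_right

theorem integrable_time_mul {f : ST → ℝ} (hf : Integrable f (slabMeasure T))
    (g : 𝓓(slab 0 T, ℝ)) :
    Integrable (fun z : ST => (∫ y, f (y, z.2)) * g z) (slabMeasure T) := by
  obtain ⟨ρ, hρ0, hρ⟩ := exists_support_radius g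
  obtain ⟨M, hM0, hM⟩ := exists_test_bound g
  rw [slabMeasure_eq_prod] at hf ⊢
  have h1 : Integrable ((Metric.ball (0 : E3) ρ).indicator (1 : E3 → ℝ)) :=
    (integrable_indicator_iff measurableSet_ball).2
      (integrableOn_const (C := (1 : ℝ)) measure_ball_lt_top.ne)
  have h2 := h1.mul_prod hf.integral_prod_right
  refine (h2.norm.const_mul M).mono'
    (hf.integral_prod_right.aestronglyMeasurable.comp_snd.mul
      g.continuous.aestronglyMeasurable) (Eventually.of_forall fun z => ?_)
  rw [norm_mul, norm_mul]
  by_cases hz : z.1 ∈ Metric.ball (0 : E3) ρ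
  · rw [indicator_of_mem hz, Pi.one_apply, norm_one, one_mul, mul_comm]
    exact mul_le_mul_of_nonneg_right (hM z) (norm_nonneg _)
  · have : g z = 0 := image_eq_zero_of_notMem_tsupport
      (hρ z (Or.inl (by simpa using hz)))
    rw [this, norm_zero, mul_zero]
    positivity
-- At each time both sides are the product of the spatial integrals of f and g. The lemma converts a
-- multiple of ∫ g in the density into a function of time paired with g.
theorem integral_time_mul {f : ST → ℝ} (hf : Integrable f (slabMeasure T)) (g : 𝓓(slab 0 T, ℝ)) :
    ∫ z in slab 0 T, (∫ y, f (y, z.2)) * g z = ∫ z in slab 0 T, f z * ∫ x, slice g z.2 x := by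
  obtain ⟨ρ, hρ0, hρ⟩ := exists_support_radius g
  obtain ⟨M, hM0, hM⟩ := exists_test_bound g
  have hgm := (measurable_integral_slice g)
  have hI2 : Integrable (fun z : ST => f z * ∫ x, slice g z.2 x) (slabMeasure T) := by
    refine hf.mul_bdd (c := M * volume.real (Metric.ball (0 : E3) ρ))
      (hgm.comp measurable_snd).aestronglyMeasurable (Eventually.of_forall fun z => ?_)
    exact abs_integral_le_of_ball
      (fun x hx => image_eq_zero_of_notMem_tsupport (f := g) (hρ (x, z.2) (Or.inl hx)))
      fun x _ => hM (x, z.2)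
  have hI1 := integrable_time_mul hf g
  change ∫ z, _ ∂(slabMeasure T) = ∫ z, _ ∂(slabMeasure T)
  rw [slabMeasure_eq_prod] at hI1 hI2 ⊢
  rw [integral_prod_symm _ hI1, integral_prod_symm _ hI2]
  refine integral_congr_ae (Eventually.of_forall fun t => ?_)
  simp only
  rw [integral_const_mul, integral_mul_const]
  rfl

/-- The Riesz terms cancel. What remains is the difference of anchors times ∫ g, integrable against
u_i u_j, and Fubini turns it into the pairing with `timeShift`. -/
theorem expansionFunctional_sub (hΘ : IsCutoff Θ) (hu : VelocityDecay T u) (x₁ x₀ : E3) {S R : ℝ}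
    (hS : 0 < S) (hR : 0 < R) (g : 𝓓(slab 0 T, ℝ)) :
    expansionFunctional Θ u x₁ S g - ∫ z in slab 0 T, timeShift Θ u x₁ x₀ S R z.2 * g z =
      expansionFunctional Θ u x₀ R g := by
  have hI := fun i j => integrable_anchor_sub hΘ hu x₁ x₀ hS hR i j
  have h1 : ∀ i j, (∫ z in slab 0 T, u z i * u z j * expansionDensity Θ x₁ S i j g z) =
      (∫ z in slab 0 T, u z i * u z j * expansionDensity Θ x₀ R i j g z) +
        ∫ z in slab 0 T, (∫ y, u (y, z.2) i * u (y, z.2) j *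
          (anchor Θ x₀ R i j y - anchor Θ x₁ S i j y)) * g z := by
    intro i j
    rw [integral_time_mul (hI i j) g, ← sub_eq_iff_eq_add',
      ← integral_sub (integrable_expansionDensity hΘ hu x₁ hS i j g)
        (integrable_expansionDensity hΘ hu x₀ hR i j g)]
    refine integral_congr_ae (Eventually.of_forall fun z => ?_)
    simp only [expansionDensity]
    ring
  have h2 : ∫ z in slab 0 T, timeShift Θ u x₁ x₀ S R z.2 * g z =
      ∑ i : Fin 3, ∑ j : Fin 3, ∫ z in slab 0 T, (∫ y, u (y, z.2) i * u (y, z.2) j *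
          (anchor Θ x₀ R i j y - anchor Θ x₁ S i j y)) * g z := by
    simp only [timeShift, Finset.sum_mul]
    rw [integral_finsetSum _ fun i _ => integrable_finsetSum _ fun j _ =>
      integrable_time_mul (hI i j) g]
    refine Finset.sum_congr rfl fun i _ => ?_
    rw [integral_finsetSum _ fun j _ => integrable_time_mul (hI i j) g]
  rw [h2]
  unfold expansionFunctional
  simp_rw [h1, Finset.sum_add_distrib]
  ring

end

section

/-! ### The expansion of the pressure and its gradient -/

variable {Θ : E3 → ℝ} {T : EReal} {u : ST → E3}

theorem expansionHolds_of_apply_eq (hΘ : IsCutoff Θ) (hu : VelocityDecay T u)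
    {p : 𝓓'(slab 0 T, ℝ)} {x₁ x₀ : E3} {S R : ℝ} (hS : 0 < S) (hR : 0 < R) {g : 𝓓(slab 0 T, ℝ)}
    (hg : tsupport g ⊆ Metric.ball x₀ R ×ˢ (univ : Set ℝ))
    (hp : p g = expansionFunctional Θ u x₁ S g) :
    ExpansionHolds Θ T u p x₀ R (timeShift Θ u x₁ x₀ S R) g := by
  refine ⟨fun i j => ?_, fun i j => integrable_farKernel hΘ hu x₀ hR i j g hg, ?_⟩
  · rw [nearIntegrand_eq]
    exact integrable_nearDensity hΘ hu x₀ hR i j g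
  · rw [hp, near_add_far_eq hΘ hu x₀ hR g hg, expansionFunctional_sub hΘ hu x₁ x₀ hS hR g]

theorem isExpansionPressure_expansionPressure (hΘ : IsCutoff Θ) (hu : VelocityDecay T u) (x₁ : E3)
    {S : ℝ} (hS : 0 < S) : IsExpansionPressure Θ T u (expansionPressure hΘ hu x₁ hS) :=
  fun x₀ R hR => ⟨timeShift Θ u x₁ x₀ S R, integrableOn_timeShift hΘ hu x₁ x₀ hS hR,
    fun _ hg => expansionHolds_of_apply_eq hΘ hu hS hR hg rfl⟩

theorem tsupport_lineDeriv_subset {Ω : TopologicalSpace.Opens ST} (ψ : 𝓓(Ω, ℝ)) (v : ST) :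
    tsupport (∂_{v} ψ : 𝓓(Ω, ℝ)) ⊆ tsupport ψ := by
  have e : ((∂_{v} ψ : 𝓓(Ω, ℝ)) : ST → ℝ) = fun y => fderiv ℝ ψ y v := by
    funext y; exact lineDeriv_apply ψ v y
  rw [e]
  exact tsupport_fderiv_apply_subset ℝ v

theorem sum_apply {Ω : TopologicalSpace.Opens ST} (f : Fin 3 → 𝓓(Ω, ℝ)) (z : ST) :
    (∑ k, f k) z = ∑ k, f k z := by
  simp [Fin.sum_univ_three]

theorem tsupport_spaceDiv_subset {Ω : TopologicalSpace.Opens ST} {ψ : Fin 3 → 𝓓(Ω, ℝ)} {s : Set ST}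
    (h : ∀ k, tsupport (ψ k) ⊆ s) : tsupport (spaceDiv ψ) ⊆ s := by
  have h1 : tsupport (spaceDiv ψ) ⊆ ⋃ k, tsupport (ψ k) := by
    refine closure_minimal (fun z hz => ?_) (isClosed_iUnion_of_finite fun k => isClosed_tsupport _)
    by_contra h'
    rw [mem_iUnion, not_exists] at h'
    refine hz ?_
    rw [spaceDiv, sum_apply]
    exact Finset.sum_eq_zero fun k _ => image_eq_zero_of_notMem_tsupport
      fun h2 => h' k (tsupport_lineDeriv_subset _ _ h2)
  exact h1.trans (iUnion_subset h)

theorem satisfiesLocalPressureExpansion_of_apply_eq (hΘ : IsCutoff Θ) (hu : VelocityDecay T u)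
    {p : 𝓓'(slab 0 T, ℝ)} {x₁ : E3} {S : ℝ} (hS : 0 < S)
    (hp : ∀ (k : Fin 3) (ψ : 𝓓(slab 0 T, ℝ)),
      p (∂_{spaceDir k} ψ) = expansionPressure hΘ hu x₁ hS (∂_{spaceDir k} ψ)) :
    SatisfiesLocalPressureExpansion Θ T u p :=
  fun x₀ R hR => ⟨timeShift Θ u x₁ x₀ S R, integrableOn_timeShift hΘ hu x₁ x₀ hS hR,
    fun ψ hψ => expansionHolds_of_apply_eq hΘ hu hS hR (tsupport_spaceDiv_subset hψ) <| by
      rw [← expansionPressure_apply hΘ hu x₁ hS, spaceDiv, map_sum, map_sum]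
      exact Finset.sum_congr rfl fun k _ => hp k (ψ k)⟩

theorem lineDeriv_eq_of_apply_eq {p q : 𝓓'(slab 0 T, ℝ)} {k : Fin 3}
    (h : ∀ ψ : 𝓓(slab 0 T, ℝ), p (∂_{spaceDir k} ψ) = q (∂_{spaceDir k} ψ)) :
    (∂_{spaceDir k} p : 𝓓'(slab 0 T, ℝ)) = ∂_{spaceDir k} q := by
  ext ψ
  rw [Distribution.lineDerivOp_apply_apply, Distribution.lineDerivOp_apply_apply, map_neg, map_neg,
    h]

/-! ### The momentum equation tested with convolutions -/

theorem VelocityDecay.integrable_sum_mul_test (hu : VelocityDecay T u) (i : Fin 3)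
    (φ : 𝓓(slab 0 T, ℝ)) : Integrable (fun z => u z i * φ z) (slabMeasure T) ∧
      ∀ j, Integrable (fun z => u z i * u z j * φ z) (slabMeasure T) := by
  obtain ⟨ρ, hρ0, hρ⟩ := exists_support_radius φ
  obtain ⟨M, hM0, hM⟩ := exists_test_bound φ
  set s := Metric.ball (0 : E3) ρ ×ˢ Ioo (-ρ) ρ with hs
  have hsm : MeasurableSet s := measurableSet_ball.prod measurableSet_Ioo
  have h0 : ∀ z, z ∉ s → φ z = 0 := fun z hz => by
    refine image_eq_zero_of_notMem_tsupport (hρ z ?_)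
    by_contra! h
    exact hz ⟨by simpa using h.1, abs_lt.1 h.2⟩
  have hI := ((integrable_indicator_iff hsm).2 (hu.integrableOn_cylinder ρ ρ)).const_mul M
  have key : ∀ (a : ℝ) (z : ST), |a| ≤ ‖u z‖ + ‖u z‖ ^ 2 →
      ‖a * φ z‖ ≤ M * s.indicator (fun z => ‖u z‖ + ‖u z‖ ^ 2) z := by
    intro a z ha
    by_cases hz : z ∈ s
    · rw [indicator_of_mem hz, norm_mul, mul_comm]
      exact mul_le_mul (hM z) ha (abs_nonneg _) hM0
    · rw [indicator_of_notMem hz, h0 z hz]; simp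
  have hφ : AEStronglyMeasurable φ (slabMeasure T) := φ.continuous.aestronglyMeasurable
  refine ⟨hI.mono' ((hu.aestronglyMeasurable_coord i).mul hφ) (Eventually.of_forall fun z =>
    key _ z ((abs_coord_le _ i).trans (by nlinarith [sq_nonneg ‖u z‖]))), fun j =>
    hI.mono' (((hu.aestronglyMeasurable_coord i).mul (hu.aestronglyMeasurable_coord j)).mul hφ)
    (Eventually.of_forall fun z => key _ z ?_)⟩
  exact (abs_velocity_mul_le u i j z).trans (by linarith [norm_nonneg (u z)])

theorem velocityTerm_eq (hu : VelocityDecay T u) (k : Fin 3) (ψ : 𝓓(slab 0 T, ℝ)) :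
    velocityTerm T u k ψ = (∫ z, u z k * (∂_{timeDir} ψ + spaceLaplacian ψ) z ∂(slabMeasure T)) +
      ∑ j : Fin 3, ∫ z, u z k * u z j * (∂_{spaceDir j} ψ) z ∂(slabMeasure T) := by
  rw [← integral_finsetSum _ fun j _ => (hu.integrable_sum_mul_test k _).2 j, ← integral_add
    (hu.integrable_sum_mul_test k _).1 (integrable_finsetSum _ fun j _ =>
      (hu.integrable_sum_mul_test k _).2 j)]
  refine integral_congr_ae (Eventually.of_forall fun z => ?_)
  simp only [add_apply, mul_add, Finset.mul_sum, mul_assoc]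

theorem lineDeriv_time_add_laplacian (χ : 𝓓(slab 0 T, ℝ)) (v : ST) :
    (∂_{timeDir} (∂_{v} χ) + spaceLaplacian (∂_{v} χ) : 𝓓(slab 0 T, ℝ)) =
      ∂_{v} (∂_{timeDir} χ + spaceLaplacian χ) := by
  simp only [spaceLaplacian, Fin.sum_univ_three, LineDeriv.lineDerivOp_add]
  rw [lineDeriv_comm χ timeDir v]
  simp only [lineDeriv_comm _ v (spaceDir _)]

/-- The i-th momentum equation is tested with ∂_iχ and summed over i. The terms linear in u combine
into the divergence equation tested with ∂_tχ + Δχ and vanish. -/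
theorem SolvesNSE.pressure_laplacian {p : 𝓓'(slab 0 T, ℝ)} (hp : SolvesNSE T u p)
    (hu : VelocityDecay T u) (χ : 𝓓(slab 0 T, ℝ)) :
    p (spaceLaplacian χ) = - ∑ i : Fin 3, ∑ j : Fin 3,
      ∫ z, u z i * u z j * (∂_{spaceDir i} (∂_{spaceDir j} χ)) z ∂(slabMeasure T) := by
  have h1 : ∑ i : Fin 3, (velocityTerm T u i (∂_{spaceDir i} χ) +
      p (∂_{spaceDir i} (∂_{spaceDir i} χ))) = 0 :=
    Finset.sum_eq_zero fun i _ => hp.momentum i _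
  have h2 := hp.divergence (∂_{timeDir} χ + spaceLaplacian χ)
  change ∫ z, _ ∂(slabMeasure T) = 0 at h2
  rw [integral_finsetSum _ fun j _ => (hu.integrable_sum_mul_test j _).1] at h2
  simp_rw [velocityTerm_eq hu, lineDeriv_time_add_laplacian, Finset.sum_add_distrib] at h1
  rw [h2, zero_add, ← map_sum] at h1
  rw [eq_neg_iff_add_eq_zero, add_comm]
  refine Eq.trans ?_ h1
  congr 1
  refine Finset.sum_congr rfl fun i _ => Finset.sum_congr rfl fun j _ => ?_
  rw [lineDeriv_comm]

end

section

/-! ### Identification of the pressure gradient -/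

variable {Θ : E3 → ℝ} {T : EReal} {u : ST → E3}

theorem lineDeriv_lineDeriv_testConv_truncNewton {R : ℝ} (hR : 0 < R) (φ : 𝓓(slab 0 T, ℝ))
    (i j : Fin 3) (z : ST) :
    (∂_{spaceDir i} (∂_{spaceDir j} (testConv (isKernel_truncNewton hR) φ))) z =
      rieszRR i j (slice φ z.2) z.1 - spaceConv (scaledKernel R i j) φ z := by
  rw [lineDeriv_testConv, lineDeriv_testConv, testConv_apply, slice_lineDeriv, slice_lineDeriv,
    integral_truncNewton_mul_pd_pd (isTest_slice φ z.2) hR]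
  rfl

theorem spaceLaplacian_testConv_truncNewton {R : ℝ} (hR : 0 < R) (φ : 𝓓(slab 0 T, ℝ)) :
    spaceLaplacian (testConv (isKernel_truncNewton hR) φ) =
      - φ - testConv (isKernel_traceKernel hR) φ := by
  ext z
  have h := integral_truncNewton_mul_laplacian (isTest_slice φ z.2) hR z.1
  simp_rw [spaceLaplacian, lineDeriv_testConv]
  rw [sum_apply]
  simp_rw [testConv_apply, slice_lineDeriv]
  exact h

theorem integral_pd_eq_zero {g : E3 → ℝ} (hg : IsTest g) (k : Fin 3) : ∫ x, pd k g x = 0 := by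
  have h := integral_mul_pd_comp_sub (f := fun _ => (1 : ℝ)) contDiff_const hg 0 k
  have h0 : ∀ z : E3, pd k (fun _ : E3 => (1 : ℝ)) z = 0 := fun z => by simp [pd]
  simp only [h0, one_mul, zero_mul, integral_zero] at h
  rwa [integral_sub_left_eq_self (fun x => pd k g x)] at h

/-- A spatial derivative has zero integral at each time, so the normalization, and with it the
dependence on the base ball, drops out. -/
theorem expansionFunctional_lineDeriv (x₀ : E3) (R : ℝ) (k : Fin 3) (ψ : 𝓓(slab 0 T, ℝ)) :
    expansionFunctional Θ u x₀ R (∂_{spaceDir k} ψ) = ∑ i : Fin 3, ∑ j : Fin 3,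
      ∫ z, u z i * u z j * rieszRR i j (slice (∂_{spaceDir k} ψ) z.2) z.1 ∂(slabMeasure T) := by
  refine Finset.sum_congr rfl fun i _ => Finset.sum_congr rfl fun j _ => ?_
  refine integral_congr_ae (Eventually.of_forall fun z => ?_)
  simp only [expansionDensity]
  rw [slice_lineDeriv, integral_pd_eq_zero (isTest_slice ψ z.2), mul_zero, sub_zero]

theorem exists_spaceConv_scaledKernel_bound (ψ : 𝓓(slab 0 T, ℝ)) (i j k : Fin 3) :
    ∃ C : ℝ, 0 ≤ C ∧ ∀ R : ℝ, 1 ≤ R → ∀ z : ST,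
      |spaceConv (scaledKernel R i j) (∂_{spaceDir k} ψ : 𝓓(slab 0 T, ℝ)) z| ≤ C * weight z.1 ∧
      |spaceConv (scaledKernel R i j) (∂_{spaceDir k} ψ : 𝓓(slab 0 T, ℝ)) z| ≤ C * (R ^ 4)⁻¹ := by
  obtain ⟨ρ, hρ0, hρ⟩ := exists_support_radius ψ
  obtain ⟨M, hM0, hM⟩ := exists_test_bound ψ
  obtain ⟨C, hC0, hC⟩ := scaledKernel_conv_pd_bound i j k ρ hρ0
  refine ⟨C * M, by positivity, fun R hR z => ?_⟩
  have e : spaceConv (scaledKernel R i j) (∂_{spaceDir k} ψ : 𝓓(slab 0 T, ℝ)) z =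
      ∫ w, scaledKernel R i j w * pd k (slice ψ z.2) (z.1 - w) := by
    rw [← slice_lineDeriv]; rfl
  rw [e]
  exact hC (slice ψ z.2) M R (isTest_slice ψ z.2) (fun x => hM (x, z.2)) (fun x hx =>
    image_eq_zero_of_notMem_tsupport (f := ψ) (hρ (x, z.2) (Or.inl hx))) hR z.1

theorem continuous_spaceConv_scaledKernel (R : ℝ) (i j : Fin 3) (φ : 𝓓(slab 0 T, ℝ)) :
    Continuous (spaceConv (scaledKernel R i j) φ) :=
  (contDiff_spaceConv (contDiff_scaledKernel R i j).continuous.locallyIntegrable φ.contDiff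
    φ.hasCompactSupport).continuous

theorem VelocityDecay.integrable_mul_spaceConv_scaledKernel (hu : VelocityDecay T u)
    (ψ : 𝓓(slab 0 T, ℝ)) (i j k : Fin 3) {R : ℝ} (hR : 1 ≤ R) :
    Integrable (fun z => u z i * u z j *
      spaceConv (scaledKernel R i j) (∂_{spaceDir k} ψ : 𝓓(slab 0 T, ℝ)) z) (slabMeasure T) := by
  obtain ⟨C, -, hC⟩ := exists_spaceConv_scaledKernel_bound ψ i j k
  exact hu.integrable_mul i j (continuous_spaceConv_scaledKernel R i j _).aestronglyMeasurable
    fun z => (hC R hR z).1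

/-- Dominated convergence: the R-independent bound by the weight gives the majorant C |u|² (1 +
|x|)^{-4}, and the bound by R^{-4} gives pointwise convergence. -/
theorem VelocityDecay.tendsto_integral_scaledKernel (hu : VelocityDecay T u)
    (ψ : 𝓓(slab 0 T, ℝ)) (i j k : Fin 3) :
    Tendsto (fun R : ℝ => ∫ z, u z i * u z j *
      spaceConv (scaledKernel R i j) (∂_{spaceDir k} ψ : 𝓓(slab 0 T, ℝ)) z ∂(slabMeasure T))
      atTop (𝓝 0) := by
  obtain ⟨C, hC0, hC⟩ := exists_spaceConv_scaledKernel_bound ψ i j k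
  have h4 : Tendsto (fun R : ℝ => C * (R ^ 4)⁻¹) atTop (𝓝 0) := by
    simpa using (tendsto_inv_atTop_zero.comp
      (tendsto_pow_atTop (α := ℝ) (n := 4) (by norm_num))).const_mul C
  rw [← integral_zero ST ℝ (μ := slabMeasure T)]
  refine tendsto_integral_filter_of_dominated_convergence (fun z => C * (‖u z‖ ^ 2 * weight z.1))
    ?_ ?_ (hu.integrable_weight.const_mul C) (Eventually.of_forall fun z => ?_)
  · filter_upwards [eventually_ge_atTop 1] with R hR
    exact (hu.integrable_mul_spaceConv_scaledKernel ψ i j k hR).aestronglyMeasurable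
  · filter_upwards [eventually_ge_atTop 1] with R hR
    refine Eventually.of_forall fun z => ?_
    rw [norm_mul]
    calc _ ≤ ‖u z‖ ^ 2 * (C * weight z.1) :=
          mul_le_mul (abs_velocity_mul_le u i j z) (hC R hR z).1 (abs_nonneg _) (by positivity)
      _ = _ := by ring
  · have h : Tendsto (fun R : ℝ =>
        spaceConv (scaledKernel R i j) (∂_{spaceDir k} ψ : 𝓓(slab 0 T, ℝ)) z) atTop (𝓝 0) :=
      squeeze_zero_norm' ((eventually_ge_atTop 1).mono fun R hR => (hC R hR z).2) h4
    simpa using h.const_mul (u z i * u z j)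

/-- The convolution is O(R^{-3}) and lives on a cylinder of radius 3R with bounded time extent, so
the integral is controlled by the vanishing average in `VelocityDecay.tendsto_cylinder`. -/
theorem VelocityDecay.tendsto_integral_traceKernel (hu : VelocityDecay T u)
    (φ : 𝓓(slab 0 T, ℝ)) {f : ST → ℝ} (hf : ∀ z, |f z| ≤ ‖u z‖ + ‖u z‖ ^ 2) :
    Tendsto (fun R : ℝ => ∫ z, f z * spaceConv (traceKernel R) φ z ∂(slabMeasure T))
      atTop (𝓝 0) := by
  obtain ⟨ρ, hρ0, hρ⟩ := exists_support_radius φ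
  obtain ⟨M, hM0, hM⟩ := exists_test_bound φ
  obtain ⟨C, hC0, hC⟩ := abs_traceKernel_bound
  set V := volume.real (Metric.ball (0 : E3) ρ)
  have hlim := (hu.tendsto_cylinder hρ0).const_mul (C * M * V)
  rw [mul_zero] at hlim
  refine squeeze_zero_norm' ?_ hlim
  -- For R ≥ ρ the support radius 2R + ρ of the convolution is at most 3R.
  filter_upwards [eventually_ge_atTop ρ] with R hR
  have hR0 : 0 < R := hρ0.trans_le hR
  set s := Metric.ball (0 : E3) (3 * R) ×ˢ Ioo (-ρ) ρ with hs
  have hsm : MeasurableSet s := measurableSet_ball.prod measurableSet_Ioo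
  have hI := ((integrable_indicator_iff hsm).2 (hu.integrableOn_cylinder (3 * R) ρ)).const_mul
    (C * M * V * (R ^ 3)⁻¹)
  have hzero : ∀ z : ST, ρ ≤ ‖z.1‖ ∨ ρ ≤ |z.2| → φ z = 0 := fun z hz =>
    image_eq_zero_of_notMem_tsupport (hρ z hz)
  have hout : ∀ z, z ∉ s → spaceConv (traceKernel R) φ z = 0 := by
    intro z hz
    rcases le_or_gt ρ |z.2| with h | h
    · refine integral_eq_zero_of_ae (Eventually.of_forall fun w => ?_)
      simp [hzero (z.1 - w, z.2) (Or.inr h)]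
    · refine spaceConv_eq_zero (fun _ => traceKernel_eq_zero hR0) (fun z h => hzero z (Or.inl h)) ?_
      by_contra! h'
      exact hz ⟨by rw [mem_ball_zero_iff]; linarith, abs_lt.1 h⟩
  have hbound : ∀ z, |spaceConv (traceKernel R) φ z| ≤ C * M * V * (R ^ 3)⁻¹ := by
    intro z
    have := abs_integral_mul_comp_sub_le (k := traceKernel R) (g := slice φ z.2) (x := z.1)
      (by positivity : 0 ≤ C * (R ^ 3)⁻¹) (fun x => hM (x, z.2))
      (fun x hx => hzero (x, z.2) (Or.inl hx)) fun w _ => hC R w hR0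
    refine this.trans (le_of_eq ?_)
    ring
  calc _ ≤ ∫ z, C * M * V * (R ^ 3)⁻¹ * s.indicator (fun z => ‖u z‖ + ‖u z‖ ^ 2) z
        ∂(slabMeasure T) := by
        refine norm_integral_le_of_norm_le hI (Eventually.of_forall fun z => ?_)
        by_cases hz : z ∈ s
        · rw [indicator_of_mem hz, norm_mul, mul_comm]
          exact mul_le_mul (hbound z) (hf z) (abs_nonneg _) (by positivity)
        · rw [indicator_of_notMem hz, hout z hz]; simp
    _ = _ := by
        rw [integral_const_mul, integral_indicator hsm]
        ring

theorem abs_coord_le_add (i : Fin 3) (z : ST) : |u z i| ≤ ‖u z‖ + ‖u z‖ ^ 2 :=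
  (abs_coord_le _ i).trans (by nlinarith [sq_nonneg ‖u z‖])

theorem abs_velocity_mul_le_add (i j : Fin 3) (z : ST) : |u z i * u z j| ≤ ‖u z‖ + ‖u z‖ ^ 2 :=
  (abs_velocity_mul_le u i j z).trans (by linarith [norm_nonneg (u z)])

theorem velocityTerm_testConv (hu : VelocityDecay T u) {R : ℝ} (hR : 0 < R) (k : Fin 3)
    (ψ : 𝓓(slab 0 T, ℝ)) :
    velocityTerm T u k (testConv (isKernel_traceKernel hR) ψ) =
      ((∫ z, u z k * spaceConv (traceKernel R) (∂_{timeDir} ψ : 𝓓(slab 0 T, ℝ)) z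
        ∂(slabMeasure T)) +
      ∑ j : Fin 3, ∫ z, u z k * spaceConv (traceKernel R)
        (∂_{spaceDir j} (∂_{spaceDir j} ψ) : 𝓓(slab 0 T, ℝ)) z ∂(slabMeasure T)) +
      ∑ j : Fin 3, ∫ z, u z k * u z j *
        spaceConv (traceKernel R) (∂_{spaceDir j} ψ : 𝓓(slab 0 T, ℝ)) z ∂(slabMeasure T) := by
  rw [velocityTerm_eq hu]
  simp_rw [spaceLaplacian, lineDeriv_testConv]
  congr 1
  have h1 := fun φ : 𝓓(slab 0 T, ℝ) =>
    (hu.integrable_sum_mul_test k (testConv (isKernel_traceKernel hR) φ)).1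
  change ∫ z, u z k * _ ∂_ = (∫ z, u z k * testConv (isKernel_traceKernel hR) (∂_{timeDir} ψ) z
    ∂(slabMeasure T)) + ∑ j : Fin 3, ∫ z, u z k * testConv (isKernel_traceKernel hR)
        (∂_{spaceDir j} (∂_{spaceDir j} ψ)) z ∂(slabMeasure T)
  rw [← integral_finsetSum _ fun j _ => h1 _,
    ← integral_add (h1 _) (integrable_finsetSum _ fun j _ => h1 _)]
  refine integral_congr_ae (Eventually.of_forall fun z => ?_)
  simp only [add_apply, sum_apply, mul_add, Finset.mul_sum]

/-- Since the convolution is spatial, every derivative can be left on ψ; no decay of derivatives of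
the trace kernel is needed. The value 0 for R ≤ 0 is irrelevant in the limit. -/
theorem tendsto_velocityTerm_testConv (hu : VelocityDecay T u) (k : Fin 3) (ψ : 𝓓(slab 0 T, ℝ)) :
    Tendsto (fun R : ℝ => if hR : 0 < R then
      velocityTerm T u k (testConv (isKernel_traceKernel hR) ψ) else 0) atTop (𝓝 0) := by
  have h := ((hu.tendsto_integral_traceKernel (∂_{timeDir} ψ) (abs_coord_le_add k)).add
    (tendsto_finsetSum Finset.univ fun j _ => hu.tendsto_integral_traceKernel
      (∂_{spaceDir j} (∂_{spaceDir j} ψ)) (abs_coord_le_add k))).add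
    (tendsto_finsetSum Finset.univ fun j _ => hu.tendsto_integral_traceKernel
      (∂_{spaceDir j} ψ) (abs_velocity_mul_le_add k j))
  simp only [Finset.sum_const_zero, add_zero] at h
  refine h.congr' ?_
  filter_upwards [eventually_gt_atTop 0] with R hR
  rw [dif_pos hR, velocityTerm_testConv hu hR]

/-- An exact identity at finite R, combining two uses of the equations: the pressure equation tested
with χ = (η_R E) * ∂_kψ, and the momentum equation tested with τ_R * ψ to eliminate the error p(τ_R
* ∂_kψ) left by the truncation. -/
theorem SolvesNSE.pressure_sub_expansionFunctional {p : 𝓓'(slab 0 T, ℝ)} (hp : SolvesNSE T u p)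
    (hu : VelocityDecay T u) (x₀ : E3) (S : ℝ) (k : Fin 3) (ψ : 𝓓(slab 0 T, ℝ)) {R : ℝ}
    (hR : 0 < R) (hR1 : 1 ≤ R) :
    p (∂_{spaceDir k} ψ) - expansionFunctional Θ u x₀ S (∂_{spaceDir k} ψ) =
      velocityTerm T u k (testConv (isKernel_traceKernel hR) ψ) -
      ∑ i : Fin 3, ∑ j : Fin 3, ∫ z, u z i * u z j *
        spaceConv (scaledKernel R i j) (∂_{spaceDir k} ψ : 𝓓(slab 0 T, ℝ)) z ∂(slabMeasure T) := by
  set φ : 𝓓(slab 0 T, ℝ) := ∂_{spaceDir k} ψ with hφ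
  set χ := testConv (isKernel_truncNewton hR) φ with hχ
  have h1 := hp.pressure_laplacian hu χ
  have h2 := hp.momentum k (testConv (isKernel_traceKernel hR) ψ)
  rw [lineDeriv_testConv, ← hφ] at h2
  rw [hχ, spaceLaplacian_testConv_truncNewton hR, map_sub, map_neg, ← hχ] at h1
  have h3 : ∀ i j, ∫ z, u z i * u z j * (∂_{spaceDir i} (∂_{spaceDir j} χ)) z ∂(slabMeasure T) =
      (∫ z, u z i * u z j * rieszRR i j (slice φ z.2) z.1 ∂(slabMeasure T)) -
        ∫ z, u z i * u z j * spaceConv (scaledKernel R i j) φ z ∂(slabMeasure T) := by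
    intro i j
    have hA := (hu.integrable_sum_mul_test i (∂_{spaceDir i} (∂_{spaceDir j} χ))).2 j
    have hB := hu.integrable_mul_spaceConv_scaledKernel ψ i j k hR1
    rw [eq_sub_iff_add_eq, ← integral_add hA hB]
    refine integral_congr_ae (Eventually.of_forall fun z => ?_)
    simp only
    rw [hχ, lineDeriv_lineDeriv_testConv_truncNewton hR, ← hφ]
    ring
  simp_rw [h3, Finset.sum_sub_distrib] at h1
  rw [hφ, expansionFunctional_lineDeriv, ← hφ]
  linarith

theorem SolvesNSE.pressure_apply_lineDeriv {p : 𝓓'(slab 0 T, ℝ)} (hp : SolvesNSE T u p)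
    (hu : VelocityDecay T u) (x₀ : E3) (S : ℝ) (k : Fin 3) (ψ : 𝓓(slab 0 T, ℝ)) :
    p (∂_{spaceDir k} ψ) = expansionFunctional Θ u x₀ S (∂_{spaceDir k} ψ) := by
  rw [← sub_eq_zero]
  have h := (tendsto_velocityTerm_testConv hu k ψ).sub
    (tendsto_finsetSum Finset.univ fun i _ => tendsto_finsetSum Finset.univ fun j _ =>
      hu.tendsto_integral_scaledKernel ψ i j k)
  simp only [Finset.sum_const_zero, sub_zero] at h
  -- The left side does not depend on R, while the expression equal to it for all R ≥ 1 tends to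
  -- zero.
  refine tendsto_nhds_unique (tendsto_const_nhds.congr' ?_) h
  filter_upwards [eventually_ge_atTop 1] with R hR1
  have hR : 0 < R := by linarith
  rw [dif_pos hR]
  exact hp.pressure_sub_expansionFunctional hu x₀ S k ψ hR hR1

end

end

end NSPressure

theorem theorem1p2 (Θ : E3 → ℝ) (hΘ : IsCutoff Θ) (T : EReal) (hT : 0 < T)
    (u₀ : E3 → E3) (hu₀ : LocallyIntegrable u₀ volume) (hdiv : DivFree u₀)
    (u : ST → E3) (p : 𝓓'(slab 0 T, ℝ))
    (hu₀_decay : Tendsto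
      (fun R : ℝ => (∫⁻ x in Metric.ball (0 : E3) R, ‖u₀ x‖ₑ) / ENNReal.ofReal (R ^ 3))
      atTop (𝓝 0))
    (hu_decay : Tendsto
      (fun R : ℝ => (∫⁻ t in timeInterval 0 T, ∫⁻ x in Metric.ball (0 : E3) R, ‖u (x, t)‖ₑ ^ 2) /
        ENNReal.ofReal (R ^ 3))
      atTop (𝓝 0))
    (hsol : IsWeakSolution T u₀ u p) :
    SatisfiesLocalPressureExpansion Θ T u p ∧
      ∃ q : 𝓓'(slab 0 T, ℝ), IsExpansionPressure Θ T u q ∧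
        ∀ k : Fin 3, (∂_{spaceDir k} p : 𝓓'(slab 0 T, ℝ)) = ∂_{spaceDir k} q := by
  have hu : VelocityDecay T u := velocityDecay_of_tendsto hsol.uloc.1 hu_decay
  have hp : ∀ (k : Fin 3) (ψ : 𝓓(slab 0 T, ℝ)),
      p (∂_{spaceDir k} ψ) = expansionPressure hΘ hu 0 one_pos (∂_{spaceDir k} ψ) :=
    fun k ψ => hsol.nse.pressure_apply_lineDeriv hu 0 1 k ψ
  exact ⟨satisfiesLocalPressureExpansion_of_apply_eq hΘ hu one_pos hp,
    expansionPressure hΘ hu 0 one_pos, isExpansionPressure_expansionPressure hΘ hu 0 one_pos,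
    fun k => lineDeriv_eq_of_apply_eq (hp k)⟩
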